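/- **Setting.** Let $d\ge 2$, $T\ge 1$, let $\mathcal X,\mathcal Y\subset\mathbb R^d$ be compact, and let $D=\max\{\sup_{x_1,x_2\in\mathcal X}\|x_1-x_2\|_1,\ \sup_{y_1,y_2\in\mathcal Y}\|y_1-y_2\|_1\}>0$. Let $\hat{\mathcal X},\hat{\mathcal Y}$ be the convex hulls of $\mathcal X,\mathcal Y$ (so $\hat{\mathcal X}=\mathcal X$, $\hat{\mathcal Y}=\mathcal Y$ if these are convex). Let $f$ be a real function of $(x,y)$ (no convexity or concavity is assumed) that is differentiable in $x$ and in $y$ at all points of $\hat{\mathcal X}\times\hat{\mathcal Y}$ (one-sidedly, i.e. within $\hat{\mathcal X}$, resp. $\hat{\mathcal Y}$), with $$\max\{\|\nabla_x f(x,y)\|_\infty,\ \|\nabla_y f(x,y)\|_\infty\}\le G,$$ $$\|\nabla_x f(x,y)-\nabla_x f(x',y')\|_\infty+\|\nabla_y f(x,y)-\nabla_y f(x',y')\|_\infty\le L\|x-x'\|_1+L\|y-y'\|_1$$ for all $x,x'\in\hat{\mathcal X}$, $y,y'\in\hat{\mathcal Y}$, where $L\ge 0$. For probability measures $P,Q$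 write $f(P,y)=\mathbb E_{x\sim P}f(x,y)$ and $f(x,Q)=\mathbb E_{y\sim Q}f(x,y)$. **Algorithm (optimistic FTPL with $m$ samples per round).** All perturbation vectors below are drawn afresh; all their coordinates, for both players and over all draws, are independent and exponentially distributed with mean $\eta$. - Round $1$: for $j=1,\dots,m$ draw $\sigma_j,\sigma'_j$ and let $x_{1,j}\in\arg\min_{x\in\mathcal X}-\langle\sigma_j,x\rangle$, $y_{1,j}\in\arg\max_{y\in\mathcal Y}\langle\sigma'_j,y\rangle$. - Round $t\ge 2$, guesses: for $j=1,\dots,m$ draw $\sigma_j,\sigma'_j$ and let $\tilde x_{t-1,j}\in\arg\min_{x\in\mathcal X}\sum_{i<t}f(x,Q_i)-\langle\sigma_j,x\rangle$, $\tilde y_{t-1,j}\in\arg\max_{y\in\mathcal Y}\sum_{i<t}f(P_i,y)+\langle\sigma'_j,y\rangle$; let $\tilde P_{t-1},\tilde Q_{t-1}$ be the empirical distributions of $(\tilde x_{t-1,j})_j$, $(\tilde y_{t-1,j})_j$. - Round $t\ge 2$, actions: for $j=1,\dots,m$ draw new $\sigma_j,\sigma'_j$ and let $x_{t,j}\in\arg\min_{x\in\mathcal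 X}\sum_{i<t}f(x,Q_i)+f(x,\tilde Q_{t-1})-\langle\sigma_j,x\rangle$, $y_{t,j}\in\arg\max_{y\in\mathcal Y}\sum_{i<t}f(P_i,y)+f(\tilde P_{t-1},y)+\langle\sigma'_j,y\rangle$. - In every round $P_t,Q_t$ are the empirical distributions of $(x_{t,j})_j$, $(y_{t,j})_j$. **Theorem.** There is a universal constant $C>0$ such that, in every such setting, if the algorithm is run for $T$ rounds with $\eta=10d^2D(L+1)$ and $m=T$ (the optimizers being selected in any way), then for every $\delta\in(0,1)$, with probability at least $1-\delta$, $$\sup_{x\in\mathcal X,\,y\in\mathcal Y}\frac1T\sum_{t=1}^T\bigl(f(P_t,y)-f(x,Q_t)\bigr)\le C\left(\frac{d^2D^2(L+1)\log d}{T}+\frac{GD}{T}\sqrt{\log\frac8\delta}\right)+C\min\left\{D^2L,\ \frac{d^2G^2\log T+dG^2\log\frac8\delta}{LT}\right\},$$ where for $L=0$ the minimum is read as $0$. -/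

import Mathlib

open MeasureTheory ProbabilityTheory

namespace OFTPL

/-- The `ℓ₁` norm on `ℝ^d`. -/
noncomputable def l1 {d : ℕ} (v : EuclideanSpace ℝ (Fin d)) : ℝ := ∑ k, |v k|

/-- The `ℓ_∞` norm on `ℝ^d`. -/
noncomputable def linf {d : ℕ} (v : EuclideanSpace ℝ (Fin d)) : ℝ := ⨆ k, |v k|

/-- The `ℓ₁` diameter of a (nonempty, bounded) set. -/
noncomputable def l1Diam {d : ℕ} (S : Set (EuclideanSpace ℝ (Fin d))) : ℝ :=
  sSup {r | ∃ a ∈ S, ∃ b ∈ S, r = l1 (a - b)}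

/-- The empirical distribution of the points `z 0, …, z (m - 1)`. -/
noncomputable def empirical {d m : ℕ} (z : Fin m → EuclideanSpace ℝ (Fin d)) :
    Measure (EuclideanSpace ℝ (Fin d)) :=
  (m : ENNReal)⁻¹ • ∑ j, Measure.dirac (z j)

/-- `f(P, y)`, the expectation of `f(x, y)` for `x ∼ P`. -/
noncomputable def payoffLeft {d : ℕ}
    (f : EuclideanSpace ℝ (Fin d) → EuclideanSpace ℝ (Fin d) → ℝ)
    (P : Measure (EuclideanSpace ℝ (Fin d))) (y : EuclideanSpace ℝ (Fin d)) : ℝ :=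
  ∫ x, f x y ∂P

/-- `f(x, Q)`, the expectation of `f(x, y)` for `y ∼ Q`. -/
noncomputable def payoffRight {d : ℕ}
    (f : EuclideanSpace ℝ (Fin d) → EuclideanSpace ℝ (Fin d) → ℝ)
    (x : EuclideanSpace ℝ (Fin d)) (Q : Measure (EuclideanSpace ℝ (Fin d))) : ℝ :=
  ∫ y, f x y ∂Q

/-- The linear perturbation function `z ↦ ⟨s, z⟩`. -/
noncomputable def perturbation {d : ℕ} (s : Fin d → ℝ) (z : EuclideanSpace ℝ (Fin d)) : ℝ :=
  ∑ k, s k * z k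

/-- `z` is a minimizer of `h` over `S`. -/
def IsArgmin {d : ℕ} (S : Set (EuclideanSpace ℝ (Fin d)))
    (h : EuclideanSpace ℝ (Fin d) → ℝ) (z : EuclideanSpace ℝ (Fin d)) : Prop :=
  z ∈ S ∧ IsMinOn h S z

/-- `z` is a maximizer of `h` over `S`. -/
def IsArgmax {d : ℕ} (S : Set (EuclideanSpace ℝ (Fin d)))
    (h : EuclideanSpace ℝ (Fin d) → ℝ) (z : EuclideanSpace ℝ (Fin d)) : Prop :=
  z ∈ S ∧ IsMaxOn h S z

/-- The minimizing player `x` and the maximizing player `y`. -/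
inductive Player
  | x
  | y

/-- In every round after the first one the players first compute a guess and then their action,
with fresh perturbations for each of the two. -/
inductive Phase
  | guess
  | play

/-- Optimistic FTPL for a nonconvex-nonconcave game, along one realization `s` of the
perturbation vectors, with `T` rounds (numbered from `0`) and `m` samples per round.
`x t j` and `y t j` are the support points of the distributions `P_t` and `Q_t` played in
round `t`; `xg t j` and `yg t j` are those of the predictions with guess `0` (that is, of the
distributions written with a tilde and with index `t - 1`), which serve as guesses in round `t`.
The values `xg t j`, `yg t j` for the first round `t = 0` are not used.
The optimization oracles may return any optimizer. -/
structure IsRun {d T m : ℕ} (X Y : Set (EuclideanSpace ℝ (Fin d)))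
    (f : EuclideanSpace ℝ (Fin d) → EuclideanSpace ℝ (Fin d) → ℝ)
    (s : Player → Phase → Fin T → Fin m → Fin d → ℝ)
    (x y xg yg : Fin T → Fin m → EuclideanSpace ℝ (Fin d)) : Prop where
  first_x : ∀ t : Fin T, (t : ℕ) = 0 → ∀ j,
    IsArgmin X (fun z => - perturbation (s .x .play t j) z) (x t j)
  first_y : ∀ t : Fin T, (t : ℕ) = 0 → ∀ j,
    IsArgmax Y (fun z => perturbation (s .y .play t j) z) (y t j)
  guess_x : ∀ t : Fin T, 0 < (t : ℕ) → ∀ j,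
    IsArgmin X (fun z => (∑ i ∈ Finset.Iio t, payoffRight f z (empirical (y i)))
      - perturbation (s .x .guess t j) z) (xg t j)
  guess_y : ∀ t : Fin T, 0 < (t : ℕ) → ∀ j,
    IsArgmax Y (fun z => (∑ i ∈ Finset.Iio t, payoffLeft f (empirical (x i)) z)
      + perturbation (s .y .guess t j) z) (yg t j)
  play_x : ∀ t : Fin T, 0 < (t : ℕ) → ∀ j,
    IsArgmin X (fun z => (∑ i ∈ Finset.Iio t, payoffRight f z (empirical (y i)))
      + payoffRight f z (empirical (yg t))
      - perturbation (s .x .play t j) z) (x t j)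
  play_y : ∀ t : Fin T, 0 < (t : ℕ) → ∀ j,
    IsArgmax Y (fun z => (∑ i ∈ Finset.Iio t, payoffLeft f (empirical (x i)) z)
      + payoffLeft f (empirical (xg t)) z
      + perturbation (s .y .play t j) z) (y t j)

end OFTPL

/-!
Why the duality gap of optimistic FTPL is small without any convexity.

Regard each player as facing continuous losses on a compact set: `f(·, Q_t)` for the minimizing
player and `-f(P_t, ·)` for the maximizing one. For such a loss `g` let `conj g s` be the maximum
of `⟨s, x⟩ - g x`, and let `potential η g` be its expectation over the exponential perturbation
`s`. The potential is convex in `g`, whatever the shape of `g`, and its derivative is minus the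
law of the perturbed best response; playing FTPL in expectation is therefore a dual gradient
method. The potential is also smooth with respect to the `ℓ₁`-Lipschitz seminorm
(`potential_add_le`): a perturbation of the loss with small Lipschitz constant is dominated by
shifts of single coordinates of `s`, and by memorylessness a shift by `τ` changes expectations only
by a factor `1 + O(τ / η)`. Convexity and smoothness together give co-coercivity
(`sq_mean_sub_mean_le`): the movement of the best response is controlled by a Bregman gap of the
potential.

The regret of one player (`regret_le`) is at most the price of the perturbation, of order
`η D log d`, plus the sum of the squared errors of the guesses, minus the Bregman gaps that measure
the player's own movement. The error of a guess is measured by the Lipschitz constant of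
`f(·, Q_t) - f(·, Q̃_{t-1})`. It is at most of order `L D`, which gives the first argument of the
minimum (`duality_gap_le_of_controls`). It is also at most `L` times the movement of the opponent
plus the sampling error, and the movement is paid for by the opponent's Bregman gaps
(`duality_gap_le_of_typical`). The sampling error is controlled through finitely many test
functions, the coordinates of the gradient at the points of a `D / T`-net of the convex hull
(`LipschitzGradients.exists_controls`), to which Hoeffding's inequality and a union bound over test
functions and rounds apply (`measure_not_typical_le`); this gives the second argument.

There remains the difference between the payoffs of the empirical distributions and those of their
expectations. By Fubini it is centered given the past, and subgaussian with variance proxy of order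
`(G D)² / T` in each round, so that its sum over the `T` rounds is of order
`G D √(log (8 / δ))` (`measure_sum_gap_ge_le`).

The optimizers returned by the oracles need not be measurable. The conjugate is Lipschitz in `s`,
hence differentiable almost everywhere by Rademacher's theorem, and where it is differentiable its
gradient is the only optimizer. The measurable function `sel` built from this gradient defines a
canonical run, and almost surely every run coincides with it (`IsRun.eq_points`).
-/


set_option linter.unusedSectionVars false

open MeasureTheory ProbabilityTheory

namespace OFTPL

/-! ### The exponential perturbation -/

/-- The law of one perturbation vector: independent exponential coordinates with mean `η`. -/
noncomputable def expLaw (d : ℕ) (η : ℝ) : Measure (Fin d → ℝ) :=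
  Measure.pi fun _ => expMeasure η⁻¹

lemma isProbabilityMeasure_expLaw {d : ℕ} {η : ℝ} (hη : 0 < η) :
    IsProbabilityMeasure (expLaw d η) := by
  have := isProbabilityMeasure_expMeasure (inv_pos.2 hη)
  unfold expLaw
  infer_instance

lemma expMeasure_eq_withDensity (r : ℝ) :
    expMeasure r = volume.withDensity (fun t => ENNReal.ofReal (exponentialPDFReal r t)) := rfl

lemma integrable_exponentialPDFReal {r : ℝ} (hr : 0 < r) :
    Integrable (exponentialPDFReal r) := by
  refine ⟨(stronglyMeasurable_exponentialPDFReal r).aestronglyMeasurable, ?_⟩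
  rw [hasFiniteIntegral_iff_ofReal (Filter.Eventually.of_forall (exponentialPDFReal_nonneg hr))]
  have := lintegral_exponentialPDF_eq_one hr
  unfold exponentialPDF at this
  rw [this]
  exact ENNReal.one_lt_top

/-- The density of `expLaw d η`. -/
noncomputable def expDensity (d : ℕ) (η : ℝ) (s : Fin d → ℝ) : ℝ :=
  ∏ k, exponentialPDFReal η⁻¹ (s k)

lemma measurable_expDensity (d : ℕ) (η : ℝ) : Measurable (expDensity d η) := by
  unfold expDensity
  fun_prop

lemma expLaw_eq_withDensity {d : ℕ} {η : ℝ} (hη : 0 < η) :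
    expLaw d η = volume.withDensity (fun s => ENNReal.ofReal (expDensity d η s)) := by
  have hr := inv_pos.2 hη
  have := isProbabilityMeasure_expMeasure hr
  refine Measure.pi_eq fun A hA => ?_
  have hint : ∀ k, Integrable ((A k).indicator (exponentialPDFReal η⁻¹)) :=
    fun k => (integrable_exponentialPDFReal hr).indicator (hA k)
  have hnn : ∀ k t, 0 ≤ (A k).indicator (exponentialPDFReal η⁻¹) t := fun k t =>
    Set.indicator_nonneg (fun t _ => exponentialPDFReal_nonneg hr t) t
  have h1 : ∀ k, expMeasure η⁻¹ (A k)
      = ENNReal.ofReal (∫ t, (A k).indicator (exponentialPDFReal η⁻¹) t) := by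
    intro k
    rw [ofReal_integral_eq_lintegral_ofReal (hint k) (Filter.Eventually.of_forall (hnn k)),
      expMeasure_eq_withDensity, withDensity_apply _ (hA k), ← lintegral_indicator (hA k)]
    refine lintegral_congr fun t => ?_
    by_cases ht : t ∈ A k <;> simp [ht]
  rw [withDensity_apply _ (MeasurableSet.univ_pi hA),
    ← lintegral_indicator (MeasurableSet.univ_pi hA)]
  simp_rw [h1]
  rw [← ENNReal.ofReal_prod_of_nonneg fun k _ => integral_nonneg (hnn k),
    ← integral_fintype_prod_volume_eq_prod, ofReal_integral_eq_lintegral_ofReal]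
  · refine lintegral_congr fun s => ?_
    by_cases hs : s ∈ Set.univ.pi A
    · rw [Set.indicator_of_mem hs]
      congr 1
      refine Finset.prod_congr rfl fun k _ => ?_
      rw [Set.indicator_of_mem (hs k (Set.mem_univ k))]
    · rw [Set.indicator_of_notMem hs]
      simp only [Set.mem_pi, Set.mem_univ, true_implies, not_forall] at hs
      obtain ⟨k, hk⟩ := hs
      rw [Finset.prod_eq_zero (Finset.mem_univ k) (Set.indicator_of_notMem hk _)]
      simp
  · exact Integrable.fintype_prod hint
  · exact Filter.Eventually.of_forall fun s => Finset.prod_nonneg fun k _ => hnn k _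

lemma expLaw_absolutelyContinuous {d : ℕ} {η : ℝ} (hη : 0 < η) :
    expLaw d η ≪ (volume : Measure (Fin d → ℝ)) := by
  rw [expLaw_eq_withDensity hη]
  exact withDensity_absolutelyContinuous _ _

lemma expDensity_sub_single_le {d : ℕ} {η τ : ℝ} (hη : 0 < η) (hτ : 0 ≤ τ) (i : Fin d)
    (s : Fin d → ℝ) :
    expDensity d η (s - (Pi.single i τ : Fin d → ℝ)) ≤ Real.exp (τ / η) * expDensity d η s := by
  have hr := inv_pos.2 hη
  have key : exponentialPDFReal η⁻¹ (s i - τ)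
      ≤ Real.exp (τ / η) * exponentialPDFReal η⁻¹ (s i) := by
    simp only [exponentialPDFReal, gammaPDFReal, sub_self, Real.rpow_zero, Real.rpow_one,
      Real.Gamma_one, div_one, mul_one]
    by_cases h : 0 ≤ s i - τ
    · rw [if_pos h, if_pos (by linarith)]
      rw [mul_left_comm, ← Real.exp_add]
      apply le_of_eq
      congr 2
      field_simp
      ring
    · rw [if_neg h]
      split_ifs <;> positivity
  unfold expDensity
  rw [← Finset.mul_prod_erase _ _ (Finset.mem_univ i),
    ← Finset.mul_prod_erase Finset.univ (fun k => exponentialPDFReal η⁻¹ (s k)) (Finset.mem_univ i),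
    ← mul_assoc]
  have h2 : ∏ k ∈ Finset.univ.erase i, exponentialPDFReal η⁻¹ ((s - (Pi.single i τ : Fin d → ℝ)) k)
      = ∏ k ∈ Finset.univ.erase i, exponentialPDFReal η⁻¹ (s k) := by
    refine Finset.prod_congr rfl fun k hk => ?_
    rw [Pi.sub_apply, Pi.single_eq_of_ne (Finset.ne_of_mem_erase hk), sub_zero]
  rw [h2]
  refine mul_le_mul_of_nonneg_right ?_
    (Finset.prod_nonneg fun _ _ => exponentialPDFReal_nonneg hr _)
  simpa using key

lemma lintegral_expLaw_add_single_le {d : ℕ} {η τ : ℝ} (hη : 0 < η) (hτ : 0 ≤ τ) (i : Fin d)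
    {F : (Fin d → ℝ) → ENNReal} (hF : Measurable F) :
    ∫⁻ s, F (s + (Pi.single i τ : Fin d → ℝ)) ∂expLaw d η
      ≤ ENNReal.ofReal (Real.exp (τ / η)) * ∫⁻ s, F s ∂expLaw d η := by
  have hm : Measurable fun s => ENNReal.ofReal (expDensity d η s) :=
    (measurable_expDensity d η).ennreal_ofReal
  rw [expLaw_eq_withDensity hη, lintegral_withDensity_eq_lintegral_mul _ hm hF,
    lintegral_withDensity_eq_lintegral_mul _ hm
      (show Measurable fun s => F (s + (Pi.single i τ : Fin d → ℝ)) by fun_prop),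
    ← lintegral_const_mul _ (hm.mul hF)]
  simp only [Pi.mul_apply]
  rw [← lintegral_add_right_eq_self
    (fun s => ENNReal.ofReal (Real.exp (τ / η)) * (ENNReal.ofReal (expDensity d η s) * F s))
    (Pi.single i τ)]
  refine lintegral_mono fun s => ?_
  rw [← mul_assoc]
  refine mul_le_mul_left ?_ _
  rw [← ENNReal.ofReal_mul (Real.exp_pos _).le]
  refine ENNReal.ofReal_le_ofReal ?_
  have h := expDensity_sub_single_le hη hτ i (s + (Pi.single i τ : Fin d → ℝ))
  rwa [add_sub_cancel_right] at h

/-- Memorylessness: a shift by `τ` of one coordinate of the perturbation changes the expectation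
of a function with values in `[0, D]` by at most `D τ / η` in the upward direction. -/
lemma integral_expLaw_add_single_sub_le {d : ℕ} {η τ D : ℝ} (hη : 0 < η) (hτ : 0 ≤ τ) (i : Fin d)
    {F : (Fin d → ℝ) → ℝ} (hF : Measurable F) (h0 : ∀ s, 0 ≤ F s) (hD : ∀ s, F s ≤ D) :
    ∫ s, F (s + (Pi.single i τ : Fin d → ℝ)) ∂expLaw d η - ∫ s, F s ∂expLaw d η ≤ D * (τ / η) := by
  have := isProbabilityMeasure_expLaw (d := d) hη
  have hD0 : 0 ≤ D := (h0 0).trans (hD 0)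
  have hint : ∀ G : (Fin d → ℝ) → ℝ, Measurable G → (∀ s, 0 ≤ G s) → (∀ s, G s ≤ D) →
      Integrable G (expLaw d η) := fun G hG h0 hD =>
    Integrable.of_bound hG.aestronglyMeasurable D
      (Filter.Eventually.of_forall fun s => by rw [Real.norm_of_nonneg (h0 s)]; exact hD s)
  have hF' : Measurable fun s => F (s + (Pi.single i τ : Fin d → ℝ)) := by fun_prop
  have i1 := hint F hF h0 hD
  have i2 := hint _ hF' (fun s => h0 _) (fun s => hD _)
  have key : ∫ s, F (s + (Pi.single i τ : Fin d → ℝ)) ∂expLaw d η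
      ≤ Real.exp (τ / η) * ∫ s, F s ∂expLaw d η := by
    have h := lintegral_expLaw_add_single_le hη hτ i hF.ennreal_ofReal
    rw [← ofReal_integral_eq_lintegral_ofReal i1 (Filter.Eventually.of_forall h0),
      ← ofReal_integral_eq_lintegral_ofReal i2 (Filter.Eventually.of_forall fun s => h0 _),
      ← ENNReal.ofReal_mul (Real.exp_pos _).le] at h
    exact (ENNReal.ofReal_le_ofReal_iff
      (mul_nonneg (Real.exp_pos _).le (integral_nonneg h0))).1 h
  set A := ∫ s, F (s + (Pi.single i τ : Fin d → ℝ)) ∂expLaw d η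
  set B := ∫ s, F s ∂expLaw d η
  have hA : A ≤ D := by
    have := integral_mono i2 (integrable_const D) (fun s => hD _)
    simpa using this
  have hA0 : 0 ≤ A := integral_nonneg fun s => h0 _
  have hτη : 0 ≤ τ / η := by positivity
  have h1 : Real.exp (-(τ / η)) * A ≤ B := by
    rw [Real.exp_neg, inv_mul_le_iff₀ (Real.exp_pos _)]
    exact key
  have h2 : 1 - τ / η ≤ Real.exp (-(τ / η)) := by
    have := Real.add_one_le_exp (-(τ / η)); linarith
  nlinarith [mul_le_mul_of_nonneg_right h2 hA0, mul_le_mul_of_nonneg_right hA hτη]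

lemma integral_exp_half_expMeasure {η : ℝ} (hη : 0 < η) :
    Integrable (fun t => Real.exp (t / (2 * η))) (expMeasure η⁻¹) ∧
      ∫ t, Real.exp (t / (2 * η)) ∂expMeasure η⁻¹ = 2 := by
  have hr := inv_pos.2 hη
  have hm : Measurable fun t => ENNReal.ofReal (exponentialPDFReal η⁻¹ t) :=
    (measurable_exponentialPDFReal _).ennreal_ofReal
  have hEq : (fun t => (ENNReal.ofReal (exponentialPDFReal η⁻¹ t)).toReal
      * Real.exp (t / (2 * η))) = fun t => 2 * exponentialPDFReal (2 * η)⁻¹ t := by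
    funext t
    rw [ENNReal.toReal_ofReal (exponentialPDFReal_nonneg hr t)]
    simp only [exponentialPDFReal, gammaPDFReal, sub_self, Real.rpow_zero, Real.rpow_one,
      Real.Gamma_one, div_one, mul_one]
    split_ifs
    · rw [mul_assoc, ← Real.exp_add, mul_inv, ← mul_assoc, ← mul_assoc]
      rw [mul_inv_cancel₀ (two_ne_zero), one_mul]
      congr 2
      field_simp
      ring
    · simp
  have hr2 : 0 < (2 * η)⁻¹ := by positivity
  constructor
  · rw [expMeasure_eq_withDensity, integrable_withDensity_iff_integrable_smul₀' hm.aemeasurable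
      (Filter.Eventually.of_forall fun _ => ENNReal.ofReal_lt_top)]
    simp only [smul_eq_mul]
    rw [hEq]
    exact (integrable_exponentialPDFReal hr2).const_mul 2
  · rw [expMeasure_eq_withDensity, integral_withDensity_eq_integral_toReal_smul hm
      (Filter.Eventually.of_forall fun _ => ENNReal.ofReal_lt_top)]
    simp only [smul_eq_mul]
    rw [hEq, integral_const_mul, integral_eq_lintegral_of_nonneg_ae
      (Filter.Eventually.of_forall (exponentialPDFReal_nonneg hr2))
      (stronglyMeasurable_exponentialPDFReal _).aestronglyMeasurable]
    have := lintegral_exponentialPDF_eq_one hr2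
    unfold exponentialPDF at this
    rw [this]
    simp

lemma integrable_exp_half_expLaw {d : ℕ} {η : ℝ} (hη : 0 < η) (k : Fin d) :
    Integrable (fun s : Fin d → ℝ => Real.exp (s k / (2 * η))) (expLaw d η) := by
  have := isProbabilityMeasure_expMeasure (inv_pos.2 hη)
  exact integrable_comp_eval (μ := fun _ : Fin d => expMeasure η⁻¹) (i := k)
    (integral_exp_half_expMeasure hη).1

lemma integral_exp_half_expLaw {d : ℕ} {η : ℝ} (hη : 0 < η) (k : Fin d) :
    ∫ s : Fin d → ℝ, Real.exp (s k / (2 * η)) ∂expLaw d η = 2 := by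
  have := isProbabilityMeasure_expMeasure (inv_pos.2 hη)
  have h := (measurePreserving_eval (fun _ : Fin d => expMeasure η⁻¹) k).map_eq
  have h2 := (integral_exp_half_expMeasure hη).2
  rw [← h, integral_map (measurable_pi_apply k).aemeasurable (by fun_prop)] at h2
  exact h2

lemma expLaw_ae_nonneg {d : ℕ} {η : ℝ} (hη : 0 < η) :
    ∀ᵐ s ∂expLaw d η, ∀ k, 0 ≤ s k := by
  have := isProbabilityMeasure_expMeasure (inv_pos.2 hη)
  rw [ae_all_iff]
  intro k
  have h1 : ∀ᵐ t ∂expMeasure η⁻¹, 0 ≤ t := by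
    rw [expMeasure_eq_withDensity, ae_withDensity_iff
      (measurable_exponentialPDFReal _).ennreal_ofReal]
    refine Filter.Eventually.of_forall fun t ht => ?_
    by_contra h
    exact ht (exponentialPDF_of_neg (not_le.1 h))
  exact (measurePreserving_eval (fun _ : Fin d => expMeasure η⁻¹) k).quasiMeasurePreserving.ae h1

lemma integrable_sum_abs_expLaw {d : ℕ} {η : ℝ} (hη : 0 < η) :
    Integrable (fun s : Fin d → ℝ => ∑ k, |s k|) (expLaw d η) := by
  refine integrable_finsetSum _ fun k _ => ?_
  refine ((integrable_exp_half_expLaw hη k).const_mul (2 * η)).mono'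
    (measurable_pi_apply k).abs.aestronglyMeasurable ?_
  filter_upwards [expLaw_ae_nonneg hη] with s hs
  rw [Real.norm_eq_abs, abs_abs, abs_of_nonneg (hs k)]
  have := Real.add_one_le_exp (s k / (2 * η))
  have h2 : s k / (2 * η) ≤ Real.exp (s k / (2 * η)) := by linarith
  rwa [div_le_iff₀' (by positivity)] at h2

/-- A function bounded by the largest coordinate of the perturbation has expectation at most
`4 η log d`: bound the maximum by a soft maximum and the logarithm by its tangent at the mean. -/
lemma integral_le_of_le_max {d : ℕ} (hd : 2 ≤ d) {η R : ℝ} (hη : 0 < η) (hR : 0 ≤ R)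
    {F : (Fin d → ℝ) → ℝ} (hF : Integrable F (expLaw d η))
    (h : ∀ s : Fin d → ℝ, (∀ k, 0 ≤ s k) → ∃ k, F s ≤ R * s k) :
    ∫ s, F s ∂expLaw d η ≤ 4 * η * R * Real.log d := by
  have := isProbabilityMeasure_expLaw (d := d) hη
  have hd0 : (0 : ℝ) < 2 * d := by positivity
  set S : (Fin d → ℝ) → ℝ := fun s => ∑ k, Real.exp (s k / (2 * η)) with hS
  have hSi : Integrable S (expLaw d η) :=
    integrable_finsetSum _ fun k _ => integrable_exp_half_expLaw hη k
  have hSv : ∫ s, S s ∂expLaw d η = 2 * d := by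
    rw [hS, integral_finsetSum _ fun k _ => integrable_exp_half_expLaw hη k]
    simp_rw [integral_exp_half_expLaw hη]
    simp [mul_comm]
  have hle : ∀ᵐ s ∂expLaw d η,
      F s ≤ R * (2 * η) * (Real.log (2 * d) + S s / (2 * d) - 1) := by
    filter_upwards [expLaw_ae_nonneg hη] with s hs
    obtain ⟨k, hk⟩ := h s hs
    have h1 : Real.exp (s k / (2 * η)) ≤ S s :=
      Finset.single_le_sum (f := fun k => Real.exp (s k / (2 * η)))
        (fun _ _ => (Real.exp_pos _).le) (Finset.mem_univ k)
    have hSpos : 0 < S s := (Real.exp_pos _).trans_le h1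
    have h2 : s k / (2 * η) ≤ Real.log (S s) := (Real.le_log_iff_exp_le hSpos).2 h1
    have h3 : Real.log (S s) ≤ Real.log (2 * d) + S s / (2 * d) - 1 := by
      have := Real.log_le_sub_one_of_pos (div_pos hSpos hd0)
      rw [Real.log_div hSpos.ne' hd0.ne'] at this
      linarith
    have h4 : s k ≤ 2 * η * (Real.log (2 * d) + S s / (2 * d) - 1) := by
      rw [← div_le_iff₀' (by positivity)]
      exact h2.trans h3
    calc F s ≤ R * s k := hk
      _ ≤ R * (2 * η * (Real.log (2 * d) + S s / (2 * d) - 1)) := by gcongr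
      _ = _ := by ring
  have hi : Integrable (fun s => R * (2 * η) * (Real.log (2 * d) + S s / (2 * d) - 1))
      (expLaw d η) :=
    (((integrable_const _).add (hSi.div_const _)).sub (integrable_const _)).const_mul _
  refine (integral_mono_ae hF hi hle).trans ?_
  have hv : ∫ s, (Real.log (2 * d) + S s / (2 * d) - 1) ∂expLaw d η
      = Real.log (2 * d) + (∫ s, S s ∂expLaw d η) / (2 * d) - 1 := by
    rw [integral_sub (by fun_prop) (by fun_prop), integral_add (by fun_prop) (by fun_prop),
      integral_div]
    simp
  rw [integral_const_mul, hv, hSv]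
  rw [div_self hd0.ne', add_sub_cancel_right, Real.log_mul two_ne_zero (by positivity)]
  have hlog : Real.log 2 ≤ Real.log d := Real.log_le_log two_pos (by exact_mod_cast hd)
  calc R * (2 * η) * (Real.log 2 + Real.log d)
      ≤ R * (2 * η) * (Real.log d + Real.log d) := by gcongr
    _ = _ := by ring


/-! ### The perturbed best response -/

lemma l1_nonneg {d : ℕ} (v : EuclideanSpace ℝ (Fin d)) : 0 ≤ l1 v :=
  Finset.sum_nonneg fun _ _ => abs_nonneg _

lemma continuous_l1 {d : ℕ} : Continuous (l1 (d := d)) := by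
  unfold l1
  fun_prop

lemma abs_coord_le_l1 {d : ℕ} (v : EuclideanSpace ℝ (Fin d)) (k : Fin d) : |v k| ≤ l1 v :=
  Finset.single_le_sum (f := fun k => |v k|) (fun _ _ => abs_nonneg _) (Finset.mem_univ k)

lemma l1_sub_comm {d : ℕ} (v w : EuclideanSpace ℝ (Fin d)) : l1 (v - w) = l1 (w - v) := by
  unfold l1
  exact Finset.sum_congr rfl fun k _ => by simpa using abs_sub_comm (v k) (w k)

lemma perturbation_add {d : ℕ} (s u : Fin d → ℝ) (z : EuclideanSpace ℝ (Fin d)) :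
    perturbation (s + u) z = perturbation s z + perturbation u z := by
  simp [perturbation, add_mul, Finset.sum_add_distrib]

lemma perturbation_sub {d : ℕ} (s : Fin d → ℝ) (z w : EuclideanSpace ℝ (Fin d)) :
    perturbation s (z - w) = perturbation s z - perturbation s w := by
  simp [perturbation, mul_sub, Finset.sum_sub_distrib]

lemma perturbation_single {d : ℕ} (i : Fin d) (τ : ℝ) (z : EuclideanSpace ℝ (Fin d)) :
    perturbation (Pi.single i τ) z = τ * z i := by
  classical
  simp [perturbation, Pi.single_apply, ite_mul]

lemma continuous_perturbation {d : ℕ} :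
    Continuous fun p : (Fin d → ℝ) × EuclideanSpace ℝ (Fin d) => perturbation p.1 p.2 := by
  unfold perturbation
  fun_prop

/-- The Borel σ-algebra on the space of loss functions. -/
instance instMeasurableSpaceLoss {d : ℕ} (X : Set (EuclideanSpace ℝ (Fin d))) :
    MeasurableSpace C(X, ℝ) := borel _

instance instBorelSpaceLoss {d : ℕ} (X : Set (EuclideanSpace ℝ (Fin d))) :
    BorelSpace C(X, ℝ) := ⟨rfl⟩

section Oracle

variable {d : ℕ} {X : Set (EuclideanSpace ℝ (Fin d))}

lemma continuous_perturbed (g : C(X, ℝ)) (s : Fin d → ℝ) :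
    Continuous fun x : X => perturbation s x - g x :=
  (continuous_perturbation.comp (continuous_const.prodMk continuous_subtype_val)).sub g.continuous

variable [Nonempty X]

/-- A measurable retraction of `ℝ^d` onto `X`. -/
noncomputable def retract (X : Set (EuclideanSpace ℝ (Fin d))) [Nonempty X]
    (v : EuclideanSpace ℝ (Fin d)) : X :=
  open Classical in
  ⟨if v ∈ X then v else (Classical.arbitrary X : X), by
    split_ifs with h
    · exact h
    · exact (Classical.arbitrary X).2⟩

lemma retract_coe (x : X) : retract X x = x := by
  ext1
  simp [retract]

variable [CompactSpace X]

/-- The convex conjugate of the loss `g` on `X`, that is, minus the optimal value of the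
perturbed problem. -/
noncomputable def conj (g : C(X, ℝ)) (s : Fin d → ℝ) : ℝ :=
  ⨆ x : X, (perturbation s x - g x)

lemma le_conj (g : C(X, ℝ)) (s : Fin d → ℝ) (x : X) : perturbation s x - g x ≤ conj g s :=
  le_ciSup (isCompact_range (continuous_perturbed g s)).bddAbove x

lemma exists_eq_conj (g : C(X, ℝ)) (s : Fin d → ℝ) :
    ∃ x : X, conj g s = perturbation s x - g x := by
  obtain ⟨x, -, hx⟩ := isCompact_univ.exists_isMaxOn Set.univ_nonempty
    (continuous_perturbed g s).continuousOn
  exact ⟨x, le_antisymm (ciSup_le fun z => hx (Set.mem_univ z)) (le_conj g s x)⟩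

lemma exists_norm_bound (X : Set (EuclideanSpace ℝ (Fin d))) [CompactSpace X] :
    ∃ R : ℝ, 0 ≤ R ∧ ∀ x : X, ∀ k, |(x : EuclideanSpace ℝ (Fin d)) k| ≤ R := by
  obtain ⟨R, hR⟩ := (isCompact_range (f := fun x : X => l1 (x : EuclideanSpace ℝ (Fin d)))
    (continuous_l1.comp continuous_subtype_val)).bddAbove
  refine ⟨max R 0, le_max_right _ _, fun x k => ?_⟩
  exact (abs_coord_le_l1 _ k).trans ((hR ⟨x, rfl⟩).trans (le_max_left _ _))

lemma conj_sub_le {R : ℝ} (hR : ∀ x : X, ∀ k, |(x : EuclideanSpace ℝ (Fin d)) k| ≤ R)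
    (g h : C(X, ℝ)) (s t : Fin d → ℝ) :
    conj g s - conj h t ≤ ‖g - h‖ + R * ∑ k, |s k - t k| := by
  obtain ⟨x, hx⟩ := exists_eq_conj g s
  have h1 := le_conj h t x
  have h2 : h x - g x ≤ ‖g - h‖ := by
    have := (g - h).norm_coe_le_norm x
    rw [ContinuousMap.sub_apply, Real.norm_eq_abs] at this
    linarith [neg_abs_le (g x - h x)]
  have h3 : perturbation s x - perturbation t x ≤ R * ∑ k, |s k - t k| := by
    unfold perturbation
    rw [← Finset.sum_sub_distrib, Finset.mul_sum]
    refine Finset.sum_le_sum fun k _ => ?_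
    rw [← sub_mul]
    refine (le_abs_self _).trans ?_
    rw [abs_mul, mul_comm]
    exact mul_le_mul_of_nonneg_right (hR x k) (abs_nonneg _)
  linarith

lemma abs_conj_sub_le {R : ℝ} (hR : ∀ x : X, ∀ k, |(x : EuclideanSpace ℝ (Fin d)) k| ≤ R)
    (g h : C(X, ℝ)) (s t : Fin d → ℝ) :
    |conj g s - conj h t| ≤ ‖g - h‖ + R * ∑ k, |s k - t k| := by
  rw [abs_sub_le_iff]
  refine ⟨conj_sub_le hR g h s t, ?_⟩
  have := conj_sub_le hR h g t s
  simpa only [norm_sub_rev h g, abs_sub_comm (t _) (s _)] using this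

lemma continuous_conj : Continuous (Function.uncurry (conj (X := X))) := by
  obtain ⟨R, -, hR⟩ := exists_norm_bound X
  rw [continuous_iff_continuousAt]
  rintro ⟨g, s⟩
  rw [ContinuousAt, tendsto_iff_dist_tendsto_zero]
  refine squeeze_zero (fun _ => dist_nonneg)
    (g := fun p : C(X, ℝ) × (Fin d → ℝ) => ‖p.1 - g‖ + R * ∑ k, |p.2 k - s k|) ?_ ?_
  · rintro ⟨h, t⟩
    exact abs_conj_sub_le hR h g t s
  · have : Continuous fun p : C(X, ℝ) × (Fin d → ℝ) => ‖p.1 - g‖ + R * ∑ k, |p.2 k - s k| := by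
      fun_prop
    have h := this.tendsto (g, s)
    simpa using h

lemma lipschitz_conj (g : C(X, ℝ)) : ∃ C, LipschitzWith C (conj g) := by
  obtain ⟨R, hR0, hR⟩ := exists_norm_bound X
  refine ⟨⟨R * d, by positivity⟩, LipschitzWith.of_dist_le_mul fun s t => ?_⟩
  have h := abs_conj_sub_le hR g g s t
  rw [sub_self, norm_zero, zero_add] at h
  refine h.trans ?_
  change _ ≤ R * d * dist s t
  rw [mul_assoc]
  gcongr
  calc ∑ k, |s k - t k| ≤ ∑ _k : Fin d, dist s t :=
        Finset.sum_le_sum fun k _ => dist_le_pi_dist s t k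
    _ = d * dist s t := by simp

lemma measurable_retract : Measurable (retract X) := by
  classical
  refine Measurable.subtype_mk ?_
  exact Measurable.ite (isCompact_iff_compactSpace.2 ‹_›).measurableSet measurable_id
    measurable_const

/-- The gradient of the conjugate. -/
noncomputable def gradConj (g : C(X, ℝ)) (s : Fin d → ℝ) : EuclideanSpace ℝ (Fin d) :=
  WithLp.toLp 2 fun k => fderiv ℝ (conj g) s (Pi.single k 1)

/-- A measurable version of the perturbed best response to the loss `g`: where the conjugate is
differentiable, its gradient is the unique minimizer of `g x - ⟨s, x⟩`. -/
noncomputable def sel (g : C(X, ℝ)) (s : Fin d → ℝ) : X := retract X (gradConj g s)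

lemma measurable_sel_prod :
    Measurable fun p : C(X, ℝ) × (Fin d → ℝ) => sel p.1 p.2 := by
  refine measurable_retract.comp ?_
  refine (WithLp.measurable_toLp 2 _).comp ?_
  refine measurable_pi_lambda _ fun k => ?_
  exact measurable_fderiv_apply_const_with_param ℝ continuous_conj _

lemma measurable_sel_comp {α : Type*} [MeasurableSpace α] {g : α → C(X, ℝ)} {s : α → Fin d → ℝ}
    (hg : Measurable g) (hs : Measurable s) : Measurable fun a => sel (g a) (s a) := by
  have h := Measurable.comp (g := fun p : C(X, ℝ) × (Fin d → ℝ) => sel p.1 p.2)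
    measurable_sel_prod (hg.prodMk hs)
  exact h

lemma measurable_sel (g : C(X, ℝ)) : Measurable (sel g) :=
  measurable_sel_comp measurable_const measurable_id

/-- `x` is a perturbed best response to the loss `g`. -/
def IsBest (g : C(X, ℝ)) (s : Fin d → ℝ) (x : X) : Prop :=
  ∀ z : X, perturbation s z - g z ≤ perturbation s x - g x

lemma IsBest.eq_conj {g : C(X, ℝ)} {s : Fin d → ℝ} {x : X} (h : IsBest g s x) :
    conj g s = perturbation s x - g x :=
  le_antisymm (ciSup_le h) (le_conj g s x)

lemma IsBest.eq_sel {g : C(X, ℝ)} {s : Fin d → ℝ} {x : X} (h : IsBest g s x)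
    (hd : DifferentiableAt ℝ (conj g) s) : x = sel g s := by
  have key : ∀ k, fderiv ℝ (conj g) s (Pi.single k 1) = (x : EuclideanSpace ℝ (Fin d)) k := by
    intro k
    have h1 : HasDerivAt (fun τ : ℝ => s + τ • (Pi.single k 1 : Fin d → ℝ))
        (Pi.single k 1 : Fin d → ℝ) 0 := by
      simpa using ((hasDerivAt_id (0 : ℝ)).smul_const (Pi.single k 1 : Fin d → ℝ)).const_add s
    have h2 : HasDerivAt (fun τ : ℝ => conj g (s + τ • (Pi.single k 1 : Fin d → ℝ)))
        (fderiv ℝ (conj g) s (Pi.single k 1)) 0 := by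
      have hd' : HasFDerivAt (conj g) (fderiv ℝ (conj g) s)
          (s + (0 : ℝ) • (Pi.single k 1 : Fin d → ℝ)) := by
        simpa using hd.hasFDerivAt
      exact hd'.comp_hasDerivAt 0 h1
    have h3 : HasDerivAt (fun τ : ℝ => conj g (s + τ • (Pi.single k 1 : Fin d → ℝ))
        - (conj g s + τ * (x : EuclideanSpace ℝ (Fin d)) k))
        (fderiv ℝ (conj g) s (Pi.single k 1) - (x : EuclideanSpace ℝ (Fin d)) k) 0 := by
      have := ((hasDerivAt_id (0 : ℝ)).mul_const ((x : EuclideanSpace ℝ (Fin d)) k)).const_add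
        (conj g s)
      simpa using h2.fun_sub this
    -- the affine minorant of the conjugate through `x` touches it at `s`
    have hmin : IsLocalMin (fun τ : ℝ => conj g (s + τ • (Pi.single k 1 : Fin d → ℝ))
        - (conj g s + τ * (x : EuclideanSpace ℝ (Fin d)) k)) 0 := by
      refine Filter.Eventually.of_forall fun τ => ?_
      have h4 := le_conj g (s + τ • (Pi.single k 1 : Fin d → ℝ)) x
      have h5 : perturbation (τ • (Pi.single k 1 : Fin d → ℝ)) x
          = τ * (x : EuclideanSpace ℝ (Fin d)) k := by
        rw [← Pi.single_smul, smul_eq_mul, mul_one, perturbation_single]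
      rw [perturbation_add, h5] at h4
      have h6 := h.eq_conj
      simp only [zero_smul, add_zero, zero_mul, sub_self]
      linarith
    have := hmin.hasDerivAt_eq_zero h3
    linarith
  have : gradConj g s = x := by
    ext k
    exact key k
  rw [sel, this, retract_coe]

lemma ae_differentiableAt_conj {η : ℝ} (hη : 0 < η) (g : C(X, ℝ)) :
    ∀ᵐ s ∂expLaw d η, DifferentiableAt ℝ (conj g) s := by
  obtain ⟨C, hC⟩ := lipschitz_conj g
  exact (expLaw_absolutelyContinuous hη).ae_le hC.ae_differentiableAt

lemma ae_isBest_sel {η : ℝ} (hη : 0 < η) (g : C(X, ℝ)) :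
    ∀ᵐ s ∂expLaw d η, IsBest g s (sel g s) := by
  filter_upwards [ae_differentiableAt_conj hη g] with s hs
  obtain ⟨x, hx⟩ := exists_eq_conj g s
  have hb : IsBest g s x := fun z => (le_conj g s z).trans hx.le
  rwa [← hb.eq_sel hs]

lemma ae_conj_eq {η : ℝ} (hη : 0 < η) (g : C(X, ℝ)) :
    ∀ᵐ s ∂expLaw d η, conj g s = perturbation s (sel g s) - g (sel g s) := by
  filter_upwards [ae_isBest_sel hη g] with s hs
  exact hs.eq_conj

/-- The set of perturbations for which the best response is unique is measurable, jointly in the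
loss. -/
lemma measurableSet_differentiableAt_conj :
    MeasurableSet {p : C(X, ℝ) × (Fin d → ℝ) | DifferentiableAt ℝ (conj p.1) p.2} :=
  measurableSet_of_differentiableAt_with_param ℝ continuous_conj

/-- The expectation of `h` under the law of the perturbed best response to `g`. -/
noncomputable def mean (η : ℝ) (g : C(X, ℝ)) (h : X → ℝ) : ℝ :=
  ∫ s, h (sel g s) ∂expLaw d η

lemma integrable_sel {η : ℝ} (hη : 0 < η) (g h : C(X, ℝ)) :
    Integrable (fun s => h (sel g s)) (expLaw d η) := by
  have := isProbabilityMeasure_expLaw (d := d) hη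
  exact Integrable.of_bound (h.continuous.measurable.comp (measurable_sel g)).aestronglyMeasurable
    ‖h‖ (Filter.Eventually.of_forall fun s => h.norm_coe_le_norm _)

/-- The expected conjugate, a convex potential whose gradient is minus the law of the perturbed
best response. -/
noncomputable def potential (η : ℝ) (g : C(X, ℝ)) : ℝ := ∫ s, conj g s ∂expLaw d η

lemma integrable_conj_add {η : ℝ} (hη : 0 < η) (g : C(X, ℝ)) (u : Fin d → ℝ) :
    Integrable (fun s => conj g (s + u)) (expLaw d η) := by
  have := isProbabilityMeasure_expLaw (d := d) hη
  obtain ⟨R, -, hR⟩ := exists_norm_bound X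
  have hc : Continuous fun s => conj g (s + u) :=
    continuous_conj.comp (continuous_const.prodMk (continuous_add_const u))
  refine (((integrable_sum_abs_expLaw hη).const_mul R).add
    (integrable_const |conj g u|)).mono' hc.aestronglyMeasurable ?_
  refine Filter.Eventually.of_forall fun s => ?_
  have h := abs_conj_sub_le hR g g (s + u) u
  simp only [sub_self, norm_zero, zero_add, Pi.add_apply, add_sub_cancel_right] at h
  have h2 := abs_sub_abs_le_abs_sub (conj g (s + u)) (conj g u)
  simp only [Pi.add_apply, Real.norm_eq_abs]
  linarith

lemma integrable_conj {η : ℝ} (hη : 0 < η) (g : C(X, ℝ)) :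
    Integrable (conj g) (expLaw d η) := by
  simpa using integrable_conj_add hη g 0

end Oracle


/-! ### Smoothness of the potential -/

section Smooth

variable {d : ℕ} {X : Set (EuclideanSpace ℝ (Fin d))} [Nonempty X] [CompactSpace X]

lemma mean_sub {η : ℝ} (hη : 0 < η) (g h h' : C(X, ℝ)) :
    mean η g (h - h' : C(X, ℝ)) = mean η g h - mean η g h' :=
  integral_sub (integrable_sel hη g h) (integrable_sel hη g h')

lemma mean_smul {η : ℝ} (g : C(X, ℝ)) (c : ℝ) (h : C(X, ℝ)) :
    mean η g (c • h : C(X, ℝ)) = c * mean η g h :=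
  integral_const_mul c _

lemma mean_le_of_le {η c : ℝ} (hη : 0 < η) (g h : C(X, ℝ)) (hc : ∀ x, h x ≤ c) :
    mean η g h ≤ c := by
  have := isProbabilityMeasure_expLaw (d := d) hη
  have h1 := integral_mono (integrable_sel hη g h) (integrable_const c) (fun s => hc _)
  simpa [mean] using h1

lemma le_mean_of_le {η c : ℝ} (hη : 0 < η) (g h : C(X, ℝ)) (hc : ∀ x, c ≤ h x) :
    c ≤ mean η g h := by
  have := isProbabilityMeasure_expLaw (d := d) hη
  have h1 := integral_mono (integrable_const c) (integrable_sel hη g h) (fun s => hc _)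
  simpa [mean] using h1

/-- Convexity of the potential. -/
lemma potential_add_ge {η : ℝ} (hη : 0 < η) (g w : C(X, ℝ)) :
    potential η g - mean η g w ≤ potential η (g + w) := by
  unfold potential mean
  rw [← integral_sub (integrable_conj hη g) (integrable_sel hη g w)]
  refine integral_mono_ae ((integrable_conj hη g).sub (integrable_sel hη g w))
    (integrable_conj hη (g + w)) ?_
  filter_upwards [ae_conj_eq hη g] with s hs
  have := le_conj (g + w) s (sel g s)
  rw [ContinuousMap.add_apply] at this
  linarith

lemma ae_isBest_sel_add {η : ℝ} (hη : 0 < η) (g : C(X, ℝ)) (u : Fin d → ℝ) :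
    ∀ᵐ s ∂expLaw d η, IsBest g (s + u) (sel g (s + u)) := by
  obtain ⟨C, hC⟩ := lipschitz_conj g
  have h1 : ∀ᵐ s : Fin d → ℝ, DifferentiableAt ℝ (conj g) (s + u) :=
    (measurePreserving_add_right volume u).quasiMeasurePreserving.ae hC.ae_differentiableAt
  filter_upwards [(expLaw_absolutelyContinuous hη).ae_le h1] with s hs
  obtain ⟨x, hx⟩ := exists_eq_conj g (s + u)
  have hb : IsBest g (s + u) x := fun z => (le_conj g (s + u) z).trans hx.le
  rwa [← hb.eq_sel hs]

/-- A second difference of the conjugate in a coordinate direction is controlled by the movement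
of the best response. -/
lemma second_difference_le {g : C(X, ℝ)} {s : Fin d → ℝ} {i : Fin d} {τ : ℝ}
    (hs' : IsBest g (s + (Pi.single i τ : Fin d → ℝ)) (sel g (s + (Pi.single i τ : Fin d → ℝ))))
    (z x : X) (hx : IsBest g s x) :
    τ * ((z : EuclideanSpace ℝ (Fin d)) i - (x : EuclideanSpace ℝ (Fin d)) i)
        + (perturbation s z - g z) - (perturbation s x - g x)
      ≤ τ * ((sel g (s + (Pi.single i τ : Fin d → ℝ)) : EuclideanSpace ℝ (Fin d)) i
          - (x : EuclideanSpace ℝ (Fin d)) i) := by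
  have h1 := hs' z
  have h2 := hx (sel g (s + (Pi.single i τ : Fin d → ℝ)))
  rw [perturbation_add, perturbation_add, perturbation_single, perturbation_single] at h1
  linarith

/-- Smoothness of the potential with respect to the Lipschitz seminorm dual to `ℓ₁`: the slope `a`
of the change `w` in each coordinate is matched by shifting that coordinate of the perturbation by
`± d a`, the convex combination of these `2 d` shifts absorbing the whole `ℓ₁` norm; the effect
of one shift is bounded because the exponential law is memoryless. -/
lemma potential_add_le {η : ℝ} (hη : 0 < η) (hd : 0 < d) {D a : ℝ} (ha : 0 ≤ a)
    (hD : ∀ x z : X, ∀ k, (x : EuclideanSpace ℝ (Fin d)) k - (z : EuclideanSpace ℝ (Fin d)) k ≤ D)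
    (g w : C(X, ℝ)) (hw : ∀ x z : X, w x - w z ≤ a * l1 (x - z : EuclideanSpace ℝ (Fin d))) :
    potential η (g + w) ≤ potential η g - mean η g w + 2 * d ^ 2 * D / η * a ^ 2 := by
  have := isProbabilityMeasure_expLaw (d := d) hη
  have hd' : (0 : ℝ) < d := by exact_mod_cast hd
  set τ : ℝ := d * a with hτ
  have hτ0 : 0 ≤ τ := by positivity
  let E : Fin d → (Fin d → ℝ) := fun i => Pi.single i τ
  let F : Fin d → (Fin d → ℝ) → ℝ := fun i s => (sel g s : EuclideanSpace ℝ (Fin d)) i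
  have hFm : ∀ i, Measurable (F i) := fun i => by
    have h1 : Measurable fun s => (sel g s : EuclideanSpace ℝ (Fin d)) :=
      measurable_subtype_coe.comp (measurable_sel g)
    have h2 : Continuous fun v : EuclideanSpace ℝ (Fin d) => v i := by fun_prop
    exact h2.measurable.comp h1
  have hmin : ∀ i, ∃ z : X, ∀ x : X,
      (z : EuclideanSpace ℝ (Fin d)) i ≤ (x : EuclideanSpace ℝ (Fin d)) i := fun i => by
    obtain ⟨z, -, hz⟩ := isCompact_univ.exists_isMinOn Set.univ_nonempty
      (f := fun x : X => (x : EuclideanSpace ℝ (Fin d)) i)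
      (show Continuous fun x : X => (x : EuclideanSpace ℝ (Fin d)) i by fun_prop).continuousOn
    exact ⟨z, fun x => hz (Set.mem_univ x)⟩
  choose z hz using hmin
  obtain ⟨R, -, hR⟩ := exists_norm_bound X
  have hFi : ∀ i, ∀ u : Fin d → ℝ, Integrable (fun s => F i (s + u)) (expLaw d η) := fun i u =>
    Integrable.of_bound ((hFm i).comp (measurable_id.add_const u)).aestronglyMeasurable R
      (Filter.Eventually.of_forall fun s => hR _ _)
  have hFi0 : ∀ i, Integrable (F i) (expLaw d η) := fun i => by simpa using hFi i 0
  -- the two one-sided increments of the best response, in expectation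
  have hplus : ∀ i, ∫ s, F i (s + E i) ∂expLaw d η - ∫ s, F i s ∂expLaw d η ≤ D * (τ / η) := by
    intro i
    have h := integral_expLaw_add_single_sub_le hη hτ0 i
      (F := fun s => F i s - (z i : EuclideanSpace ℝ (Fin d)) i) ((hFm i).sub_const _)
      (fun s => sub_nonneg.2 (hz i _)) (fun s => hD _ _ i)
    rw [integral_sub (hFi i _) (integrable_const _),
      integral_sub (hFi0 i) (integrable_const _)] at h
    simpa using h
  have hminus : ∀ i, ∫ s, F i s ∂expLaw d η - ∫ s, F i (s + -E i) ∂expLaw d η ≤ D * (τ / η) := by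
    intro i
    have h := integral_expLaw_add_single_sub_le hη hτ0 i
      (F := fun s => F i (s + -E i) - (z i : EuclideanSpace ℝ (Fin d)) i)
      (((hFm i).comp (measurable_id.add_const _)).sub_const _)
      (fun s => sub_nonneg.2 (hz i _)) (fun s => hD _ _ i)
    simp only [E, add_neg_cancel_right] at h
    rw [integral_sub (hFi0 i) (integrable_const _),
      integral_sub (hFi i _) (integrable_const _)] at h
    simpa using h
  let M : (Fin d → ℝ) → ℝ := fun s =>
    (d : ℝ)⁻¹ * ∑ i, (τ * (F i (s + E i) - F i s) + τ * (F i s - F i (s + -E i)))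
  have hsum : ∀ i, Integrable (fun s =>
      τ * (F i (s + E i) - F i s) + τ * (F i s - F i (s + -E i))) (expLaw d η) := fun i =>
    (((hFi i _).sub (hFi0 i)).const_mul _).add (((hFi0 i).sub (hFi i _)).const_mul _)
  have hMi : Integrable M (expLaw d η) := (integrable_finsetSum _ fun i _ => hsum i).const_mul _
  have hMle : ∫ s, M s ∂expLaw d η ≤ 2 * d ^ 2 * D / η * a ^ 2 := by
    simp only [M]
    rw [integral_const_mul, integral_finsetSum _ fun i _ => hsum i]
    have h1 : ∀ i, ∫ s, (τ * (F i (s + E i) - F i s) + τ * (F i s - F i (s + -E i))) ∂expLaw d η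
        ≤ 2 * (τ * (D * (τ / η))) := by
      intro i
      have hA : Integrable (fun s => τ * (F i (s + E i) - F i s)) (expLaw d η) :=
        ((hFi i _).sub (hFi0 i)).const_mul _
      have hB : Integrable (fun s => τ * (F i s - F i (s + -E i))) (expLaw d η) :=
        ((hFi0 i).sub (hFi i _)).const_mul _
      rw [integral_add hA hB, integral_const_mul, integral_const_mul,
        integral_sub (hFi i _) (hFi0 i), integral_sub (hFi0 i) (hFi i _)]
      have := mul_le_mul_of_nonneg_left (hplus i) hτ0
      have := mul_le_mul_of_nonneg_left (hminus i) hτ0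
      linarith
    calc (d : ℝ)⁻¹ * ∑ i, ∫ s, (τ * (F i (s + E i) - F i s)
          + τ * (F i s - F i (s + -E i))) ∂expLaw d η
        ≤ (d : ℝ)⁻¹ * ∑ _i : Fin d, 2 * (τ * (D * (τ / η))) := by
          gcongr with i
          exact h1 i
      _ = 2 * d ^ 2 * D / η * a ^ 2 := by
          rw [Finset.sum_const, Finset.card_univ, Fintype.card_fin, nsmul_eq_mul, hτ]
          field_simp
  have hpt : ∀ᵐ s ∂expLaw d η, conj (g + w) s ≤ conj g s - w (sel g s) + M s := by
    filter_upwards [ae_isBest_sel hη g, ae_all_iff.2 fun i => ae_isBest_sel_add hη g (E i),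
      ae_all_iff.2 fun i => ae_isBest_sel_add hη g (-E i)] with s h0 hp hm
    obtain ⟨y, hy⟩ := exists_eq_conj (g + w) s
    rw [hy, h0.eq_conj, ContinuousMap.add_apply]
    set x := sel g s with hx
    have hi : ∀ i, τ * |(y : EuclideanSpace ℝ (Fin d)) i - (x : EuclideanSpace ℝ (Fin d)) i|
        + ((perturbation s y - g y) - (perturbation s x - g x))
        ≤ τ * (F i (s + E i) - F i s) + τ * (F i s - F i (s + -E i)) := by
      intro i
      have hneg : -E i = (Pi.single i (-τ) : Fin d → ℝ) := by
        ext k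
        by_cases hk : k = i
        · subst hk; simp [E]
        · simp [E, hk]
      have hm' := hm i
      rw [hneg] at hm' ⊢
      have ha1 := second_difference_le (hp i) y x h0
      have ha2 := second_difference_le hm' y x h0
      have ha3 := second_difference_le (hp i) x x h0
      have ha4 := second_difference_le hm' x x h0
      simp only [F, E, ← hx] at *
      rcases abs_cases ((y : EuclideanSpace ℝ (Fin d)) i - (x : EuclideanSpace ℝ (Fin d)) i)
        with ⟨h, -⟩ | ⟨h, -⟩ <;> rw [h] <;> linarith
    have hsum' := Finset.sum_le_sum fun i (_ : i ∈ Finset.univ) => hi i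
    rw [Finset.sum_add_distrib, ← Finset.mul_sum, Finset.sum_const, Finset.card_univ,
      Fintype.card_fin, nsmul_eq_mul] at hsum'
    have hl1 : ∑ i, |(y : EuclideanSpace ℝ (Fin d)) i - (x : EuclideanSpace ℝ (Fin d)) i|
        = l1 (x - y : EuclideanSpace ℝ (Fin d)) := by
      rw [l1_sub_comm]
      rfl
    rw [hl1] at hsum'
    have hMs : a * l1 (x - y : EuclideanSpace ℝ (Fin d))
        + ((perturbation s y - g y) - (perturbation s x - g x)) ≤ M s := by
      simp only [M]
      rw [le_inv_mul_iff₀ hd']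
      refine le_trans (le_of_eq ?_) hsum'
      rw [hτ]
      ring
    have := hw x y
    linarith
  have hfin := integral_mono_ae (integrable_conj hη (g + w))
    (((integrable_conj hη g).sub (integrable_sel hη g w)).add hMi) hpt
  have hv : ∫ s, ((conj g - fun s => w (sel g s)) + M) s ∂expLaw d η
      = potential η g - mean η g w + ∫ s, M s ∂expLaw d η := by
    rw [integral_add' ((integrable_conj hη g).sub (integrable_sel hη g w)) hMi,
      integral_sub' (integrable_conj hη g) (integrable_sel hη g w)]
    rfl
  rw [hv] at hfin
  unfold potential at hfin ⊢
  linarith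

/-- The Bregman gap of the potential between `g` and `g + u`. -/
noncomputable def bregman (η : ℝ) (g u : C(X, ℝ)) : ℝ :=
  potential η g - potential η (g + u) - mean η (g + u) u

lemma bregman_nonneg {η : ℝ} (hη : 0 < η) (g u : C(X, ℝ)) : 0 ≤ bregman η g u := by
  have h := potential_add_ge hη (g + u) (-u)
  have h2 := mean_smul (η := η) (g + u) (-1) u
  rw [neg_one_smul] at h2
  rw [add_neg_cancel_right, h2] at h
  unfold bregman
  linarith

/-- Co-coercivity, the dual form of smoothness: the change of the expectation of a Lipschitz
function `h` between the best responses to `g` and to `g + u` is controlled by the Bregman gap.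
Convexity and smoothness of the potential at `g + r h` give a quadratic inequality in `r`. -/
lemma sq_mean_sub_mean_le {η : ℝ} (hη : 0 < η) (hd : 0 < d) {D b : ℝ} (hb : 0 ≤ b)
    (hD : ∀ x z : X, ∀ k, (x : EuclideanSpace ℝ (Fin d)) k - (z : EuclideanSpace ℝ (Fin d)) k ≤ D)
    (g u h : C(X, ℝ)) (hh : ∀ x z : X, h x - h z ≤ b * l1 (x - z : EuclideanSpace ℝ (Fin d))) :
    (mean η g h - mean η (g + u) h) ^ 2
      ≤ 4 * (2 * d ^ 2 * D / η) * b ^ 2 * bregman η g u := by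
  set c := 2 * (d : ℝ) ^ 2 * D / η
  set q := mean η g h - mean η (g + u) h with hq
  have key : ∀ r : ℝ, 0 ≤ c * b ^ 2 * (r * r) + (-q) * r + bregman η g u := by
    intro r
    have hr : ∀ x z : X, (r • h) x - (r • h) z
        ≤ (|r| * b) * l1 (x - z : EuclideanSpace ℝ (Fin d)) := by
      intro x z
      have h1 : |h x - h z| ≤ b * l1 (x - z : EuclideanSpace ℝ (Fin d)) := by
        rw [abs_sub_le_iff]
        exact ⟨hh x z, by rw [l1_sub_comm]; exact hh z x⟩
      rw [ContinuousMap.smul_apply, ContinuousMap.smul_apply, smul_eq_mul, smul_eq_mul, ← mul_sub]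
      refine (le_abs_self _).trans ?_
      rw [abs_mul, mul_assoc]
      exact mul_le_mul_of_nonneg_left h1 (abs_nonneg r)
    have h1 := potential_add_le hη hd (by positivity) hD g (r • h) hr
    have h2 := potential_add_ge hη (g + u) (r • h - u)
    have h3 : g + u + (r • h - u) = g + r • h := by abel
    rw [h3, mean_sub hη, mean_smul] at h2
    rw [mean_smul, mul_pow, sq_abs] at h1
    unfold bregman
    rw [hq]
    linarith
  have := discrim_le_zero key
  unfold discrim at this
  linarith

end Smooth


/-! ### Regret of one player -/

section Regret

variable {d : ℕ} {X : Set (EuclideanSpace ℝ (Fin d))} [Nonempty X] [CompactSpace X]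

lemma potential_add_le_of_le {η c : ℝ} (hη : 0 < η) (g w : C(X, ℝ)) (hc : ∀ x, c ≤ w x) :
    potential η (g + w) ≤ potential η g - c := by
  have := isProbabilityMeasure_expLaw (d := d) hη
  have h : potential η (g + w) ≤ ∫ s, (conj g s - c) ∂expLaw d η := by
    refine integral_mono (integrable_conj hη _) ((integrable_conj hη g).sub (integrable_const c))
      fun s => ?_
    obtain ⟨x, hx⟩ := exists_eq_conj (g + w) s
    have h1 := le_conj g s x
    have h2 := hc x
    simp only [hx, ContinuousMap.add_apply]
    linarith
  rw [integral_sub (integrable_conj hη g) (integrable_const c)] at h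
  simpa [potential] using h

lemma coord_sub_le_of_l1_le {D : ℝ}
    (hD : ∀ x z : X, l1 (x - z : EuclideanSpace ℝ (Fin d)) ≤ D) (x z : X) (k : Fin d) :
    (x : EuclideanSpace ℝ (Fin d)) k - (z : EuclideanSpace ℝ (Fin d)) k ≤ D :=
  (le_abs_self _).trans ((abs_coord_le_l1 (x - z : EuclideanSpace ℝ (Fin d)) k).trans (hD x z))

/-- The price of the perturbation: the potential drops by at most the loss of any fixed action, up
to the expected advantage gained from the perturbation. -/
lemma potential_zero_sub_le {η D : ℝ} (hη : 0 < η) (hd : 2 ≤ d)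
    (hD : ∀ x z : X, l1 (x - z : EuclideanSpace ℝ (Fin d)) ≤ D) (g : C(X, ℝ)) (x₀ : X) :
    potential η (0 : C(X, ℝ)) - potential η g ≤ g x₀ + 4 * η * D * Real.log d := by
  have := isProbabilityMeasure_expLaw (d := d) hη
  have hD0 : 0 ≤ D := (l1_nonneg _).trans (hD x₀ x₀)
  have hi : Integrable (fun s => conj (0 : C(X, ℝ)) s - conj g s - g x₀) (expLaw d η) :=
    ((integrable_conj hη 0).sub (integrable_conj hη g)).sub (integrable_const _)
  have h := integral_le_of_le_max hd hη hD0 hi fun s hs => by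
    obtain ⟨x, hx⟩ := exists_eq_conj (0 : C(X, ℝ)) s
    have hne : (Finset.univ : Finset (Fin d)).Nonempty :=
      Finset.univ_nonempty_iff.2 ⟨⟨0, by omega⟩⟩
    obtain ⟨k, -, hk⟩ := Finset.exists_max_image Finset.univ s hne
    refine ⟨k, ?_⟩
    have h1 := le_conj g s x₀
    have h2 : perturbation s (x - x₀ : EuclideanSpace ℝ (Fin d)) ≤ D * s k := by
      calc perturbation s (x - x₀ : EuclideanSpace ℝ (Fin d))
          ≤ ∑ i, s k * |(x - x₀ : EuclideanSpace ℝ (Fin d)) i| := by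
            refine Finset.sum_le_sum fun i _ => ?_
            calc s i * (x - x₀ : EuclideanSpace ℝ (Fin d)) i
                ≤ s i * |(x - x₀ : EuclideanSpace ℝ (Fin d)) i| :=
                  mul_le_mul_of_nonneg_left (le_abs_self _) (hs i)
              _ ≤ _ := mul_le_mul_of_nonneg_right (hk i (Finset.mem_univ i)) (abs_nonneg _)
        _ = l1 (x - x₀ : EuclideanSpace ℝ (Fin d)) * s k := by
            rw [← Finset.mul_sum, mul_comm]
            rfl
        _ ≤ D * s k := mul_le_mul_of_nonneg_right (hD x x₀) (hs k)
    rw [perturbation_sub] at h2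
    rw [hx, ContinuousMap.zero_apply]
    linarith
  have hv : ∫ s, (conj (0 : C(X, ℝ)) s - conj g s - g x₀) ∂expLaw d η
      = potential η (0 : C(X, ℝ)) - potential η g - g x₀ := by
    have hi2 : Integrable (fun s => conj (0 : C(X, ℝ)) s - conj g s) (expLaw d η) :=
      (integrable_conj hη 0).sub (integrable_conj hη g)
    rw [integral_sub hi2 (integrable_const _),
      integral_sub (integrable_conj hη 0) (integrable_conj hη g)]
    simp [potential]
  rw [hv] at h
  linarith

/-- The regret of optimistic follow-the-perturbed-leader, played in expectation over the
perturbation: `l t` is the loss of round `t`, `u t` the guess and `Λ t` a Lipschitz constant of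
the error of the guess. The negative Bregman terms measure the movement of the player. -/
lemma regret_le {η D G : ℝ} (hη : 0 < η) (hd : 2 ≤ d)
    (hD : ∀ x z : X, l1 (x - z : EuclideanSpace ℝ (Fin d)) ≤ D) (hG : 0 ≤ G)
    (l u : ℕ → C(X, ℝ)) (Λ : ℕ → ℝ) (hΛ0 : ∀ t, 0 ≤ Λ t) (hu : u 0 = 0)
    (hl : ∀ x z : X, l 0 x - l 0 z ≤ G * l1 (x - z : EuclideanSpace ℝ (Fin d)))
    (T : ℕ) (hT : 1 ≤ T) (hΛ : ∀ t, 0 < t → t < T → ∀ x z : X,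
      (l t - u t) x - (l t - u t) z ≤ Λ t * l1 (x - z : EuclideanSpace ℝ (Fin d)))
    (x₀ : X) :
    ∑ t ∈ Finset.range T, mean η (∑ i ∈ Finset.range t, l i + u t) (l t)
        - (∑ t ∈ Finset.range T, l t) x₀
      ≤ 4 * η * D * Real.log d + G * D
        + ∑ t ∈ Finset.Ico 1 T, (2 * d ^ 2 * D / η * Λ t ^ 2
          - bregman η (∑ i ∈ Finset.range t, l i) (u t)) := by
  have hD0 : 0 ≤ D := (l1_nonneg _).trans (hD x₀ x₀)
  have hstep : ∀ T', 1 ≤ T' → T' ≤ T →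
      ∑ t ∈ Finset.range T', mean η (∑ i ∈ Finset.range t, l i + u t) (l t)
      ≤ potential η (0 : C(X, ℝ)) - potential η (∑ t ∈ Finset.range T', l t) + G * D
        + ∑ t ∈ Finset.Ico 1 T', (2 * d ^ 2 * D / η * Λ t ^ 2
          - bregman η (∑ i ∈ Finset.range t, l i) (u t)) := by
    intro T' hT'
    induction T', hT' using Nat.le_induction with
    | base =>
      intro _
      obtain ⟨z, -, hz⟩ := isCompact_univ.exists_isMinOn Set.univ_nonempty (l 0).continuous.continuousOn
      have h1 := potential_add_le_of_le hη 0 (l 0) (c := l 0 z) fun x => hz (Set.mem_univ x)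
      have h2 := mean_le_of_le hη 0 (l 0) (c := l 0 z + G * D) fun x => by
        have h3 := hl x z
        have h4 := mul_le_mul_of_nonneg_left (hD x z) hG
        linarith
      simp only [Finset.range_one, Finset.sum_singleton, Finset.range_zero, Finset.sum_empty, hu,
        add_zero, Finset.Ico_self]
      rw [zero_add] at h1
      linarith
    | succ t ht ih =>
      intro htT
      have ih := ih (by omega)
      rw [Finset.sum_range_succ, Finset.sum_Ico_succ_top ht, Finset.sum_range_succ l]
      set g := ∑ i ∈ Finset.range t, l i with hg
      have h1 := potential_add_le hη (by omega) (hΛ0 t) (coord_sub_le_of_l1_le hD) (g + u t)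
        (l t - u t) (hΛ t ht htT)
      rw [add_add_sub_cancel, mean_sub hη] at h1
      unfold bregman at ih ⊢
      linarith
  have h1 := hstep T hT le_rfl
  have h2 := potential_zero_sub_le hη hd hD (∑ t ∈ Finset.range T, l t) x₀
  linarith

end Regret

/-! ### The game along one realization of the perturbations -/

section Game

variable {d : ℕ} {X Y : Set (EuclideanSpace ℝ (Fin d))}

/-- The losses of the minimizing player, one for each action `y` of the opponent. -/
noncomputable def lossX [CompactSpace X] [CompactSpace Y] (K : C(X × Y, ℝ)) : C(Y, C(X, ℝ)) :=
  ContinuousMap.curry (K.comp ⟨Prod.swap, continuous_swap⟩)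

/-- The losses of the maximizing player, one for each action `x` of the opponent. -/
noncomputable def lossY [CompactSpace X] [CompactSpace Y] (K : C(X × Y, ℝ)) : C(X, C(Y, ℝ)) :=
  ContinuousMap.curry (-K)

lemma lossX_apply [CompactSpace X] [CompactSpace Y] (K : C(X × Y, ℝ)) (x : X) (y : Y) :
    lossX K y x = K (x, y) := rfl

lemma lossY_apply [CompactSpace X] [CompactSpace Y] (K : C(X × Y, ℝ)) (x : X) (y : Y) :
    lossY K x y = -K (x, y) := rfl

/-- The average of a loss over the points `z j`. -/
noncomputable def avg {Z V : Type*} [AddCommGroup V] [Module ℝ V] {m : ℕ} (F : Z → V)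
    (z : Fin m → Z) : V :=
  (m : ℝ)⁻¹ • ∑ j, F (z j)

lemma avg_coe {Z : Type*} {m : ℕ} (F : Z → C(X, ℝ)) (z : Fin m → Z) (x : X) :
    avg F z x = avg (fun w => F w x) z := by
  simp [avg]

lemma avg_mono {Z : Type*} {m : ℕ} {F F' : Z → ℝ} {z : Fin m → Z}
    (h : ∀ j, F (z j) ≤ F' (z j)) : avg F z ≤ avg F' z :=
  smul_le_smul_of_nonneg_left (Finset.sum_le_sum fun j _ => h j) (by positivity)

lemma avg_const {Z : Type*} {m : ℕ} (hm : 0 < m) (c : ℝ) (z : Fin m → Z) :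
    avg (fun _ => c) z = c := by
  have : (m : ℝ) ≠ 0 := by positivity
  simp [avg, this]

lemma avg_sub {Z : Type*} {m : ℕ} (F F' : Z → ℝ) (z : Fin m → Z) :
    avg (fun w => F w - F' w) z = avg F z - avg F' z := by
  simp [avg, Finset.sum_sub_distrib, mul_sub]

lemma mean_avg {η : ℝ} (hη : 0 < η) [Nonempty X] [CompactSpace X] {Z : Type*} {m : ℕ}
    (g : C(X, ℝ)) (F : Z → C(X, ℝ)) (z : Fin m → Z) :
    mean η g (avg F z : C(X, ℝ)) = avg (fun w => mean η g (F w)) z := by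
  have : ∀ s, (avg F z : C(X, ℝ)) (sel g s) = (m : ℝ)⁻¹ * ∑ j, F (z j) (sel g s) := fun s => by
    simp [avg]
  unfold mean
  simp only [this]
  simp only [avg, smul_eq_mul]
  rw [integral_const_mul, integral_finsetSum _ fun j _ => integrable_sel hη g _]

variable [Nonempty X] [Nonempty Y] [CompactSpace X] [CompactSpace Y]

/-- The best responses of the minimizing player to the loss pair `θ`. -/
noncomputable def pointsX {m : ℕ} (θ : C(X, ℝ) × C(Y, ℝ)) (ξ : Player × Fin m → Fin d → ℝ) :
    Fin m → X := fun j => sel θ.1 (ξ (.x, j))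

/-- The best responses of the maximizing player to the loss pair `θ`. -/
noncomputable def pointsY {m : ℕ} (θ : C(X, ℝ) × C(Y, ℝ)) (ξ : Player × Fin m → Fin d → ℝ) :
    Fin m → Y := fun j => sel θ.2 (ξ (.y, j))

/-- The pair of losses incurred when both players respond to the loss pair `θ`. -/
noncomputable def response {m : ℕ} (K : C(X × Y, ℝ)) (θ : C(X, ℝ) × C(Y, ℝ))
    (ξ : Player × Fin m → Fin d → ℝ) : C(X, ℝ) × C(Y, ℝ) :=
  (avg (lossX K) (pointsY θ ξ), avg (lossY K) (pointsX θ ξ))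

/-- The guessed loss pair of round `t`; there is none in the first round. -/
noncomputable def predict {m : ℕ} (K : C(X × Y, ℝ)) (t : ℕ) (θ : C(X, ℝ) × C(Y, ℝ))
    (ξ : Player × Fin m → Fin d → ℝ) : C(X, ℝ) × C(Y, ℝ) :=
  if t = 0 then 0 else response K θ ξ

/-- The cumulative losses before round `t`, when the perturbations used for the guesses and for
the actions are `ξg` and `ξp`. -/
noncomputable def state {m : ℕ} (K : C(X × Y, ℝ)) (ξg ξp : ℕ → Player × Fin m → Fin d → ℝ) :
    ℕ → C(X, ℝ) × C(Y, ℝ)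
  | 0 => 0
  | t + 1 => state K ξg ξp t
      + response K (state K ξg ξp t + predict K t (state K ξg ξp t) (ξg t)) (ξp t)

/-- The loss pair that the players respond to in round `t`. -/
noncomputable def belief {m : ℕ} (K : C(X × Y, ℝ)) (ξg ξp : ℕ → Player × Fin m → Fin d → ℝ)
    (t : ℕ) : C(X, ℝ) × C(Y, ℝ) :=
  state K ξg ξp t + predict K t (state K ξg ξp t) (ξg t)

/-- The sampling error `f(P, Q̄) - f(P̄, Q)` of one round, where `P`, `Q` are the empirical
distributions and `P̄`, `Q̄` the laws of the responses to `θ`. -/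
noncomputable def gap {m : ℕ} (η : ℝ) (K : C(X × Y, ℝ)) (θ : C(X, ℝ) × C(Y, ℝ))
    (ξ : Player × Fin m → Fin d → ℝ) : ℝ :=
  -(mean η θ.1 (response K θ ξ).1 + mean η θ.2 (response K θ ξ).2)

lemma state_eq_sum {m : ℕ} (K : C(X × Y, ℝ)) (ξg ξp : ℕ → Player × Fin m → Fin d → ℝ) (t : ℕ) :
    state K ξg ξp t = ∑ i ∈ Finset.range t, response K (belief K ξg ξp i) (ξp i) := by
  induction t with
  | zero => rfl
  | succ t ih =>
    rw [Finset.sum_range_succ, ← ih]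
    rfl

/-- The regrets of the two players add up to the duality gap. -/
lemma duality_gap_le {m : ℕ} {η D G : ℝ} (hη : 0 < η) (hd : 2 ≤ d)
    (hDX : ∀ x z : X, l1 (x - z : EuclideanSpace ℝ (Fin d)) ≤ D)
    (hDY : ∀ x z : Y, l1 (x - z : EuclideanSpace ℝ (Fin d)) ≤ D) (hG : 0 ≤ G) (hm : 0 < m)
    (K : C(X × Y, ℝ))
    (hKX : ∀ y, ∀ x z : X, K (x, y) - K (z, y) ≤ G * l1 (x - z : EuclideanSpace ℝ (Fin d)))
    (hKY : ∀ x, ∀ y z : Y, K (x, y) - K (x, z) ≤ G * l1 (y - z : EuclideanSpace ℝ (Fin d)))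
    (ξg ξp : ℕ → Player × Fin m → Fin d → ℝ) (ΛX ΛY : ℕ → ℝ)
    (hΛX0 : ∀ t, 0 ≤ ΛX t) (hΛY0 : ∀ t, 0 ≤ ΛY t) (T : ℕ) (hT : 1 ≤ T)
    (hΛX : ∀ t, 0 < t → t < T → ∀ x z : X,
      ((response K (belief K ξg ξp t) (ξp t)).1 - (response K (state K ξg ξp t) (ξg t)).1) x
        - ((response K (belief K ξg ξp t) (ξp t)).1 - (response K (state K ξg ξp t) (ξg t)).1) z
        ≤ ΛX t * l1 (x - z : EuclideanSpace ℝ (Fin d)))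
    (hΛY : ∀ t, 0 < t → t < T → ∀ x z : Y,
      ((response K (belief K ξg ξp t) (ξp t)).2 - (response K (state K ξg ξp t) (ξg t)).2) x
        - ((response K (belief K ξg ξp t) (ξp t)).2 - (response K (state K ξg ξp t) (ξg t)).2) z
        ≤ ΛY t * l1 (x - z : EuclideanSpace ℝ (Fin d)))
    (x₀ : X) (y₀ : Y) :
    -((state K ξg ξp T).1 x₀ + (state K ξg ξp T).2 y₀)
      ≤ ∑ t ∈ Finset.range T, gap η K (belief K ξg ξp t) (ξp t)
        + 8 * η * D * Real.log d + 2 * (G * D)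
        + ∑ t ∈ Finset.Ico 1 T,
          (2 * d ^ 2 * D / η * (ΛX t ^ 2 + ΛY t ^ 2)
            - bregman η (state K ξg ξp t).1 (predict K t (state K ξg ξp t) (ξg t)).1
            - bregman η (state K ξg ξp t).2 (predict K t (state K ξg ξp t) (ξg t)).2) := by
  set l : ℕ → C(X, ℝ) × C(Y, ℝ) := fun t => response K (belief K ξg ξp t) (ξp t) with hl
  set u : ℕ → C(X, ℝ) × C(Y, ℝ) := fun t => predict K t (state K ξg ξp t) (ξg t) with hu
  have hu0 : u 0 = 0 := by simp [hu, predict]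
  have hut : ∀ t, 0 < t → u t = response K (state K ξg ξp t) (ξg t) := fun t ht => by
    simp only [hu, predict, if_neg ht.ne']
  have hs : ∀ t, state K ξg ξp t = ∑ i ∈ Finset.range t, l i := state_eq_sum K ξg ξp
  have hs1 : ∀ t, (state K ξg ξp t).1 = ∑ i ∈ Finset.range t, (l i).1 := fun t => by
    rw [hs, Prod.fst_sum]
  have hs2 : ∀ t, (state K ξg ξp t).2 = ∑ i ∈ Finset.range t, (l i).2 := fun t => by
    rw [hs, Prod.snd_sum]
  have r1 := regret_le hη hd hDX hG (fun t => (l t).1) (fun t => (u t).1) ΛX hΛX0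
    (by rw [hu0]; rfl) (fun x z => by
      have hl0 : ∀ x, (l 0).1 x = avg (fun y => K (x, y)) (pointsY (belief K ξg ξp 0) (ξp 0)) :=
        fun x => avg_coe (lossX K) _ x
      simp only [hl0]
      rw [← avg_sub]
      exact (avg_mono fun j => hKX _ x z).trans (avg_const hm _ _).le)
    T hT (fun t ht htT x z => by rw [hut t ht]; exact hΛX t ht htT x z) x₀
  have r2 := regret_le hη hd hDY hG (fun t => (l t).2) (fun t => (u t).2) ΛY hΛY0
    (by rw [hu0]; rfl) (fun y z => by
      have hl0 : ∀ y, (l 0).2 y = avg (fun x => -K (x, y)) (pointsX (belief K ξg ξp 0) (ξp 0)) :=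
        fun y => avg_coe (lossY K) _ y
      simp only [hl0]
      rw [← avg_sub]
      refine (avg_mono (F' := fun _ => G * l1 (y - z : EuclideanSpace ℝ (Fin d)))
        fun j => ?_).trans (avg_const hm _ _).le
      have := hKY (pointsX (belief K ξg ξp 0) (ξp 0) j) z y
      rw [l1_sub_comm] at this
      linarith)
    T hT (fun t ht htT x z => by rw [hut t ht]; exact hΛY t ht htT x z) y₀
  simp only [← hs1] at r1
  simp only [← hs2] at r2
  have hgap : ∑ t ∈ Finset.range T, gap η K (belief K ξg ξp t) (ξp t)
      = -(∑ t ∈ Finset.range T, mean η ((state K ξg ξp t).1 + (u t).1) (l t).1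
        + ∑ t ∈ Finset.range T, mean η ((state K ξg ξp t).2 + (u t).2) (l t).2) := by
    rw [← Finset.sum_add_distrib, ← Finset.sum_neg_distrib]
    rfl
  rw [hgap]
  have hsum : ∑ t ∈ Finset.Ico 1 T, (2 * d ^ 2 * D / η * (ΛX t ^ 2 + ΛY t ^ 2)
      - bregman η (state K ξg ξp t).1 (u t).1 - bregman η (state K ξg ξp t).2 (u t).2)
      = ∑ t ∈ Finset.Ico 1 T, (2 * d ^ 2 * D / η * ΛX t ^ 2
        - bregman η (state K ξg ξp t).1 (u t).1)
      + ∑ t ∈ Finset.Ico 1 T, (2 * d ^ 2 * D / η * ΛY t ^ 2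
        - bregman η (state K ξg ξp t).2 (u t).2) := by
    rw [← Finset.sum_add_distrib]
    exact Finset.sum_congr rfl fun t _ => by ring
  change _ ≤ _ + _ + _ + ∑ t ∈ Finset.Ico 1 T, (2 * d ^ 2 * D / η * (ΛX t ^ 2 + ΛY t ^ 2)
      - bregman η (state K ξg ξp t).1 (u t).1 - bregman η (state K ξg ξp t).2 (u t).2)
  rw [hsum]
  linarith

end Game


/-! ### Gradients and finitely many test functions -/

lemma abs_coord_le_of_linf_le {d : ℕ} {v : EuclideanSpace ℝ (Fin d)} {G : ℝ} (h : linf v ≤ G)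
    (k : Fin d) : |v k| ≤ G :=
  (le_ciSup (f := fun k => |v k|) (Set.finite_range _).bddAbove k).trans h

lemma linf_nonneg {d : ℕ} (v : EuclideanSpace ℝ (Fin d)) : 0 ≤ linf v :=
  Real.iSup_nonneg fun _ => abs_nonneg _

lemma abs_sum_mul_le {d : ℕ} {v w : EuclideanSpace ℝ (Fin d)} {C : ℝ} (h : ∀ k, |v k| ≤ C) :
    |∑ k, v k * w k| ≤ C * l1 w := by
  unfold l1
  rw [Finset.mul_sum]
  refine (Finset.abs_sum_le_sum_abs _ _).trans (Finset.sum_le_sum fun k _ => ?_)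
  rw [abs_mul]
  exact mul_le_mul_of_nonneg_right (h k) (abs_nonneg _)

lemma hasDerivWithinAt_segment {d : ℕ} {S : Set (EuclideanSpace ℝ (Fin d))} (hS : Convex ℝ S)
    {h : EuclideanSpace ℝ (Fin d) → ℝ} {v x z : EuclideanSpace ℝ (Fin d)} (hx : x ∈ S) (hz : z ∈ S)
    {t : ℝ} (hv : HasGradientWithinAt h v S (AffineMap.lineMap z x t)) :
    HasDerivWithinAt (fun t => h (AffineMap.lineMap z x t)) (∑ k, v k * (x - z) k)
      (Set.Icc 0 1) t := by
  have h1 : HasDerivWithinAt (fun t : ℝ => AffineMap.lineMap z x t) (x - z) (Set.Icc 0 1) t :=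
    AffineMap.hasDerivWithinAt_lineMap
  have h2 := hv.hasFDerivWithinAt.comp_hasDerivWithinAt t h1
    (fun t ht => hS.lineMap_mem hz hx ht)
  have h3 : ∑ k, v k * (x - z) k
      = InnerProductSpace.toDual ℝ (EuclideanSpace ℝ (Fin d)) v (x - z) := by
    simp [InnerProductSpace.toDual_apply_apply, PiLp.inner_apply, mul_comm]
  rw [h3]
  exact h2

/-- The mean value inequality along segments, for a combination of functions with gradients. -/
lemma sub_le_of_gradient {d : ℕ} {S : Set (EuclideanSpace ℝ (Fin d))} (hS : Convex ℝ S)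
    {ι : Type*} [Fintype ι] (c : ι → ℝ) {h : ι → EuclideanSpace ℝ (Fin d) → ℝ}
    {h' : ι → EuclideanSpace ℝ (Fin d) → EuclideanSpace ℝ (Fin d)}
    (hh : ∀ i, ∀ x ∈ S, HasGradientWithinAt (h i) (h' i x) S x) {C : ℝ}
    (hC : ∀ x ∈ S, ∀ k, |∑ i, c i * h' i x k| ≤ C) {x z : EuclideanSpace ℝ (Fin d)}
    (hx : x ∈ S) (hz : z ∈ S) :
    ∑ i, c i * h i x - ∑ i, c i * h i z ≤ C * l1 (x - z) := by
  have hd : ∀ t ∈ Set.Icc (0 : ℝ) 1, HasDerivWithinAt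
      (fun t => ∑ i, c i * h i (AffineMap.lineMap z x t))
      (∑ i, c i * ∑ k, h' i (AffineMap.lineMap z x t) k * (x - z) k) (Set.Icc 0 1) t := by
    intro t ht
    refine HasDerivWithinAt.fun_sum fun i _ => ?_
    exact (hasDerivWithinAt_segment hS hx hz (hh i _ (hS.lineMap_mem hz hx ht))).const_mul _
  have hb : ∀ t ∈ Set.Ico (0 : ℝ) 1,
      ‖∑ i, c i * ∑ k, h' i (AffineMap.lineMap z x t) k * (x - z) k‖ ≤ C * l1 (x - z) := by
    intro t ht
    have hmem := hS.lineMap_mem hz hx (Set.Ico_subset_Icc_self ht)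
    have := abs_sum_mul_le (w := x - z)
      (v := WithLp.toLp 2 fun k => ∑ i, c i * h' i (AffineMap.lineMap z x t) k)
      (fun k => hC _ hmem k)
    rw [Real.norm_eq_abs]
    refine le_trans (le_of_eq ?_) this
    congr 1
    simp only [Finset.mul_sum, Finset.sum_mul]
    rw [Finset.sum_comm]
    exact Finset.sum_congr rfl fun k _ => Finset.sum_congr rfl fun i _ => by ring
  have := norm_image_sub_le_of_norm_deriv_le_segment_01' hd hb
  simp only [AffineMap.lineMap_apply_one, AffineMap.lineMap_apply_zero] at this
  exact (le_abs_self _).trans this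

lemma exists_grid_point {d : ℕ} (hd : 0 < d) {n : ℕ} (hn : 0 < n) {D : ℝ} (hD : 0 < D)
    {S : Set (EuclideanSpace ℝ (Fin d))} {c : EuclideanSpace ℝ (Fin d)} (hc : c ∈ S)
    (hS : ∀ x ∈ S, ∀ k, |x k - c k| ≤ D) :
    ∃ z : (Fin d → Fin (2 * d * n + 1)) → EuclideanSpace ℝ (Fin d), (∀ q, z q ∈ S) ∧
      ∀ x ∈ S, ∃ q, l1 (x - z q) ≤ D / n := by
  classical
  have hd' : (0 : ℝ) < d := by exact_mod_cast hd
  have hn' : (0 : ℝ) < n := by exact_mod_cast hn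
  set b : ℝ := d * n / D with hb
  have hb0 : 0 < b := by positivity
  let cell : EuclideanSpace ℝ (Fin d) → Fin d → ℕ := fun x k => ⌊(x k - c k + D) * b⌋₊
  have hlt : ∀ x ∈ S, ∀ k, cell x k < 2 * d * n + 1 := by
    intro x hx k
    have h1 := (abs_le.1 (hS x hx k)).2
    refine Nat.lt_succ_of_le (Nat.floor_le_of_le ?_)
    have : (x k - c k + D) * b ≤ (D + D) * b := by gcongr
    refine this.trans (le_of_eq ?_)
    rw [hb]
    push_cast
    field_simp
    ring
  refine ⟨fun q => if h : ∃ x ∈ S, ∀ k, cell x k = q k then h.choose else c, fun q => ?_,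
    fun x hx => ?_⟩
  · dsimp only
    split_ifs with h
    · exact h.choose_spec.1
    · exact hc
  · refine ⟨fun k => ⟨cell x k, hlt x hx k⟩, ?_⟩
    have h : ∃ w ∈ S, ∀ k, cell w k = (fun k => (⟨cell x k, hlt x hx k⟩ : Fin (2 * d * n + 1))) k :=
      ⟨x, hx, fun k => rfl⟩
    dsimp only
    rw [dif_pos h]
    obtain ⟨hw, hwk⟩ := h.choose_spec
    set w := h.choose
    have hk : ∀ k, |(x - w) k| ≤ 1 / b := by
      intro k
      have e1 : cell w k = cell x k := hwk k
      have p1 : 0 ≤ (x k - c k + D) * b :=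
        mul_nonneg (by linarith [(abs_le.1 (hS x hx k)).1]) hb0.le
      have p2 : 0 ≤ (w k - c k + D) * b :=
        mul_nonneg (by linarith [(abs_le.1 (hS w hw k)).1]) hb0.le
      have f1 := Nat.floor_le p1
      have f2 := Nat.floor_le p2
      have f3 := Nat.lt_floor_add_one ((x k - c k + D) * b)
      have f4 := Nat.lt_floor_add_one ((w k - c k + D) * b)
      change ⌊(w k - c k + D) * b⌋₊ = ⌊(x k - c k + D) * b⌋₊ at e1
      rw [e1] at f2 f4
      rw [le_div_iff₀ hb0, PiLp.sub_apply]
      nth_rewrite 1 [← abs_of_pos hb0]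
      rw [← abs_mul, abs_le]
      constructor <;> nlinarith
    calc l1 (x - w) ≤ ∑ _k : Fin d, 1 / b := Finset.sum_le_sum fun k _ => hk k
      _ = D / n := by
        rw [Finset.sum_const, Finset.card_univ, Fintype.card_fin, nsmul_eq_mul, hb]
        field_simp

/-- The index set of the test functions: the cells of a grid, and the coordinates. -/
abbrev TestIndex (d n : ℕ) : Type := (Fin d → Fin (2 * d * n + 1)) × Fin d

/-- Discretization of the gradient: the Lipschitz constant of a difference of two averaged losses
of one player is controlled by finitely many test functions on the actions of the other, namely
the coordinates of the gradient at the points of a net of the convex hull. -/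
lemma exists_test_functions {d m n : ℕ} (hd : 0 < d) (hn : 0 < n)
    {X Y : Set (EuclideanSpace ℝ (Fin d))} [Nonempty X]
    {D G L : ℝ} (hD0 : 0 < D) (hL : 0 ≤ L)
    (hD : ∀ x z : X, l1 (x - z : EuclideanSpace ℝ (Fin d)) ≤ D)
    {f : EuclideanSpace ℝ (Fin d) → EuclideanSpace ℝ (Fin d) → ℝ}
    {g : EuclideanSpace ℝ (Fin d) → EuclideanSpace ℝ (Fin d) → EuclideanSpace ℝ (Fin d)}
    (hg : ∀ x ∈ convexHull ℝ X, ∀ y ∈ Y,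
      HasGradientWithinAt (fun z => f z y) (g x y) (convexHull ℝ X) x)
    (hG : ∀ x ∈ convexHull ℝ X, ∀ y ∈ Y, ∀ k, |g x y k| ≤ G)
    (hgL : ∀ x ∈ convexHull ℝ X, ∀ y ∈ Y, ∀ x' ∈ convexHull ℝ X, ∀ y' ∈ Y, ∀ k,
      |g x y k - g x' y' k| ≤ L * l1 (x - x') + L * l1 (y - y')) :
    ∃ H : TestIndex d n → C(Y, ℝ), (∀ i y, |H i y| ≤ G) ∧
      (∀ i, ∀ y z : Y, H i y - H i z ≤ L * l1 (y - z : EuclideanSpace ℝ (Fin d))) ∧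
      ∀ (y y' : Fin m → Y) (Λ : ℝ), (∀ i, |avg (H i) y - avg (H i) y'| ≤ Λ) →
        ∀ x z : X, (avg (fun w : Y => f x w) y - avg (fun w : Y => f x w) y')
            - (avg (fun w : Y => f z w) y - avg (fun w : Y => f z w) y')
          ≤ (Λ + 2 * L * (D / n)) * l1 (x - z : EuclideanSpace ℝ (Fin d)) := by
  classical
  set S := convexHull ℝ X with hS
  have hXS : X ⊆ S := subset_convexHull ℝ X
  let c : X := Classical.arbitrary X
  have hbox : ∀ x ∈ S, ∀ k, |x k - (c : EuclideanSpace ℝ (Fin d)) k| ≤ D := by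
    intro x hx k
    have hconv : Convex ℝ {x : EuclideanSpace ℝ (Fin d) |
        |x k - (c : EuclideanSpace ℝ (Fin d)) k| ≤ D} := by
      intro a ha b hb s t hs ht hst
      simp only [Set.mem_ofPred_eq, abs_le] at ha hb ⊢
      have e : (s • a + t • b) k - (c : EuclideanSpace ℝ (Fin d)) k
          = s * (a k - (c : EuclideanSpace ℝ (Fin d)) k)
            + t * (b k - (c : EuclideanSpace ℝ (Fin d)) k) := by
        have : (s • a + t • b) k = s * a k + t * b k := by simp
        rw [this]
        linear_combination (-(c : EuclideanSpace ℝ (Fin d)) k) * hst.symm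
      rw [e]
      constructor <;> nlinarith
    exact convexHull_min (fun a ha =>
      (abs_coord_le_l1 (a - c : EuclideanSpace ℝ (Fin d)) k).trans (hD ⟨a, ha⟩ c)) hconv hx
  obtain ⟨z, hzS, hz⟩ := exists_grid_point hd hn hD0 (hXS c.2) hbox
  have hlip : ∀ i : TestIndex d n, ∀ y y' : Y,
      |g (z i.1) y i.2 - g (z i.1) y' i.2| ≤ L * l1 (y - y' : EuclideanSpace ℝ (Fin d)) := by
    intro i y y'
    have := hgL _ (hzS i.1) y y.2 _ (hzS i.1) y' y'.2 i.2
    simpa [l1] using this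
  have hcont : ∀ i : TestIndex d n, Continuous fun y : Y => g (z i.1) y i.2 := by
    intro i
    rw [continuous_iff_continuousAt]
    intro y
    rw [ContinuousAt, tendsto_iff_dist_tendsto_zero]
    refine squeeze_zero (fun _ => dist_nonneg) (fun w => hlip i w y) ?_
    have : Continuous fun w : Y => L * l1 (w - y : EuclideanSpace ℝ (Fin d)) :=
      continuous_const.mul (continuous_l1.comp (continuous_subtype_val.sub continuous_const))
    have h := this.tendsto y
    simpa [l1] using h
  refine ⟨fun i => ⟨fun y => g (z i.1) y i.2, hcont i⟩, fun i y => hG _ (hzS i.1) y y.2 i.2,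
    fun i y y' => (le_abs_self _).trans (hlip i y y'), fun y y' Λ hΛ x w => ?_⟩
  have hm' : (m : ℝ)⁻¹ * m ≤ 1 := by
    rcases Nat.eq_zero_or_pos m with h | h
    · simp [h]
    · have : (m : ℝ) ≠ 0 := by positivity
      rw [inv_mul_cancel₀ this]
  have key : ∀ x ∈ S, ∀ k, |∑ i : Fin m ⊕ Fin m,
      (Sum.elim (fun _ => (m : ℝ)⁻¹) (fun _ => -(m : ℝ)⁻¹) i)
        * (g x (Sum.elim (fun j => (y j : EuclideanSpace ℝ (Fin d))) (fun j => y' j) i)) k|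
      ≤ Λ + 2 * L * (D / n) := by
    intro x hx k
    obtain ⟨q, hq⟩ := hz x hx
    have hq' := hΛ (q, k)
    have happ : ∀ y : Fin m → Y, |(m : ℝ)⁻¹ * ∑ j, g x (y j) k
        - (m : ℝ)⁻¹ * ∑ j, g (z q) (y j) k| ≤ L * (D / n) := by
      intro y
      rw [← mul_sub, ← Finset.sum_sub_distrib, abs_mul, abs_of_nonneg (by positivity)]
      calc (m : ℝ)⁻¹ * |∑ j, (g x (y j) k - g (z q) (y j) k)|
          ≤ (m : ℝ)⁻¹ * ∑ _j : Fin m, L * (D / n) := by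
            gcongr
            refine (Finset.abs_sum_le_sum_abs _ _).trans (Finset.sum_le_sum fun j _ => ?_)
            have h1 := hgL x hx (y j) (y j).2 _ (hzS q) (y j) (y j).2 k
            have h2 : L * l1 (x - z q) ≤ L * (D / n) := mul_le_mul_of_nonneg_left hq hL
            have h3 : l1 ((y j : EuclideanSpace ℝ (Fin d)) - (y j : EuclideanSpace ℝ (Fin d))) = 0 := by simp [l1]
            rw [h3] at h1
            linarith
        _ = ((m : ℝ)⁻¹ * m) * (L * (D / n)) := by simp; ring
        _ ≤ 1 * (L * (D / n)) := by gcongr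
        _ = _ := one_mul _
    have h1 := happ y
    have h2 := happ y'
    simp only [avg, smul_eq_mul, ContinuousMap.coe_mk] at hq'
    simp only [Fintype.sum_sum_type, Sum.elim_inl, Sum.elim_inr, ← Finset.mul_sum]
    rw [abs_le] at h1 h2 hq' ⊢
    constructor <;> linarith [h1.1, h1.2, h2.1, h2.2, hq'.1, hq'.2]
  have := sub_le_of_gradient (convex_convexHull ℝ X)
    (Sum.elim (fun _ => (m : ℝ)⁻¹) (fun _ => -(m : ℝ)⁻¹))
    (h := fun i x => f x (Sum.elim (fun j => (y j : EuclideanSpace ℝ (Fin d))) (fun j => y' j) i))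
    (h' := fun i x => g x (Sum.elim (fun j => (y j : EuclideanSpace ℝ (Fin d))) (fun j => y' j) i))
    (fun i x hx => by
      rcases i with j | j
      · exact hg x hx _ (y j).2
      · exact hg x hx _ (y' j).2) key (hXS x.2) (hXS w.2)
  simp only [Fintype.sum_sum_type, Sum.elim_inl, Sum.elim_inr, ← Finset.mul_sum] at this
  simp only [avg, smul_eq_mul]
  linarith


/-! ### The duality gap along a realization -/

section Combine

variable {d m : ℕ} {X Y : Set (EuclideanSpace ℝ (Fin d))} [Nonempty X] [Nonempty Y]
  [CompactSpace X] [CompactSpace Y]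

/-- The empirical averages of the test functions are within `r` of their expectations. -/
def Typical {ι : Type*} (η r : ℝ) (HX : ι → C(X, ℝ)) (HY : ι → C(Y, ℝ))
    (θ : C(X, ℝ) × C(Y, ℝ)) (ξ : Player × Fin m → Fin d → ℝ) : Prop :=
  ∀ i, |avg (HX i) (pointsX θ ξ) - mean η θ.1 (HX i)| ≤ r ∧
    |avg (HY i) (pointsY θ ξ) - mean η θ.2 (HY i)| ≤ r

/-- The test functions `HY` on the actions of the maximizing player control the Lipschitz constant
of differences of averaged losses of the minimizing player up to `e`, and vice versa. -/
structure Controls {ι : Type*} (m : ℕ) (K : C(X × Y, ℝ)) (L e : ℝ) (HX : ι → C(X, ℝ))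
    (HY : ι → C(Y, ℝ)) : Prop where
  lipX : ∀ i, ∀ x z : X, HX i x - HX i z ≤ L * l1 (x - z : EuclideanSpace ℝ (Fin d))
  lipY : ∀ i, ∀ y z : Y, HY i y - HY i z ≤ L * l1 (y - z : EuclideanSpace ℝ (Fin d))
  lossX : ∀ (y y' : Fin m → Y) (Λ : ℝ), (∀ i, |avg (HY i) y - avg (HY i) y'| ≤ Λ) →
    ∀ x z : X, (avg (lossX K) y - avg (lossX K) y' : C(X, ℝ)) x
        - (avg (lossX K) y - avg (lossX K) y' : C(X, ℝ)) z
      ≤ (Λ + e) * l1 (x - z : EuclideanSpace ℝ (Fin d))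
  lossY : ∀ (x x' : Fin m → X) (Λ : ℝ), (∀ i, |avg (HX i) x - avg (HX i) x'| ≤ Λ) →
    ∀ y z : Y, (avg (lossY K) x - avg (lossY K) x' : C(Y, ℝ)) y
        - (avg (lossY K) x - avg (lossY K) x' : C(Y, ℝ)) z
      ≤ (Λ + e) * l1 (y - z : EuclideanSpace ℝ (Fin d))

/-- Without any information on the samples the guesses are wrong by at most the smoothness
constant times the diameter. -/
lemma duality_gap_le_of_controls {ι : Type*} {η D G L e : ℝ} (hη : 0 < η) (hd : 2 ≤ d)
    (hDX : ∀ x z : X, l1 (x - z : EuclideanSpace ℝ (Fin d)) ≤ D)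
    (hDY : ∀ x z : Y, l1 (x - z : EuclideanSpace ℝ (Fin d)) ≤ D) (hG : 0 ≤ G) (hm : 0 < m)
    (hL : 0 ≤ L) (he : 0 ≤ e) (K : C(X × Y, ℝ))
    (hKX : ∀ y, ∀ x z : X, K (x, y) - K (z, y) ≤ G * l1 (x - z : EuclideanSpace ℝ (Fin d)))
    (hKY : ∀ x, ∀ y z : Y, K (x, y) - K (x, z) ≤ G * l1 (y - z : EuclideanSpace ℝ (Fin d)))
    {HX : ι → C(X, ℝ)} {HY : ι → C(Y, ℝ)} (hC : Controls m K L e HX HY)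
    (ξg ξp : ℕ → Player × Fin m → Fin d → ℝ) (T : ℕ) (hT : 1 ≤ T) (x₀ : X) (y₀ : Y) :
    -((state K ξg ξp T).1 x₀ + (state K ξg ξp T).2 y₀)
      ≤ ∑ t ∈ Finset.range T, gap η K (belief K ξg ξp t) (ξp t)
        + 8 * η * D * Real.log d + 2 * (G * D)
        + T * (4 * d ^ 2 * D / η * (L * D + e) ^ 2) := by
  have hD0 : 0 ≤ D := (l1_nonneg _).trans (hDX x₀ x₀)
  have havg : ∀ {Z : Set (EuclideanSpace ℝ (Fin d))} (h : C(Z, ℝ)) (y y' : Fin m → Z),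
      (∀ x z : Z, h x - h z ≤ L * l1 (x - z : EuclideanSpace ℝ (Fin d))) →
      (∀ x z : Z, l1 (x - z : EuclideanSpace ℝ (Fin d)) ≤ D) →
      |avg h y - avg h y'| ≤ L * D := by
    intro Z h y y' hh hZ
    have h1 : ∀ x z : Z, h x ≤ h z + L * D := fun x z => by
      have := hh x z
      have := mul_le_mul_of_nonneg_left (hZ x z) hL
      linarith
    have h2 : ∀ y y' : Fin m → Z, avg h y ≤ avg h y' + L * D := by
      intro y y'
      have : ∀ z, avg h y ≤ h z + L * D := fun z =>
        (avg_mono (F' := fun _ => h z + L * D) fun j => h1 _ z).trans (avg_const hm _ _).le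
      have h3 : avg (fun _ => avg h y - L * D) y' ≤ avg h y' :=
        avg_mono fun j => by have := this (y' j); linarith
      rw [avg_const hm] at h3
      linarith
    rw [abs_sub_le_iff]
    exact ⟨by linarith [h2 y y'], by linarith [h2 y' y]⟩
  have hc : 0 ≤ 2 * (d : ℝ) ^ 2 * D / η := by positivity
  refine (duality_gap_le hη hd hDX hDY hG hm K hKX hKY ξg ξp (fun _ => L * D + e)
    (fun _ => L * D + e) (fun _ => by positivity) (fun _ => by positivity) T hT
    (fun t ht _ => hC.lossX _ _ _ fun i => havg _ _ _ (hC.lipY i) hDY)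
    (fun t ht _ => hC.lossY _ _ _ fun i => havg _ _ _ (hC.lipX i) hDX) x₀ y₀).trans ?_
  gcongr
  calc ∑ t ∈ Finset.Ico 1 T, (2 * d ^ 2 * D / η * ((L * D + e) ^ 2 + (L * D + e) ^ 2)
          - bregman η (state K ξg ξp t).1 (predict K t (state K ξg ξp t) (ξg t)).1
          - bregman η (state K ξg ξp t).2 (predict K t (state K ξg ξp t) (ξg t)).2)
      ≤ ∑ _t ∈ Finset.Ico 1 T, 4 * d ^ 2 * D / η * (L * D + e) ^ 2 := by
        refine Finset.sum_le_sum fun t _ => ?_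
        have h1 := bregman_nonneg hη (state K ξg ξp t).1 (predict K t (state K ξg ξp t) (ξg t)).1
        have h2 := bregman_nonneg hη (state K ξg ξp t).2 (predict K t (state K ξg ξp t) (ξg t)).2
        have h3 : 2 * (d : ℝ) ^ 2 * D / η * ((L * D + e) ^ 2 + (L * D + e) ^ 2)
          = 4 * d ^ 2 * D / η * (L * D + e) ^ 2 := by ring
        linarith
    _ = ((T - 1 : ℕ) : ℝ) * (4 * d ^ 2 * D / η * (L * D + e) ^ 2) := by
        rw [Finset.sum_const, Nat.card_Ico, nsmul_eq_mul]
    _ ≤ T * (4 * d ^ 2 * D / η * (L * D + e) ^ 2) := by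
        have : ((T - 1 : ℕ) : ℝ) ≤ T := by exact_mod_cast Nat.sub_le T 1
        gcongr

/-- If the samples are typical, the error of a guess is, up to the sampling error, the movement of
the opponent, which the Bregman terms of the opponent's regret pay for. -/
lemma duality_gap_le_of_typical {ι : Type*} {η D G L e r : ℝ} (hη : 0 < η) (hd : 2 ≤ d)
    (hDX : ∀ x z : X, l1 (x - z : EuclideanSpace ℝ (Fin d)) ≤ D)
    (hDY : ∀ x z : Y, l1 (x - z : EuclideanSpace ℝ (Fin d)) ≤ D) (hG : 0 ≤ G) (hm : 0 < m)
    (hL : 0 ≤ L) (he : 0 ≤ e) (hr : 0 ≤ r) (hsmall : 8 * (2 * d ^ 2 * D / η) ^ 2 * L ^ 2 ≤ 1)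
    (K : C(X × Y, ℝ))
    (hKX : ∀ y, ∀ x z : X, K (x, y) - K (z, y) ≤ G * l1 (x - z : EuclideanSpace ℝ (Fin d)))
    (hKY : ∀ x, ∀ y z : Y, K (x, y) - K (x, z) ≤ G * l1 (y - z : EuclideanSpace ℝ (Fin d)))
    {HX : ι → C(X, ℝ)} {HY : ι → C(Y, ℝ)} (hC : Controls m K L e HX HY)
    (ξg ξp : ℕ → Player × Fin m → Fin d → ℝ) (T : ℕ) (hT : 1 ≤ T)
    (hg : ∀ t ∈ Finset.Ico 1 T, Typical η r HX HY (state K ξg ξp t) (ξg t))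
    (hp : ∀ t ∈ Finset.Ico 1 T, Typical η r HX HY (belief K ξg ξp t) (ξp t)) (x₀ : X) (y₀ : Y) :
    -((state K ξg ξp T).1 x₀ + (state K ξg ξp T).2 y₀)
      ≤ ∑ t ∈ Finset.range T, gap η K (belief K ξg ξp t) (ξp t)
        + 8 * η * D * Real.log d + 2 * (G * D)
        + T * (8 * d ^ 2 * D / η * (2 * r + e) ^ 2) := by
  have hD0 : 0 ≤ D := (l1_nonneg _).trans (hDX x₀ x₀)
  set c : ℝ := 2 * (d : ℝ) ^ 2 * D / η with hcdef
  have hc : 0 ≤ c := by positivity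
  set BX : ℕ → ℝ := fun t =>
    bregman η (state K ξg ξp t).1 (predict K t (state K ξg ξp t) (ξg t)).1
  set BY : ℕ → ℝ := fun t =>
    bregman η (state K ξg ξp t).2 (predict K t (state K ξg ξp t) (ξg t)).2
  have hBX : ∀ t, 0 ≤ BX t := fun t => bregman_nonneg hη _ _
  have hBY : ∀ t, 0 ≤ BY t := fun t => bregman_nonneg hη _ _
  have hmoveX : ∀ t i, |mean η (state K ξg ξp t).1 (HX i) - mean η (belief K ξg ξp t).1 (HX i)|
      ≤ Real.sqrt (4 * c * L ^ 2 * BX t) := fun t i =>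
    Real.abs_le_sqrt (sq_mean_sub_mean_le hη (by omega) hL (coord_sub_le_of_l1_le hDX) _ _ _
      (hC.lipX i))
  have hmoveY : ∀ t i, |mean η (state K ξg ξp t).2 (HY i) - mean η (belief K ξg ξp t).2 (HY i)|
      ≤ Real.sqrt (4 * c * L ^ 2 * BY t) := fun t i =>
    Real.abs_le_sqrt (sq_mean_sub_mean_le hη (by omega) hL (coord_sub_le_of_l1_le hDY) _ _ _
      (hC.lipY i))
  have htri : ∀ {a b p q w : ℝ}, |a - p| ≤ r → |b - q| ≤ r → |q - p| ≤ w →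
      |a - b| ≤ 2 * r + w := by
    intro a b p q w h1 h2 h3
    rw [abs_le] at *
    constructor <;> linarith [h1.1, h1.2, h2.1, h2.2, h3.1, h3.2]
  have hall : ∀ t, 0 < t → t < T → ∀ i,
      |avg (HX i) (pointsX (belief K ξg ξp t) (ξp t)) - avg (HX i) (pointsX (state K ξg ξp t) (ξg t))|
        ≤ 2 * r + Real.sqrt (4 * c * L ^ 2 * BX t) ∧
      |avg (HY i) (pointsY (belief K ξg ξp t) (ξp t)) - avg (HY i) (pointsY (state K ξg ξp t) (ξg t))|
        ≤ 2 * r + Real.sqrt (4 * c * L ^ 2 * BY t) := by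
    intro t ht htT i
    have h1 := hg t (Finset.mem_Ico.2 ⟨ht, htT⟩) i
    have h2 := hp t (Finset.mem_Ico.2 ⟨ht, htT⟩) i
    exact ⟨htri h2.1 h1.1 (hmoveX t i), htri h2.2 h1.2 (hmoveY t i)⟩
  have hsq : ∀ B, 0 ≤ B → c * (2 * r + Real.sqrt (4 * c * L ^ 2 * B) + e) ^ 2
      ≤ 2 * c * (2 * r + e) ^ 2 + B := by
    intro B hB
    have h1 := Real.sq_sqrt (show 0 ≤ 4 * c * L ^ 2 * B by positivity)
    set q := Real.sqrt (4 * c * L ^ 2 * B)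
    have h2 : (2 * r + q + e) ^ 2 ≤ 2 * (2 * r + e) ^ 2 + 2 * q ^ 2 := by
      nlinarith [sq_nonneg (2 * r + e - q)]
    have h3 := mul_le_mul_of_nonneg_left h2 hc
    have h4 := mul_le_mul_of_nonneg_right hsmall hB
    rw [h1] at h3
    linarith
  refine (duality_gap_le hη hd hDX hDY hG hm K hKX hKY ξg ξp
    (fun t => 2 * r + Real.sqrt (4 * c * L ^ 2 * BY t) + e)
    (fun t => 2 * r + Real.sqrt (4 * c * L ^ 2 * BX t) + e) (fun _ => by positivity)
    (fun _ => by positivity) T hT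
    (fun t ht htT => hC.lossX _ _ _ fun i => (hall t ht htT i).2)
    (fun t ht htT => hC.lossY _ _ _ fun i => (hall t ht htT i).1) x₀ y₀).trans ?_
  gcongr
  calc ∑ t ∈ Finset.Ico 1 T, (c * ((2 * r + Real.sqrt (4 * c * L ^ 2 * BY t) + e) ^ 2
          + (2 * r + Real.sqrt (4 * c * L ^ 2 * BX t) + e) ^ 2) - BX t - BY t)
      ≤ ∑ _t ∈ Finset.Ico 1 T, 8 * d ^ 2 * D / η * (2 * r + e) ^ 2 := by
        refine Finset.sum_le_sum fun t _ => ?_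
        have h1 := hsq _ (hBX t)
        have h2 := hsq _ (hBY t)
        have h3 : 8 * (d : ℝ) ^ 2 * D / η * (2 * r + e) ^ 2 = 4 * c * (2 * r + e) ^ 2 := by
          rw [hcdef]
          ring
        linarith
    _ = ((T - 1 : ℕ) : ℝ) * (8 * d ^ 2 * D / η * (2 * r + e) ^ 2) := by
        rw [Finset.sum_const, Nat.card_Ico, nsmul_eq_mul]
    _ ≤ T * (8 * d ^ 2 * D / η * (2 * r + e) ^ 2) := by
        have : ((T - 1 : ℕ) : ℝ) ≤ T := by exact_mod_cast Nat.sub_le T 1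
        gcongr

end Combine


/-! ### Concentration within one phase -/

instance instFintypePlayer : Fintype Player := ⟨⟨{.x, .y}, by simp⟩, fun p => by cases p <;> simp⟩

instance instFintypePhase : Fintype Phase :=
  ⟨⟨{.guess, .play}, by simp⟩, fun p => by cases p <;> simp⟩

instance instDecidableEqPlayer : DecidableEq Player := fun p q => by
  cases p <;> cases q <;> first | exact isTrue rfl | exact isFalse (by simp)

lemma sum_player {V : Type*} [AddCommMonoid V] (F : Player → V) : ∑ p, F p = F .x + F .y := by
  change ∑ p ∈ ({.x, .y} : Finset Player), F p = _
  rw [Finset.sum_pair (by simp)]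

/-- The law of the perturbations drawn by both players in one phase of one round. -/
noncomputable def blockLaw (d m : ℕ) (η : ℝ) : Measure (Player × Fin m → Fin d → ℝ) :=
  Measure.pi fun _ => expLaw d η

lemma isProbabilityMeasure_blockLaw {d m : ℕ} {η : ℝ} (hη : 0 < η) :
    IsProbabilityMeasure (blockLaw d m η) := by
  have := isProbabilityMeasure_expLaw (d := d) hη
  unfold blockLaw
  infer_instance

/-- Hoeffding's lemma for a sum of centered bounded functions of independent variables. -/
lemma exists_hasSubgaussianMGF_sum_centered {ι V : Type*} [Fintype ι] [MeasurableSpace V]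
    (ν : Measure V) [IsProbabilityMeasure ν] {h : ι → V → ℝ} (hm : ∀ i, Measurable (h i))
    (a c : ι → ℝ) (hc0 : ∀ i, 0 ≤ c i) (hc : ∀ i v, |h i v - a i| ≤ c i) :
    ∃ w : NNReal, (w : ℝ) = ∑ i, c i ^ 2 ∧
      HasSubgaussianMGF (fun ξ : ι → V => ∑ i, (h i (ξ i) - ∫ v, h i v ∂ν)) w
        (Measure.pi fun _ => ν) := by
  refine ⟨∑ i, (c i).toNNReal ^ 2, ?_, ?_⟩
  · push_cast
    exact Finset.sum_congr rfl fun i _ => by rw [Real.coe_toNNReal _ (hc0 i)]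
  have h1 : iIndepFun (fun i (ξ : ι → V) => h i (ξ i) - ∫ v, h i v ∂ν) (Measure.pi fun _ => ν) :=
    iIndepFun_pi (X := fun i v => h i v - ∫ v, h i v ∂ν)
      fun i => ((hm i).sub_const _).aemeasurable
  refine HasSubgaussianMGF.sum_of_iIndepFun h1 (s := Finset.univ) fun i _ => ?_
  have h2 : HasSubgaussianMGF (fun v => h i v - ∫ v, h i v ∂ν) ((c i).toNNReal ^ 2) ν := by
    have := hasSubgaussianMGF_of_mem_Icc (μ := ν) (X := h i) (a := a i - c i) (b := a i + c i)
      (hm i).aemeasurable (Filter.Eventually.of_forall fun v => by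
        have := abs_le.1 (hc i v)
        constructor <;> linarith [this.1, this.2])
    convert this using 1
    have e : a i + c i - (a i - c i) = 2 * c i := by ring
    rw [e]
    ext
    push_cast
    rw [Real.coe_toNNReal _ (hc0 i), Real.norm_of_nonneg (by have := hc0 i; positivity)]
    ring
  refine HasSubgaussianMGF.of_map (Y := fun ξ : ι → V => ξ i)
    (X := fun v => h i v - ∫ v, h i v ∂ν) (measurable_pi_apply i).aemeasurable ?_
  have h3 := (measurePreserving_eval (fun _ : ι => ν) i).map_eq
  change Measure.map (fun ξ : ι → V => ξ i) (Measure.pi fun _ => ν) = ν at h3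
  rwa [h3]

section Block

variable {d m : ℕ} {X Y : Set (EuclideanSpace ℝ (Fin d))} [Nonempty X] [Nonempty Y]
  [CompactSpace X] [CompactSpace Y]

/-- Deviation of the empirical average of one player's samples. -/
lemma blockLaw_deviation_le {η G r : ℝ} (hη : 0 < η) (hm : 0 < m) (hG : 0 < G) (hr : 0 ≤ r)
    (p : Player) {Z : Set (EuclideanSpace ℝ (Fin d))} [Nonempty Z] [CompactSpace Z]
    (g h : C(Z, ℝ)) (hh : ∀ z, |h z| ≤ G) :
    blockLaw d m η {ξ | ¬ |avg h (fun j => sel g (ξ (p, j))) - mean η g h| ≤ r}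
      ≤ ENNReal.ofReal (2 * Real.exp (-(m * r ^ 2 / (2 * G ^ 2)))) := by
  have := isProbabilityMeasure_expLaw (d := d) hη
  have := isProbabilityMeasure_blockLaw (d := d) (m := m) hη
  have hm' : (0 : ℝ) < m := by exact_mod_cast hm
  let H : Player × Fin m → (Fin d → ℝ) → ℝ := fun q v =>
    if q.1 = p then (m : ℝ)⁻¹ * h (sel g v) else 0
  let c : Player × Fin m → ℝ := fun q => if q.1 = p then G / m else 0
  have hHm : ∀ q, Measurable (H q) := fun q => by
    by_cases hq : q.1 = p
    · simp only [H, hq, if_true]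
      exact (h.continuous.measurable.comp (measurable_sel g)).const_mul _
    · simp only [H, hq, if_false]
      exact measurable_const
  obtain ⟨w, hw, hsub⟩ := exists_hasSubgaussianMGF_sum_centered (expLaw d η) hHm (fun _ => 0) c
    (fun q => by simp only [c]; split_ifs <;> positivity) fun q v => by
    by_cases hq : q.1 = p
    · simp only [H, c, hq, if_true, sub_zero, abs_mul]
      rw [abs_of_pos (inv_pos.2 hm'), inv_mul_eq_div]
      exact div_le_div_of_nonneg_right (hh _) hm'.le
    · simp [H, c, hq]
  have hcsum : ∑ q, c q ^ 2 = G ^ 2 / m := by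
    rw [Fintype.sum_prod_type_right]
    have : ∀ j : Fin m, ∑ q : Player, c (q, j) ^ 2 = (G / m) ^ 2 := by
      intro j
      rw [Finset.sum_eq_single p]
      · simp [c]
      · intro q _ hq
        simp [c, hq]
      · simp
    simp only [this, Finset.sum_const, Finset.card_univ, Fintype.card_fin, nsmul_eq_mul]
    field_simp
  have hfun : (fun ξ : Player × Fin m → Fin d → ℝ =>
      ∑ q, (H q (ξ q) - ∫ v, H q v ∂expLaw d η))
      = fun ξ => avg h (fun j => sel g (ξ (p, j))) - mean η g h := by
    funext ξ
    rw [Fintype.sum_prod_type_right]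
    have : ∀ j : Fin m, ∑ q : Player, (H (q, j) (ξ (q, j)) - ∫ v, H (q, j) v ∂expLaw d η)
        = (m : ℝ)⁻¹ * h (sel g (ξ (p, j))) - (m : ℝ)⁻¹ * mean η g h := by
      intro j
      rw [Finset.sum_eq_single p]
      · simp only [H, if_true]
        rw [integral_const_mul]
        rfl
      · intro q _ hq
        simp [H, hq]
      · simp
    simp only [this, Finset.sum_sub_distrib, ← Finset.mul_sum, avg, smul_eq_mul]
    congr 1
    simp only [Finset.sum_const, Finset.card_univ, Fintype.card_fin, nsmul_eq_mul]
    field_simp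
  rw [hfun] at hsub
  rw [hcsum] at hw
  change HasSubgaussianMGF _ _ (blockLaw d m η) at hsub
  set S : (Player × Fin m → Fin d → ℝ) → ℝ :=
    fun ξ => avg h (fun j => sel g (ξ (p, j))) - mean η g h with hS
  have hexp : -r ^ 2 / (2 * (w : ℝ))
      = -(m * r ^ 2 / (2 * G ^ 2)) := by
    rw [hw]
    field_simp
  have t1 := hsub.measure_ge_le hr
  have t2 := hsub.neg.measure_ge_le hr
  rw [hexp] at t1 t2
  have hsubset : {ξ | ¬ |S ξ| ≤ r} ⊆ {ξ | r ≤ S ξ} ∪ {ξ | r ≤ (-S) ξ} := by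
    intro ξ hξ
    have hξ' : r < |S ξ| := not_le.1 hξ
    rcases lt_abs.1 hξ' with h | h
    · exact Or.inl h.le
    · exact Or.inr h.le
  rw [← ofReal_measureReal]
  refine ENNReal.ofReal_le_ofReal ?_
  refine (measureReal_mono hsubset).trans ((measureReal_union_le _ _).trans ?_)
  linarith

lemma blockLaw_not_typical_le {ι : Type*} [Fintype ι] {η G r : ℝ} (hη : 0 < η) (hm : 0 < m)
    (hG : 0 < G) (hr : 0 ≤ r) {HX : ι → C(X, ℝ)} {HY : ι → C(Y, ℝ)} (hX : ∀ i x, |HX i x| ≤ G)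
    (hY : ∀ i y, |HY i y| ≤ G) (θ : C(X, ℝ) × C(Y, ℝ)) :
    blockLaw d m η {ξ | ¬ Typical η r HX HY θ ξ}
      ≤ ENNReal.ofReal (4 * Fintype.card ι * Real.exp (-(m * r ^ 2 / (2 * G ^ 2)))) := by
  have hsub : {ξ | ¬ Typical η r HX HY θ ξ} ⊆ ⋃ i : ι,
      ({ξ : Player × Fin m → Fin d → ℝ |
          ¬ |avg (HX i) (fun j => sel θ.1 (ξ (.x, j))) - mean η θ.1 (HX i)| ≤ r}
        ∪ {ξ | ¬ |avg (HY i) (fun j => sel θ.2 (ξ (.y, j))) - mean η θ.2 (HY i)| ≤ r}) := by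
    intro ξ hξ
    have hξ' : ¬ Typical η r HX HY θ ξ := hξ
    unfold Typical at hξ'
    push Not at hξ'
    obtain ⟨i, hi⟩ := hξ'
    refine Set.mem_iUnion.2 ⟨i, ?_⟩
    by_cases h : |avg (HX i) (fun j => sel θ.1 (ξ (.x, j))) - mean η θ.1 (HX i)| ≤ r
    · exact Or.inr (not_le.2 (hi h))
    · exact Or.inl h
  refine (measure_mono hsub).trans ((measure_iUnion_fintype_le _ _).trans ?_)
  calc ∑ i : ι, blockLaw d m η _
      ≤ ∑ _i : ι, ENNReal.ofReal (4 * Real.exp (-(m * r ^ 2 / (2 * G ^ 2)))) := by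
        refine Finset.sum_le_sum fun i _ => (measure_union_le _ _).trans ?_
        refine (add_le_add (blockLaw_deviation_le hη hm hG hr .x θ.1 (HX i) (hX i))
          (blockLaw_deviation_le hη hm hG hr .y θ.2 (HY i) (hY i))).trans (le_of_eq ?_)
        rw [← ENNReal.ofReal_add (by positivity) (by positivity)]
        congr 1
        ring
    _ = _ := by
        rw [Finset.sum_const, Finset.card_univ, nsmul_eq_mul, ← ENNReal.ofReal_natCast,
          ← ENNReal.ofReal_mul (by positivity)]
        congr 1
        ring

lemma measurable_eval {α : Type*} [MeasurableSpace α] {h : α → C(X, ℝ)} {x : α → X}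
    (hh : Measurable h) (hx : Measurable x) : Measurable fun a => h a (x a) := by
  have h1 : Continuous fun p : C(X, ℝ) × X => p.1 p.2 := continuous_eval
  exact h1.measurable.comp (hh.prodMk hx)

lemma measurable_eval_sel :
    Measurable fun p : (C(X, ℝ) × C(X, ℝ)) × (Fin d → ℝ) => p.1.2 (sel p.1.1 p.2) :=
  measurable_eval measurable_fst.snd (measurable_sel_comp measurable_fst.fst measurable_snd)

lemma measurable_mean {η : ℝ} (hη : 0 < η) :
    Measurable fun p : C(X, ℝ) × C(X, ℝ) => mean η p.1 p.2 := by
  have := isProbabilityMeasure_expLaw (d := d) hη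
  exact (StronglyMeasurable.integral_prod_right
    (measurable_eval_sel (X := X)).stronglyMeasurable).measurable

lemma abs_mean_sub_mean_le {η c : ℝ} (hη : 0 < η) (g h h' : C(X, ℝ)) (hc : ∀ x, |h x - h' x| ≤ c) :
    |mean η g h - mean η g h'| ≤ c := by
  rw [← mean_sub hη, abs_le]
  exact ⟨le_mean_of_le hη g _ fun x => (abs_le.1 (hc x)).1,
    mean_le_of_le hη g _ fun x => (abs_le.1 (hc x)).2⟩

/-- Fubini: the two players' expected losses against the laws of the responses cancel. -/
lemma integral_mean_lossX_add {η : ℝ} (hη : 0 < η) (K : C(X × Y, ℝ)) (g : C(X, ℝ)) (h : C(Y, ℝ)) :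
    ∫ v, mean η g (lossX K (sel h v)) ∂expLaw d η
      + ∫ v, mean η h (lossY K (sel g v)) ∂expLaw d η = 0 := by
  have := isProbabilityMeasure_expLaw (d := d) hη
  have hi : Integrable (Function.uncurry fun v w : Fin d → ℝ => K (sel g w, sel h v))
      ((expLaw d η).prod (expLaw d η)) := by
    refine Integrable.of_bound (C := ‖K‖) ?_ (Filter.Eventually.of_forall fun p =>
      K.norm_coe_le_norm _)
    exact (K.continuous.measurable.comp (((measurable_sel g).comp measurable_snd).prodMk
      ((measurable_sel h).comp measurable_fst))).aestronglyMeasurable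
  have h1 : ∫ v, mean η g (lossX K (sel h v)) ∂expLaw d η
      = ∫ v, ∫ w, K (sel g w, sel h v) ∂expLaw d η ∂expLaw d η := rfl
  have h2 : ∫ v, mean η h (lossY K (sel g v)) ∂expLaw d η
      = -∫ w, ∫ v, K (sel g w, sel h v) ∂expLaw d η ∂expLaw d η := by
    rw [← integral_neg]
    refine integral_congr_ae (Filter.Eventually.of_forall fun w => ?_)
    simp only [mean, lossY_apply]
    rw [integral_neg]
  rw [h1, h2, integral_integral_swap hi, add_neg_cancel]

/-- The sampling error of one round is centered, by Fubini, and subgaussian. -/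
lemma lintegral_exp_gap_le {η D G : ℝ} (hη : 0 < η) (hm : 0 < m)
    (hDX : ∀ x z : X, l1 (x - z : EuclideanSpace ℝ (Fin d)) ≤ D)
    (hDY : ∀ x z : Y, l1 (x - z : EuclideanSpace ℝ (Fin d)) ≤ D) (hG : 0 ≤ G)
    (K : C(X × Y, ℝ))
    (hKX : ∀ y, ∀ x z : X, K (x, y) - K (z, y) ≤ G * l1 (x - z : EuclideanSpace ℝ (Fin d)))
    (hKY : ∀ x, ∀ y z : Y, K (x, y) - K (x, z) ≤ G * l1 (y - z : EuclideanSpace ℝ (Fin d)))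
    (θ : C(X, ℝ) × C(Y, ℝ)) (q : ℝ) :
    ∫⁻ ξ, ENNReal.ofReal (Real.exp (q * gap η K θ ξ)) ∂blockLaw d m η
      ≤ ENNReal.ofReal (Real.exp (q ^ 2 * (G * D) ^ 2 / m)) := by
  have := isProbabilityMeasure_expLaw (d := d) hη
  have hm' : (0 : ℝ) < m := by exact_mod_cast hm
  let x₀ : X := Classical.arbitrary X
  let y₀ : Y := Classical.arbitrary Y
  have hD0 : 0 ≤ D := (l1_nonneg _).trans (hDX x₀ x₀)
  have hbX : ∀ y, ∀ x z : X, |K (x, y) - K (z, y)| ≤ G * D := fun y x z => by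
    have h1 := mul_le_mul_of_nonneg_left (hDX x z) hG
    have h2 := mul_le_mul_of_nonneg_left (hDX z x) hG
    rw [abs_sub_le_iff]
    exact ⟨(hKX y x z).trans h1, (hKX y z x).trans h2⟩
  have hbY : ∀ x, ∀ y z : Y, |K (x, y) - K (x, z)| ≤ G * D := fun x y z => by
    have h1 := mul_le_mul_of_nonneg_left (hDY y z) hG
    have h2 := mul_le_mul_of_nonneg_left (hDY z y) hG
    rw [abs_sub_le_iff]
    exact ⟨(hKY x y z).trans h1, (hKY x z y).trans h2⟩
  let A : Player → (Fin d → ℝ) → ℝ := fun p v => match p with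
    | .x => mean η θ.2 (lossY K (sel θ.1 v))
    | .y => mean η θ.1 (lossX K (sel θ.2 v))
  let a : Player → ℝ := fun p => match p with
    | .x => mean η θ.2 (lossY K x₀)
    | .y => mean η θ.1 (lossX K y₀)
  have hAm : ∀ p, Measurable (A p) := fun p => by
    cases p
    · exact (measurable_mean hη).comp (measurable_const.prodMk
        ((lossY K).continuous.measurable.comp (measurable_sel θ.1)))
    · exact (measurable_mean hη).comp (measurable_const.prodMk
        ((lossX K).continuous.measurable.comp (measurable_sel θ.2)))
  have hAa : ∀ p v, |A p v - a p| ≤ G * D := fun p v => by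
    cases p
    · refine abs_mean_sub_mean_le hη _ _ _ fun y => ?_
      rw [lossY_apply, lossY_apply, ← neg_sub', abs_neg]
      exact hbX y _ _
    · refine abs_mean_sub_mean_le hη _ _ _ fun x => ?_
      rw [lossX_apply, lossX_apply]
      exact hbY x _ _
  obtain ⟨w, hw, hsub⟩ := exists_hasSubgaussianMGF_sum_centered (expLaw d η)
    (h := fun (i : Player × Fin m) v => -(m : ℝ)⁻¹ * A i.1 v) (fun i => (hAm i.1).const_mul _)
    (fun i => -(m : ℝ)⁻¹ * a i.1) (fun _ => G * D / m) (fun _ => by positivity) fun i v => by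
      rw [← mul_sub, abs_mul, abs_neg, abs_of_pos (inv_pos.2 hm'), inv_mul_eq_div]
      exact div_le_div_of_nonneg_right (hAa _ _) hm'.le
  have hw' : (w : ℝ) = 2 * (G * D) ^ 2 / m := by
    rw [hw, Fintype.sum_prod_type, sum_player]
    simp only [Finset.sum_const, Finset.card_univ, Fintype.card_fin, nsmul_eq_mul]
    field_simp
    ring
  have hfun : (fun ξ : Player × Fin m → Fin d → ℝ =>
      ∑ i, (-(m : ℝ)⁻¹ * A i.1 (ξ i) - ∫ v, -(m : ℝ)⁻¹ * A i.1 v ∂expLaw d η))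
      = fun ξ => gap η K θ ξ := by
    funext ξ
    have hz : ∫ v, A .y v ∂expLaw d η + ∫ v, A .x v ∂expLaw d η = 0 :=
      integral_mean_lossX_add hη K θ.1 θ.2
    rw [Finset.sum_sub_distrib]
    simp only [Fintype.sum_prod_type, sum_player, integral_const_mul, Finset.sum_const,
      Finset.card_univ, Fintype.card_fin, nsmul_eq_mul]
    unfold gap response
    rw [mean_avg hη, mean_avg hη]
    simp only [avg, smul_eq_mul, pointsX, pointsY, A, ← Finset.mul_sum] at hz ⊢
    linear_combination ((m : ℝ) * (m : ℝ)⁻¹) * hz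
  rw [hfun] at hsub
  change HasSubgaussianMGF _ _ (blockLaw d m η) at hsub
  rw [← ofReal_integral_eq_lintegral_ofReal (hsub.integrable_exp_mul q)
    (Filter.Eventually.of_forall fun _ => (Real.exp_pos _).le)]
  refine ENNReal.ofReal_le_ofReal ((hsub.mgf_le q).trans (le_of_eq ?_))
  rw [hw']
  congr 1
  ring

end Block


/-! ### Independence of the phases -/

/-- The perturbations drawn in phase `ph` of round `t`. -/
noncomputable def block {Ω : Type*} {d T m : ℕ}
    (σ : Player × Phase × Fin T × Fin m × Fin d → Ω → ℝ) (ph : Phase) (t : ℕ) (ω : Ω) :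
    Player × Fin m → Fin d → ℝ :=
  fun q k => if h : t < T then σ (q.1, ph, ⟨t, h⟩, q.2, k) ω else 0

/-- The indices of the perturbations drawn before phase `ph` of round `t`. -/
def before (d T m : ℕ) (ph : Phase) (t : ℕ) : Set (Player × Phase × Fin T × Fin m × Fin d) :=
  {i | (i.2.2.1 : ℕ) < t ∨ ((i.2.2.1 : ℕ) = t ∧ ph = .play ∧ i.2.1 = .guess)}

/-- The σ-algebra generated by the perturbations with index in `A`. -/
abbrev indexAlg {Ω I : Type*} (σ : I → Ω → ℝ) (A : Set I) : MeasurableSpace Ω :=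
  ⨆ i ∈ A, MeasurableSpace.comap (σ i) inferInstance

lemma measurable_indexAlg {Ω I : Type*} {σ : I → Ω → ℝ} {A : Set I} {i : I} (hi : i ∈ A) :
    Measurable[indexAlg σ A] (σ i) := by
  refine Measurable.of_comap_le ?_
  exact le_iSup₂_of_le (f := fun i (_ : i ∈ A) => MeasurableSpace.comap (σ i) inferInstance)
    i hi le_rfl

lemma measurable_block {Ω : Type*} {d T m : ℕ}
    {σ : Player × Phase × Fin T × Fin m × Fin d → Ω → ℝ} {A : Set _} {ph : Phase} {t : ℕ}
    (hA : ∀ i, (i.2.2.1 : ℕ) = t → i.2.1 = ph → i ∈ A) :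
    Measurable[indexAlg σ A] (block σ ph t) := by
  refine @measurable_pi_lambda _ _ _ (indexAlg σ A) _ _ fun q => ?_
  refine @measurable_pi_lambda _ _ _ (indexAlg σ A) _ _ fun k => ?_
  unfold block
  by_cases h : t < T
  · simp only [h, dif_pos]
    exact measurable_indexAlg (hA _ rfl rfl)
  · simp only [h, dif_neg, not_false_iff]
    exact @measurable_const _ _ _ (indexAlg σ A) _

section Rounds

variable {Ω : Type*} [MeasurableSpace Ω] {μ : Measure Ω} [IsProbabilityMeasure μ] {d T m : ℕ}
  {η : ℝ} {σ : Player × Phase × Fin T × Fin m × Fin d → Ω → ℝ}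

lemma map_block (hη : 0 < η) (hσ : iIndepFun σ μ) (hlaw : ∀ i, HasLaw (σ i) (expMeasure η⁻¹) μ)
    (ph : Phase) {t : ℕ} (ht : t < T) : μ.map (block σ ph t) = blockLaw d m η := by
  have hp := isProbabilityMeasure_expMeasure (inv_pos.2 hη)
  let e : (Player × Fin m) × Fin d → Player × Phase × Fin T × Fin m × Fin d :=
    fun q => (q.1.1, ph, ⟨t, ht⟩, q.1.2, q.2)
  have he : Function.Injective e := by
    rintro ⟨⟨p, j⟩, k⟩ ⟨⟨p', j'⟩, k'⟩ h
    simp only [e, Prod.mk.injEq] at h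
    obtain ⟨h1, -, -, h2, h3⟩ := h
    simp [h1, h2, h3]
  have h1 : HasLaw (fun ω q => σ (e q) ω)
      (Measure.pi fun _ : (Player × Fin m) × Fin d => expMeasure η⁻¹) μ :=
    iIndepFun.hasLaw_pi (fun q => hlaw (e q)) (hσ.precomp he)
  have h2 : block σ ph t = fun ω => MeasurableEquiv.curry (Player × Fin m) (Fin d) ℝ
      (fun q => σ (e q) ω) := by
    funext ω q k
    simp [block, ht, e, MeasurableEquiv.curry]
  have h3 := Measure.infinitePi_map_curry
    (fun (_ : Player × Fin m) (_ : Fin d) => expMeasure η⁻¹)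
  simp only [Measure.infinitePi_eq_pi] at h3
  have h4 : Measure.map (MeasurableEquiv.curry (Player × Fin m) (Fin d) ℝ)
      (μ.map fun ω q => σ (e q) ω) = blockLaw d m η := by
    rw [h1.map_eq]
    exact h3
  rw [h2, ← h4, AEMeasurable.map_map_of_aemeasurable
    (MeasurableEquiv.measurable _).aemeasurable h1.aemeasurable]
  rfl

/-- The perturbations of one phase are independent of everything that was drawn before. -/
lemma indep_before_block (hσm : ∀ i, Measurable (σ i)) (hσ : iIndepFun σ μ) (ph : Phase) (t : ℕ) :
    Indep (indexAlg σ (before d T m ph t)) (MeasurableSpace.comap (block σ ph t) inferInstance)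
      μ := by
  have hd : Disjoint (before d T m ph t)
      {i | (i.2.2.1 : ℕ) = t ∧ i.2.1 = ph} := by
    rw [Set.disjoint_left]
    rintro ⟨p, q, s, j, k⟩ h1 ⟨h2, h3⟩
    rcases h1 with h1 | ⟨-, h4, h5⟩
    · simp only at h1 h2
      omega
    · simp only at h3 h5
      rw [h4, h5] at h3
      cases h3
  have h := indep_iSup_of_disjoint (fun i => (hσm i).comap_le) hσ hd
  exact indep_of_indep_of_le_right h
    (Measurable.comap_le (measurable_block fun i h1 h2 => ⟨h1, h2⟩))

/-- Conditionally on the past, the perturbations of one phase have the law `blockLaw`. -/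
lemma lintegral_block (hη : 0 < η) (hσm : ∀ i, Measurable (σ i)) (hσ : iIndepFun σ μ)
    (hlaw : ∀ i, HasLaw (σ i) (expMeasure η⁻¹) μ) (ph : Phase) {t : ℕ} (ht : t < T)
    {Θ : Type*} [MeasurableSpace Θ] {θ : Ω → Θ}
    (hθ : Measurable[indexAlg σ (before d T m ph t)] θ)
    {V : Θ × (Player × Fin m → Fin d → ℝ) → ENNReal} (hV : Measurable V) :
    ∫⁻ ω, V (θ ω, block σ ph t ω) ∂μ
      = ∫⁻ ω, ∫⁻ ξ, V (θ ω, ξ) ∂blockLaw d m η ∂μ := by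
  have := isProbabilityMeasure_blockLaw (d := d) (m := m) hη
  have hle : ∀ A, indexAlg σ A ≤ ‹MeasurableSpace Ω› := fun A =>
    iSup₂_le fun i _ => (hσm i).comap_le
  have hθ' : Measurable θ := hθ.mono (hle _) le_rfl
  have hb : Measurable (block σ ph t) :=
    (measurable_block (A := Set.univ) fun _ _ _ => Set.mem_univ _).mono (hle _) le_rfl
  have hind : IndepFun θ (block σ ph t) μ :=
    indep_of_indep_of_le_left (indep_before_block hσm hσ ph t) hθ.comap_le
  have hmap := (indepFun_iff_map_prod_eq_prod_map_map hθ'.aemeasurable hb.aemeasurable).1 hind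
  rw [map_block hη hσ hlaw ph ht] at hmap
  calc ∫⁻ ω, V (θ ω, block σ ph t ω) ∂μ
      = ∫⁻ p, V p ∂μ.map (fun ω => (θ ω, block σ ph t ω)) :=
        (lintegral_map hV (hθ'.prodMk hb)).symm
    _ = ∫⁻ a, ∫⁻ ξ, V (a, ξ) ∂blockLaw d m η ∂μ.map θ := by
        rw [hmap, lintegral_prod _ hV.aemeasurable]
    _ = _ := lintegral_map hV.lintegral_prod_right' hθ'

/-- An event that has conditional probability at most `p` given the past. -/
lemma measure_block_le (hη : 0 < η) (hσm : ∀ i, Measurable (σ i)) (hσ : iIndepFun σ μ)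
    (hlaw : ∀ i, HasLaw (σ i) (expMeasure η⁻¹) μ) (ph : Phase) {t : ℕ} (ht : t < T)
    {Θ : Type*} [MeasurableSpace Θ] {θ : Ω → Θ}
    (hθ : Measurable[indexAlg σ (before d T m ph t)] θ)
    {B : Set (Θ × (Player × Fin m → Fin d → ℝ))} (hB : MeasurableSet B) {p : ENNReal}
    (hp : ∀ a, blockLaw d m η {ξ | (a, ξ) ∈ B} ≤ p) :
    μ {ω | (θ ω, block σ ph t ω) ∈ B} ≤ p := by
  have hle : ∀ A, indexAlg σ A ≤ ‹MeasurableSpace Ω› := fun A =>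
    iSup₂_le fun i _ => (hσm i).comap_le
  have hθ' : Measurable θ := hθ.mono (hle _) le_rfl
  have hb : Measurable (block σ ph t) :=
    (measurable_block (A := Set.univ) fun _ _ _ => Set.mem_univ _).mono (hle _) le_rfl
  have h := lintegral_block hη hσm hσ hlaw ph ht hθ (V := B.indicator fun _ => 1)
    (measurable_const.indicator hB)
  have h1 : ∫⁻ ω, B.indicator (fun _ => (1 : ENNReal)) (θ ω, block σ ph t ω) ∂μ
      = μ {ω | (θ ω, block σ ph t ω) ∈ B} :=
    lintegral_indicator_one ((hθ'.prodMk hb) hB)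
  rw [← h1, h]
  calc ∫⁻ ω, ∫⁻ ξ, B.indicator (fun _ => (1 : ENNReal)) (θ ω, ξ) ∂blockLaw d m η ∂μ
      ≤ ∫⁻ _ω, p ∂μ := by
        refine lintegral_mono fun ω => ?_
        exact le_trans (le_of_eq (lintegral_indicator_one (measurable_prodMk_left hB))) (hp (θ ω))
    _ = p := by simp

variable {X Y : Set (EuclideanSpace ℝ (Fin d))} [Nonempty X] [Nonempty Y]
  [CompactSpace X] [CompactSpace Y]

lemma measurable_pointsX {α : Type*} [mα : MeasurableSpace α] {θ : α → C(X, ℝ) × C(Y, ℝ)}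
    {ξ : α → Player × Fin m → Fin d → ℝ} (hθ : Measurable θ) (hξ : Measurable ξ) :
    Measurable fun a => pointsX (θ a) (ξ a) :=
  measurable_pi_lambda _ fun _ => measurable_sel_comp hθ.fst ((measurable_pi_apply _).comp hξ)

lemma measurable_pointsY {α : Type*} [mα : MeasurableSpace α] {θ : α → C(X, ℝ) × C(Y, ℝ)}
    {ξ : α → Player × Fin m → Fin d → ℝ} (hθ : Measurable θ) (hξ : Measurable ξ) :
    Measurable fun a => pointsY (θ a) (ξ a) :=
  measurable_pi_lambda _ fun _ => measurable_sel_comp hθ.snd ((measurable_pi_apply _).comp hξ)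

lemma measurable_avg {V : Type*} [AddCommGroup V] [Module ℝ V] [TopologicalSpace V]
    [IsTopologicalAddGroup V] [ContinuousSMul ℝ V] [MeasurableSpace V] [BorelSpace V]
    {F : X → V} (hF : Continuous F) : Measurable fun z : Fin m → X => avg F z := by
  have : Continuous fun z : Fin m → X => avg F z := by
    unfold avg
    fun_prop
  exact this.measurable

lemma measurable_response (K : C(X × Y, ℝ)) {α : Type*} [mα : MeasurableSpace α]
    {θ : α → C(X, ℝ) × C(Y, ℝ)} {ξ : α → Player × Fin m → Fin d → ℝ} (hθ : Measurable θ)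
    (hξ : Measurable ξ) : Measurable fun a => response K (θ a) (ξ a) :=
  ((measurable_avg (lossX K).continuous).comp (measurable_pointsY hθ hξ)).prodMk
    ((measurable_avg (lossY K).continuous).comp (measurable_pointsX hθ hξ))

lemma measurable_predict (K : C(X × Y, ℝ)) (t : ℕ) {α : Type*} [mα : MeasurableSpace α]
    {θ : α → C(X, ℝ) × C(Y, ℝ)} {ξ : α → Player × Fin m → Fin d → ℝ} (hθ : Measurable θ)
    (hξ : Measurable ξ) : Measurable fun a => predict K t (θ a) (ξ a) := by
  unfold predict
  split_ifs
  · exact measurable_const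
  · exact measurable_response K hθ hξ

lemma measurable_gap (hη : 0 < η) (K : C(X × Y, ℝ)) {α : Type*} [mα : MeasurableSpace α]
    {θ : α → C(X, ℝ) × C(Y, ℝ)} {ξ : α → Player × Fin m → Fin d → ℝ} (hθ : Measurable θ)
    (hξ : Measurable ξ) : Measurable fun a => gap η K (θ a) (ξ a) := by
  have hr := measurable_response K hθ hξ
  exact (((measurable_mean hη).comp (hθ.fst.prodMk hr.fst)).add
    ((measurable_mean hη).comp (hθ.snd.prodMk hr.snd))).neg

lemma measurable_add_loss {α : Type*} [mα : MeasurableSpace α] {θ θ' : α → C(X, ℝ) × C(Y, ℝ)}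
    (hθ : Measurable θ) (hθ' : Measurable θ') : Measurable fun a => θ a + θ' a :=
  hθ.add hθ'

lemma measurable_state (K : C(X × Y, ℝ)) {α : Type*} [mα : MeasurableSpace α]
    {ξg ξp : ℕ → α → Player × Fin m → Fin d → ℝ} (t : ℕ) (hg : ∀ i < t, Measurable (ξg i))
    (hp : ∀ i < t, Measurable (ξp i)) :
    Measurable fun a => state K (fun i => ξg i a) (fun i => ξp i a) t := by
  induction t with
  | zero => exact measurable_const
  | succ t ih =>
    have h := ih (fun i hi => hg i (by omega)) (fun i hi => hp i (by omega))
    exact measurable_add_loss h (measurable_response K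
      (measurable_add_loss h (measurable_predict K t h (hg t (by omega)))) (hp t (by omega)))

lemma measurable_state_before (K : C(X × Y, ℝ)) (t : ℕ) :
    Measurable[indexAlg σ (before d T m .guess t)] fun ω =>
      state K (fun i => block σ .guess i ω) (fun i => block σ .play i ω) t :=
  measurable_state (mα := indexAlg σ (before d T m .guess t)) K t
    (fun i hi => measurable_block fun q h1 _ => Or.inl (by omega))
    (fun i hi => measurable_block fun q h1 _ => Or.inl (by omega))

lemma measurable_belief_before (K : C(X × Y, ℝ)) (t : ℕ) :
    Measurable[indexAlg σ (before d T m .play t)] fun ω =>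
      belief K (fun i => block σ .guess i ω) (fun i => block σ .play i ω) t := by
  have h1 := measurable_state (mα := indexAlg σ (before d T m .play t)) K
    (ξg := block σ .guess) (ξp := block σ .play) t
    (fun i hi => measurable_block fun q h1 _ => Or.inl (by omega))
    (fun i hi => measurable_block fun q h1 _ => Or.inl (by omega))
  exact measurable_add_loss (mα := indexAlg σ (before d T m .play t)) h1
    (measurable_predict (mα := indexAlg σ (before d T m .play t)) K t h1
      (measurable_block fun q h1 h2 => Or.inr ⟨h1, rfl, h2⟩))

end Rounds


/-! ### Probability of the exceptional events -/

section Events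

variable {Ω : Type*} [MeasurableSpace Ω] {μ : Measure Ω} [IsProbabilityMeasure μ] {d T m : ℕ}
  {η : ℝ} {σ : Player × Phase × Fin T × Fin m × Fin d → Ω → ℝ}
  {X Y : Set (EuclideanSpace ℝ (Fin d))} [Nonempty X] [Nonempty Y]
  [CompactSpace X] [CompactSpace Y]

/-- The cumulative losses along the realization `ω`. -/
noncomputable abbrev stateAt (σ : Player × Phase × Fin T × Fin m × Fin d → Ω → ℝ)
    (K : C(X × Y, ℝ)) (t : ℕ) (ω : Ω) : C(X, ℝ) × C(Y, ℝ) :=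
  state K (fun i => block σ .guess i ω) (fun i => block σ .play i ω) t

/-- The loss pair responded to in round `t` along the realization `ω`. -/
noncomputable abbrev beliefAt (σ : Player × Phase × Fin T × Fin m × Fin d → Ω → ℝ)
    (K : C(X × Y, ℝ)) (t : ℕ) (ω : Ω) : C(X, ℝ) × C(Y, ℝ) :=
  belief K (fun i => block σ .guess i ω) (fun i => block σ .play i ω) t

lemma measurableSet_typical {ι : Type*} [Fintype ι] (hη : 0 < η) (r : ℝ) (HX : ι → C(X, ℝ))
    (HY : ι → C(Y, ℝ)) :
    MeasurableSet {p : (C(X, ℝ) × C(Y, ℝ)) × (Player × Fin m → Fin d → ℝ) |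
      Typical η r HX HY p.1 p.2} := by
  have e : {p : (C(X, ℝ) × C(Y, ℝ)) × (Player × Fin m → Fin d → ℝ) | Typical η r HX HY p.1 p.2}
      = ⋂ i, ({p | |avg (HX i) (pointsX p.1 p.2) - mean η p.1.1 (HX i)| ≤ r}
        ∩ {p | |avg (HY i) (pointsY p.1 p.2) - mean η p.1.2 (HY i)| ≤ r}) := by
    ext p
    simp [Typical]
  rw [e]
  refine MeasurableSet.iInter fun i => MeasurableSet.inter ?_ ?_
  · exact measurableSet_le ((((measurable_avg (HX i).continuous).comp
      (measurable_pointsX measurable_fst measurable_snd)).sub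
      ((measurable_mean hη).comp (measurable_fst.fst.prodMk measurable_const))).abs)
      measurable_const
  · exact measurableSet_le ((((measurable_avg (HY i).continuous).comp
      (measurable_pointsY measurable_fst measurable_snd)).sub
      ((measurable_mean hη).comp (measurable_fst.snd.prodMk measurable_const))).abs)
      measurable_const

lemma measure_not_typical_le {ι : Type*} [Fintype ι] {G r : ℝ} (hη : 0 < η) (hm : 0 < m)
    (hG : 0 < G) (hr : 0 ≤ r) {HX : ι → C(X, ℝ)} {HY : ι → C(Y, ℝ)} (hX : ∀ i x, |HX i x| ≤ G)
    (hY : ∀ i y, |HY i y| ≤ G) (hσm : ∀ i, Measurable (σ i)) (hσ : iIndepFun σ μ)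
    (hlaw : ∀ i, HasLaw (σ i) (expMeasure η⁻¹) μ) (K : C(X × Y, ℝ)) :
    μ {ω | ¬ ∀ t ∈ Finset.Ico 1 T, Typical η r HX HY (stateAt σ K t ω) (block σ .guess t ω) ∧
        Typical η r HX HY (beliefAt σ K t ω) (block σ .play t ω)}
      ≤ ENNReal.ofReal (T * (8 * Fintype.card ι * Real.exp (-(m * r ^ 2 / (2 * G ^ 2))))) := by
  set p := ENNReal.ofReal (4 * Fintype.card ι * Real.exp (-(m * r ^ 2 / (2 * G ^ 2)))) with hp
  have hB := (measurableSet_typical (m := m) hη r HX HY).compl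
  have h1 : ∀ t ∈ Finset.Ico 1 T,
      μ {ω | ¬ Typical η r HX HY (stateAt σ K t ω) (block σ .guess t ω)} ≤ p := fun t ht =>
    measure_block_le hη hσm hσ hlaw .guess (Finset.mem_Ico.1 ht).2 (measurable_state_before K t)
      hB (fun θ => blockLaw_not_typical_le hη hm hG hr hX hY θ)
  have h2 : ∀ t ∈ Finset.Ico 1 T,
      μ {ω | ¬ Typical η r HX HY (beliefAt σ K t ω) (block σ .play t ω)} ≤ p := fun t ht =>
    measure_block_le hη hσm hσ hlaw .play (Finset.mem_Ico.1 ht).2 (measurable_belief_before K t)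
      hB (fun θ => blockLaw_not_typical_le hη hm hG hr hX hY θ)
  have hsub : {ω | ¬ ∀ t ∈ Finset.Ico 1 T,
        Typical η r HX HY (stateAt σ K t ω) (block σ .guess t ω) ∧
        Typical η r HX HY (beliefAt σ K t ω) (block σ .play t ω)}
      ⊆ ⋃ t ∈ Finset.Ico 1 T,
        ({ω | ¬ Typical η r HX HY (stateAt σ K t ω) (block σ .guess t ω)}
          ∪ {ω | ¬ Typical η r HX HY (beliefAt σ K t ω) (block σ .play t ω)}) := by
    intro ω hω
    have hω' : ¬ ∀ t ∈ Finset.Ico 1 T,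
        Typical η r HX HY (stateAt σ K t ω) (block σ .guess t ω) ∧
        Typical η r HX HY (beliefAt σ K t ω) (block σ .play t ω) := hω
    push Not at hω'
    obtain ⟨t, ht, h⟩ := hω'
    refine Set.mem_iUnion₂.2 ⟨t, ht, ?_⟩
    by_cases h' : Typical η r HX HY (stateAt σ K t ω) (block σ .guess t ω)
    · exact Or.inr (h h')
    · exact Or.inl h'
  refine (measure_mono hsub).trans ((measure_biUnion_finset_le _ _).trans ?_)
  calc ∑ t ∈ Finset.Ico 1 T, μ _ ≤ ∑ _t ∈ Finset.Ico 1 T, (p + p) :=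
        Finset.sum_le_sum fun t ht => (measure_union_le _ _).trans (add_le_add (h1 t ht) (h2 t ht))
    _ = ((T - 1 : ℕ) : ENNReal) * (p + p) := by
        rw [Finset.sum_const, Nat.card_Ico, nsmul_eq_mul]
    _ ≤ (T : ENNReal) * (p + p) := by
        gcongr
        exact Nat.sub_le T 1
    _ = _ := by
        rw [hp, ← ENNReal.ofReal_add (by positivity) (by positivity), ← ENNReal.ofReal_natCast,
          ← ENNReal.ofReal_mul (by positivity)]
        congr 1
        ring

/-- The exponential moment of the accumulated sampling error, a martingale. -/
lemma lintegral_exp_sum_gap_le {D G : ℝ} (hη : 0 < η) (hm : 0 < m)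
    (hDX : ∀ x z : X, l1 (x - z : EuclideanSpace ℝ (Fin d)) ≤ D)
    (hDY : ∀ x z : Y, l1 (x - z : EuclideanSpace ℝ (Fin d)) ≤ D) (hG : 0 ≤ G)
    (K : C(X × Y, ℝ))
    (hKX : ∀ y, ∀ x z : X, K (x, y) - K (z, y) ≤ G * l1 (x - z : EuclideanSpace ℝ (Fin d)))
    (hKY : ∀ x, ∀ y z : Y, K (x, y) - K (x, z) ≤ G * l1 (y - z : EuclideanSpace ℝ (Fin d)))
    (hσm : ∀ i, Measurable (σ i)) (hσ : iIndepFun σ μ)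
    (hlaw : ∀ i, HasLaw (σ i) (expMeasure η⁻¹) μ) (q : ℝ) (n : ℕ) (hn : n ≤ T) :
    ∫⁻ ω, ENNReal.ofReal (Real.exp (q * ∑ t ∈ Finset.range n,
        gap η K (beliefAt σ K t ω) (block σ .play t ω))) ∂μ
      ≤ ENNReal.ofReal (Real.exp (n * (q ^ 2 * (G * D) ^ 2 / m))) := by
  induction n with
  | zero => simp
  | succ n ih =>
    have ih := ih (by omega)
    set S : Ω → ℝ := fun ω => ∑ t ∈ Finset.range n,
      gap η K (beliefAt σ K t ω) (block σ .play t ω) with hS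
    have hSm : Measurable[indexAlg σ (before d T m .play n)] S := by
      refine Finset.measurable_fun_sum (m := indexAlg σ (before d T m .play n)) _ fun t ht => ?_
      have ht' := Finset.mem_range.1 ht
      have hle : indexAlg σ (before d T m .play t) ≤ indexAlg σ (before d T m .play n) :=
        biSup_mono fun i hi => by
          rcases hi with h | ⟨h, -⟩
          · exact Or.inl (by omega)
          · exact Or.inl (by omega)
      exact measurable_gap (mα := indexAlg σ (before d T m .play n)) hη K
        ((measurable_belief_before K t).mono hle le_rfl)
        (measurable_block fun i h1 _ => Or.inl (by omega))
    have hexp : ∀ a b : ℝ, ENNReal.ofReal (Real.exp (q * (a + b)))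
        = ENNReal.ofReal (Real.exp (q * a)) * ENNReal.ofReal (Real.exp (q * b)) := fun a b => by
      rw [← ENNReal.ofReal_mul (Real.exp_pos _).le, ← Real.exp_add, mul_add]
    have hθ : Measurable[indexAlg σ (before d T m .play n)] fun ω => (S ω, beliefAt σ K n ω) :=
      Measurable.prodMk hSm (measurable_belief_before K n)
    have hV : Measurable fun p : (ℝ × (C(X, ℝ) × C(Y, ℝ))) × (Player × Fin m → Fin d → ℝ) =>
        ENNReal.ofReal (Real.exp (q * p.1.1)) *
          ENNReal.ofReal (Real.exp (q * gap η K p.1.2 p.2)) := by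
      have h1 := measurable_gap hη K (m := m)
        (θ := fun p : (ℝ × (C(X, ℝ) × C(Y, ℝ))) × (Player × Fin m → Fin d → ℝ) => p.1.2)
        measurable_fst.snd measurable_snd
      exact ((measurable_fst.fst.const_mul q).exp.ennreal_ofReal).mul
        ((h1.const_mul q).exp.ennreal_ofReal)
    have hb := lintegral_block hη hσm hσ hlaw .play (by omega : n < T) hθ hV
    simp only at hb
    simp only [Finset.sum_range_succ, hexp]
    change ∫⁻ ω, ENNReal.ofReal (Real.exp (q * S ω)) * ENNReal.ofReal (Real.exp (q *
      gap η K (beliefAt σ K n ω) (block σ .play n ω))) ∂μ ≤ _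
    rw [hb]
    calc ∫⁻ ω, ∫⁻ ξ, ENNReal.ofReal (Real.exp (q * S ω)) *
          ENNReal.ofReal (Real.exp (q * gap η K (beliefAt σ K n ω) ξ)) ∂blockLaw d m η ∂μ
        ≤ ∫⁻ ω, ENNReal.ofReal (Real.exp (q * S ω)) *
          ENNReal.ofReal (Real.exp (q ^ 2 * (G * D) ^ 2 / m)) ∂μ := by
          refine lintegral_mono fun ω => ?_
          rw [lintegral_const_mul' _ _ ENNReal.ofReal_ne_top]
          gcongr
          exact lintegral_exp_gap_le hη hm hDX hDY hG K hKX hKY _ q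
      _ = (∫⁻ ω, ENNReal.ofReal (Real.exp (q * S ω)) ∂μ) *
          ENNReal.ofReal (Real.exp (q ^ 2 * (G * D) ^ 2 / m)) :=
          lintegral_mul_const' _ _ ENNReal.ofReal_ne_top
      _ ≤ ENNReal.ofReal (Real.exp (n * (q ^ 2 * (G * D) ^ 2 / m))) *
          ENNReal.ofReal (Real.exp (q ^ 2 * (G * D) ^ 2 / m)) := by gcongr
      _ = _ := by
          rw [← ENNReal.ofReal_mul (Real.exp_pos _).le, ← Real.exp_add]
          congr 2
          push_cast
          ring

lemma measure_sum_gap_ge_le {D G : ℝ} (hη : 0 < η) (hm : 0 < m)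
    (hDX : ∀ x z : X, l1 (x - z : EuclideanSpace ℝ (Fin d)) ≤ D)
    (hDY : ∀ x z : Y, l1 (x - z : EuclideanSpace ℝ (Fin d)) ≤ D) (hG : 0 ≤ G)
    (K : C(X × Y, ℝ))
    (hKX : ∀ y, ∀ x z : X, K (x, y) - K (z, y) ≤ G * l1 (x - z : EuclideanSpace ℝ (Fin d)))
    (hKY : ∀ x, ∀ y z : Y, K (x, y) - K (x, z) ≤ G * l1 (y - z : EuclideanSpace ℝ (Fin d)))
    (hσm : ∀ i, Measurable (σ i)) (hσ : iIndepFun σ μ)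
    (hlaw : ∀ i, HasLaw (σ i) (expMeasure η⁻¹) μ) {q : ℝ} (hq : 0 < q) (ε : ℝ) :
    μ {ω | ε ≤ ∑ t ∈ Finset.range T, gap η K (beliefAt σ K t ω) (block σ .play t ω)}
      ≤ ENNReal.ofReal (Real.exp (T * (q ^ 2 * (G * D) ^ 2 / m) - q * ε)) := by
  set S : Ω → ℝ := fun ω => ∑ t ∈ Finset.range T,
    gap η K (beliefAt σ K t ω) (block σ .play t ω) with hS
  have h := lintegral_exp_sum_gap_le hη hm hDX hDY hG K hKX hKY hσm hσ hlaw q T le_rfl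
  have hle : ∀ A, indexAlg σ A ≤ ‹MeasurableSpace Ω› := fun A =>
    iSup₂_le fun i _ => (hσm i).comap_le
  have hSm : Measurable S := Finset.measurable_fun_sum _ fun t _ => measurable_gap hη K
    ((measurable_belief_before K t).mono (hle _) le_rfl)
    ((measurable_block (A := Set.univ) fun _ _ _ => Set.mem_univ _).mono (hle _) le_rfl)
  have hmk := mul_meas_ge_le_lintegral₀ (μ := μ)
    (f := fun ω => ENNReal.ofReal (Real.exp (q * S ω)))
    (hSm.const_mul q).exp.ennreal_ofReal.aemeasurable (ENNReal.ofReal (Real.exp (q * ε)))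
  have hset : {ω | ENNReal.ofReal (Real.exp (q * ε)) ≤ ENNReal.ofReal (Real.exp (q * S ω))}
      = {ω | ε ≤ S ω} := by
    ext ω
    simp only [Set.mem_ofPred_eq]
    rw [ENNReal.ofReal_le_ofReal_iff (Real.exp_pos _).le, Real.exp_le_exp,
      mul_le_mul_iff_right₀ hq]
  rw [hset] at hmk
  have h2 := hmk.trans h
  rw [sub_eq_add_neg, Real.exp_add, ENNReal.ofReal_mul (Real.exp_pos _).le, Real.exp_neg,
    ENNReal.ofReal_inv_of_pos (Real.exp_pos _), ← div_eq_mul_inv]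
  rw [ENNReal.le_div_iff_mul_le (Or.inl (by simp [Real.exp_pos]))
    (Or.inl ENNReal.ofReal_ne_top), mul_comm]
  exact h2

/-- All best responses to `θ` are unique. What is required is differentiability of the conjugates,
which implies uniqueness by `IsBest.eq_sel`. -/
def Unique (θ : C(X, ℝ) × C(Y, ℝ)) (ξ : Player × Fin m → Fin d → ℝ) : Prop :=
  ∀ j, DifferentiableAt ℝ (conj θ.1) (ξ (.x, j)) ∧ DifferentiableAt ℝ (conj θ.2) (ξ (.y, j))

lemma ae_unique (hη : 0 < η) (hσm : ∀ i, Measurable (σ i)) (hσ : iIndepFun σ μ)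
    (hlaw : ∀ i, HasLaw (σ i) (expMeasure η⁻¹) μ) (K : C(X × Y, ℝ)) :
    ∀ᵐ ω ∂μ, ∀ t < T, Unique (stateAt σ K t ω) (block σ .guess t ω) ∧
      Unique (beliefAt σ K t ω) (block σ .play t ω) := by
  have hprob := isProbabilityMeasure_expLaw (d := d) hη
  have hB : MeasurableSet {p : (C(X, ℝ) × C(Y, ℝ)) × (Player × Fin m → Fin d → ℝ) |
      Unique p.1 p.2} := by
    have e : {p : (C(X, ℝ) × C(Y, ℝ)) × (Player × Fin m → Fin d → ℝ) | Unique p.1 p.2}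
        = ⋂ j, ((fun p => (p.1.1, p.2 (.x, j))) ⁻¹'
            {p : C(X, ℝ) × (Fin d → ℝ) | DifferentiableAt ℝ (conj p.1) p.2}
          ∩ (fun p => (p.1.2, p.2 (.y, j))) ⁻¹'
            {p : C(Y, ℝ) × (Fin d → ℝ) | DifferentiableAt ℝ (conj p.1) p.2}) := by
      ext p
      simp [Unique]
    rw [e]
    refine MeasurableSet.iInter fun j => MeasurableSet.inter ?_ ?_
    · exact (measurable_fst.fst.prodMk ((measurable_pi_apply _).comp measurable_snd))
        measurableSet_differentiableAt_conj
    · exact (measurable_fst.snd.prodMk ((measurable_pi_apply _).comp measurable_snd))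
        measurableSet_differentiableAt_conj
  have hnull : ∀ θ : C(X, ℝ) × C(Y, ℝ), blockLaw d m η {ξ | ¬ Unique θ ξ} ≤ 0 := by
    intro θ
    refine le_of_eq ?_
    change ∀ᵐ ξ ∂blockLaw d m η, Unique θ ξ
    refine ae_all_iff.2 fun j => ?_
    have h1 := (measurePreserving_eval (fun _ : Player × Fin m => expLaw d η)
      (.x, j)).quasiMeasurePreserving.ae (ae_differentiableAt_conj hη θ.1)
    have h2 := (measurePreserving_eval (fun _ : Player × Fin m => expLaw d η)
      (.y, j)).quasiMeasurePreserving.ae (ae_differentiableAt_conj hη θ.2)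
    filter_upwards [h1, h2] with ξ a b
    exact ⟨a, b⟩
  refine ae_all_iff.2 fun t => ?_
  by_cases ht : t < T
  · have h1 : ∀ᵐ ω ∂μ, Unique (stateAt σ K t ω) (block σ .guess t ω) :=
      le_antisymm (measure_block_le hη hσm hσ hlaw .guess ht (measurable_state_before K t)
        hB.compl hnull) zero_le
    have h2 : ∀ᵐ ω ∂μ, Unique (beliefAt σ K t ω) (block σ .play t ω) :=
      le_antisymm (measure_block_le hη hσm hσ hlaw .play ht (measurable_belief_before K t)
        hB.compl hnull) zero_le
    filter_upwards [h1, h2] with ω a b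
    exact fun _ => ⟨a, b⟩
  · exact Filter.Eventually.of_forall fun ω h => absurd h ht

end Events


/-! ### Runs of the algorithm -/

section Run

lemma integral_empirical {d m : ℕ} (h : EuclideanSpace ℝ (Fin d) → ℝ)
    (z : Fin m → EuclideanSpace ℝ (Fin d)) : ∫ w, h w ∂empirical z = avg h z := by
  unfold empirical avg
  rw [integral_smul_measure, integral_finsetSum_measure fun j _ =>
    (integrable_dirac (by simp))]
  simp

lemma payoffRight_empirical {d m : ℕ}
    (f : EuclideanSpace ℝ (Fin d) → EuclideanSpace ℝ (Fin d) → ℝ) (z : EuclideanSpace ℝ (Fin d))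
    (y : Fin m → EuclideanSpace ℝ (Fin d)) : payoffRight f z (empirical y) = avg (f z) y :=
  integral_empirical _ _

lemma payoffLeft_empirical {d m : ℕ}
    (f : EuclideanSpace ℝ (Fin d) → EuclideanSpace ℝ (Fin d) → ℝ) (z : EuclideanSpace ℝ (Fin d))
    (x : Fin m → EuclideanSpace ℝ (Fin d)) :
    payoffLeft f (empirical x) z = avg (fun w => f w z) x :=
  integral_empirical _ _

lemma sum_Iio_val {T : ℕ} (t : Fin T) (F : ℕ → ℝ) :
    ∑ i ∈ Finset.Iio t, F i = ∑ i ∈ Finset.range t, F i := by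
  rw [← Nat.Iio_eq_range, ← Fin.map_valEmbedding_Iio, Finset.sum_map]
  rfl

variable {d T m : ℕ} {X Y : Set (EuclideanSpace ℝ (Fin d))} [Nonempty X] [Nonempty Y]
  [CompactSpace X] [CompactSpace Y]

lemma avg_lossX_eq {f : EuclideanSpace ℝ (Fin d) → EuclideanSpace ℝ (Fin d) → ℝ} {K : C(X × Y, ℝ)}
    (hK : ∀ (x : X) (y : Y), K (x, y) = f x y) {v : Fin m → Y}
    {y : Fin m → EuclideanSpace ℝ (Fin d)} (hy : ∀ j, y j = v j) (z : X) :
    (avg (lossX K) v : C(X, ℝ)) z = payoffRight f z (empirical y) := by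
  rw [avg_coe, payoffRight_empirical]
  simp only [avg, lossX_apply, hK, hy]

lemma avg_lossY_eq {f : EuclideanSpace ℝ (Fin d) → EuclideanSpace ℝ (Fin d) → ℝ} {K : C(X × Y, ℝ)}
    (hK : ∀ (x : X) (y : Y), K (x, y) = f x y) {v : Fin m → X}
    {x : Fin m → EuclideanSpace ℝ (Fin d)} (hx : ∀ j, x j = v j) (z : Y) :
    (avg (lossY K) v : C(Y, ℝ)) z = -payoffLeft f (empirical x) z := by
  rw [avg_coe, payoffLeft_empirical]
  simp only [avg, lossY_apply, hK, hx, Finset.sum_neg_distrib, smul_neg]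

lemma IsArgmin.eq_sel {h : EuclideanSpace ℝ (Fin d) → ℝ} {g : C(X, ℝ)} {s : Fin d → ℝ}
    {w : EuclideanSpace ℝ (Fin d)} (hw : IsArgmin X (fun z => h z - perturbation s z) w)
    (hg : ∀ z : X, g z = h z) (hd : DifferentiableAt ℝ (conj g) s) : w = sel g s := by
  have hb : IsBest g s ⟨w, hw.1⟩ := fun z => by
    have := hw.2 z.2
    simp only [Set.mem_ofPred_eq] at this
    rw [hg, hg]
    linarith
  exact congrArg Subtype.val (hb.eq_sel hd)

lemma IsArgmax.eq_sel {h : EuclideanSpace ℝ (Fin d) → ℝ} {g : C(X, ℝ)} {s : Fin d → ℝ}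
    {w : EuclideanSpace ℝ (Fin d)} (hw : IsArgmax X (fun z => h z + perturbation s z) w)
    (hg : ∀ z : X, g z = -h z) (hd : DifferentiableAt ℝ (conj g) s) : w = sel g s := by
  have hb : IsBest g s ⟨w, hw.1⟩ := fun z => by
    have := hw.2 z.2
    simp only [Set.mem_ofPred_eq] at this
    rw [hg, hg]
    linarith
  exact congrArg Subtype.val (hb.eq_sel hd)

section Identify

variable {f : EuclideanSpace ℝ (Fin d) → EuclideanSpace ℝ (Fin d) → ℝ} {K : C(X × Y, ℝ)}
  {s : Player → Phase → Fin T → Fin m → Fin d → ℝ} {ξg ξp : ℕ → Player × Fin m → Fin d → ℝ}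
  {x y xg yg : Fin T → Fin m → EuclideanSpace ℝ (Fin d)}

lemma state_fst_eq (hK : ∀ (x : X) (y : Y), K (x, y) = f x y) (t : Fin T)
    (h : ∀ i < t, ∀ j, y i j = pointsY (belief K ξg ξp i) (ξp i) j) (z : X) :
    (state K ξg ξp t).1 z = ∑ i ∈ Finset.Iio t, payoffRight f z (empirical (y i)) := by
  rw [state_eq_sum, Prod.fst_sum, ContinuousMap.sum_apply, ← sum_Iio_val t
    (fun i => (response K (belief K ξg ξp i) (ξp i)).1 z)]
  exact Finset.sum_congr rfl fun i hi => avg_lossX_eq hK (h i (Finset.mem_Iio.1 hi)) z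

lemma state_snd_eq (hK : ∀ (x : X) (y : Y), K (x, y) = f x y) (t : Fin T)
    (h : ∀ i < t, ∀ j, x i j = pointsX (belief K ξg ξp i) (ξp i) j) (z : Y) :
    (state K ξg ξp t).2 z = -∑ i ∈ Finset.Iio t, payoffLeft f (empirical (x i)) z := by
  rw [state_eq_sum, Prod.snd_sum, ContinuousMap.sum_apply, ← sum_Iio_val t
    (fun i => (response K (belief K ξg ξp i) (ξp i)).2 z), ← Finset.sum_neg_distrib]
  exact Finset.sum_congr rfl fun i hi => avg_lossY_eq hK (h i (Finset.mem_Iio.1 hi)) z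

/-- Whatever the optimization oracles return, where the best responses are unique a run of the
algorithm is the one determined by the measurable best responses. -/
lemma IsRun.eq_points (hK : ∀ (x : X) (y : Y), K (x, y) = f x y)
    (hg : ∀ (t : Fin T) p j, ξg t (p, j) = s p .guess t j)
    (hp : ∀ (t : Fin T) p j, ξp t (p, j) = s p .play t j)
    (hrun : IsRun X Y f s x y xg yg)
    (hU : ∀ t < T, Unique (state K ξg ξp t) (ξg t) ∧ Unique (belief K ξg ξp t) (ξp t))
    (t : Fin T) :
    (∀ j, x t j = pointsX (belief K ξg ξp t) (ξp t) j) ∧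
      ∀ j, y t j = pointsY (belief K ξg ξp t) (ξp t) j := by
  induction t using WellFoundedLT.induction with
  | ind t ih =>
  have s1 := state_fst_eq (ξg := ξg) (ξp := ξp) (y := y) hK t fun i hi => (ih i hi).2
  have s2 := state_snd_eq (ξg := ξg) (ξp := ξp) (x := x) hK t fun i hi => (ih i hi).1
  obtain ⟨u1, u2⟩ := hU t t.2
  have u2x := fun j => (u2 j).1
  have u2y := fun j => (u2 j).2
  simp only [hp] at u2x u2y
  rcases Nat.eq_zero_or_pos (t : ℕ) with h0 | h0
  · have b1 : ∀ z, (belief K ξg ξp t).1 z = 0 := fun z => by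
      simp [belief, predict, h0, state]
    have b2 : ∀ z, (belief K ξg ξp t).2 z = 0 := fun z => by
      simp [belief, predict, h0, state]
    refine ⟨fun j => ?_, fun j => ?_⟩
    · have h1 := hrun.first_x t h0 j
      simp only [pointsX, hp]
      refine IsArgmin.eq_sel (h := fun _ => 0) ?_ b1 (u2x j)
      simpa only [zero_sub] using h1
    · have h1 := hrun.first_y t h0 j
      simp only [pointsY, hp]
      refine IsArgmax.eq_sel (h := fun _ => 0) ?_ (fun z => by rw [b2, neg_zero]) (u2y j)
      simpa only [zero_add] using h1
  · have u1x := fun j => (u1 j).1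
    have u1y := fun j => (u1 j).2
    simp only [hg] at u1x u1y
    have g1 : ∀ j, xg t j = pointsX (state K ξg ξp t) (ξg t) j := fun j => by
      simp only [pointsX, hg]
      exact (hrun.guess_x t h0 j).eq_sel s1 (u1x j)
    have g2 : ∀ j, yg t j = pointsY (state K ξg ξp t) (ξg t) j := fun j => by
      simp only [pointsY, hg]
      exact (hrun.guess_y t h0 j).eq_sel s2 (u1y j)
    have b1 : ∀ z : X, (belief K ξg ξp t).1 z
        = ∑ i ∈ Finset.Iio t, payoffRight f z (empirical (y i))
          + payoffRight f z (empirical (yg t)) := fun z => by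
      rw [← s1, ← avg_lossX_eq hK g2]
      simp only [belief, predict, if_neg h0.ne']
      rfl
    have b2 : ∀ z : Y, (belief K ξg ξp t).2 z
        = -(∑ i ∈ Finset.Iio t, payoffLeft f (empirical (x i)) z
          + payoffLeft f (empirical (xg t)) z) := fun z => by
      rw [neg_add, ← s2, ← avg_lossY_eq hK g1]
      simp only [belief, predict, if_neg h0.ne']
      rfl
    refine ⟨fun j => ?_, fun j => ?_⟩
    · simp only [pointsX, hp]
      exact (hrun.play_x t h0 j).eq_sel b1 (u2x j)
    · simp only [pointsY, hp]
      exact (hrun.play_y t h0 j).eq_sel b2 (u2y j)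

/-- The duality gap of a run in terms of the cumulative losses. -/
lemma IsRun.sum_payoff_eq (hK : ∀ (x : X) (y : Y), K (x, y) = f x y)
    (hg : ∀ (t : Fin T) p j, ξg t (p, j) = s p .guess t j)
    (hp : ∀ (t : Fin T) p j, ξp t (p, j) = s p .play t j)
    (hrun : IsRun X Y f s x y xg yg)
    (hU : ∀ t < T, Unique (state K ξg ξp t) (ξg t) ∧ Unique (belief K ξg ξp t) (ξp t))
    (x₀ : X) (y₀ : Y) :
    ∑ t, (payoffLeft f (empirical (x t)) y₀ - payoffRight f x₀ (empirical (y t)))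
      = -((state K ξg ξp T).1 x₀ + (state K ξg ξp T).2 y₀) := by
  have h := hrun.eq_points hK hg hp hU
  rw [state_eq_sum, Prod.fst_sum, Prod.snd_sum, ContinuousMap.sum_apply, ContinuousMap.sum_apply,
    ← Finset.sum_add_distrib, ← Finset.sum_neg_distrib, Finset.sum_range]
  refine Finset.sum_congr rfl fun t _ => ?_
  have h1 := avg_lossX_eq hK (h t).2 x₀
  have h2 := avg_lossY_eq hK (h t).1 y₀
  change _ = -((avg (lossX K) (pointsY (belief K ξg ξp t) (ξp t)) : C(X, ℝ)) x₀
    + (avg (lossY K) (pointsX (belief K ξg ξp t) (ξp t)) : C(Y, ℝ)) y₀)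
  rw [h1, h2]
  ring

end Identify

end Run


/-! ### Payoffs with Lipschitz gradients -/

lemma l1_sub_le_l1Diam {d : ℕ} {X : Set (EuclideanSpace ℝ (Fin d))} (hX : IsCompact X)
    {x z : EuclideanSpace ℝ (Fin d)} (hx : x ∈ X) (hz : z ∈ X) : l1 (x - z) ≤ l1Diam X := by
  refine le_csSup ?_ ⟨x, hx, z, hz, rfl⟩
  have h := ((hX.prod hX).image (f := fun p => l1 (p.1 - p.2))
    (continuous_l1.comp (continuous_fst.sub continuous_snd))).bddAbove
  refine h.mono ?_
  rintro _ ⟨a, ha, b, hb, rfl⟩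
  exact ⟨(a, b), ⟨ha, hb⟩, rfl⟩

lemma hasGradientWithinAt_neg {d : ℕ} {h : EuclideanSpace ℝ (Fin d) → ℝ}
    {v x : EuclideanSpace ℝ (Fin d)} {S : Set (EuclideanSpace ℝ (Fin d))}
    (hv : HasGradientWithinAt h v S x) : HasGradientWithinAt (fun z => -h z) (-v) S x := by
  rw [hasGradientWithinAt_iff_hasFDerivWithinAt] at hv ⊢
  rw [map_neg]
  exact hv.fun_neg

/-- The regularity of the payoff `f` with partial gradients `gradX` and `gradY`. -/
structure LipschitzGradients {d : ℕ} (X Y : Set (EuclideanSpace ℝ (Fin d)))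
    (f : EuclideanSpace ℝ (Fin d) → EuclideanSpace ℝ (Fin d) → ℝ)
    (gradX gradY : EuclideanSpace ℝ (Fin d) → EuclideanSpace ℝ (Fin d) →
      EuclideanSpace ℝ (Fin d)) (G L : ℝ) : Prop where
  hasGradX : ∀ x ∈ convexHull ℝ X, ∀ y ∈ convexHull ℝ Y,
    HasGradientWithinAt (fun z => f z y) (gradX x y) (convexHull ℝ X) x
  hasGradY : ∀ x ∈ convexHull ℝ X, ∀ y ∈ convexHull ℝ Y,
    HasGradientWithinAt (fun z => f x z) (gradY x y) (convexHull ℝ Y) y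
  bound : ∀ x ∈ convexHull ℝ X, ∀ y ∈ convexHull ℝ Y,
    max (linf (gradX x y)) (linf (gradY x y)) ≤ G
  lipschitz : ∀ x ∈ convexHull ℝ X, ∀ y ∈ convexHull ℝ Y,
    ∀ x' ∈ convexHull ℝ X, ∀ y' ∈ convexHull ℝ Y,
    linf (gradX x y - gradX x' y') + linf (gradY x y - gradY x' y')
      ≤ L * l1 (x - x') + L * l1 (y - y')

namespace LipschitzGradients

variable {d m n : ℕ} {X Y : Set (EuclideanSpace ℝ (Fin d))}
  {f : EuclideanSpace ℝ (Fin d) → EuclideanSpace ℝ (Fin d) → ℝ}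
  {gradX gradY : EuclideanSpace ℝ (Fin d) → EuclideanSpace ℝ (Fin d) → EuclideanSpace ℝ (Fin d)}
  {D G L : ℝ}

lemma nonneg [Nonempty X] [Nonempty Y] (h : LipschitzGradients X Y f gradX gradY G L) : 0 ≤ G :=
  (linf_nonneg _).trans ((le_max_left _ _).trans
    (h.bound _ (subset_convexHull ℝ X (Classical.arbitrary X).2) _
      (subset_convexHull ℝ Y (Classical.arbitrary Y).2)))

lemma sub_le_left (h : LipschitzGradients X Y f gradX gradY G L)
    {x z y : EuclideanSpace ℝ (Fin d)} (hx : x ∈ X) (hz : z ∈ X) (hy : y ∈ Y) :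
    f x y - f z y ≤ G * l1 (x - z) := by
  have := sub_le_of_gradient (convex_convexHull ℝ X) (fun _ : Unit => 1)
    (h := fun _ x => f x y) (h' := fun _ x => gradX x y)
    (fun _ x hx => h.hasGradX x hx y (subset_convexHull ℝ Y hy))
    (C := G) (fun x hx k => by
      simpa using abs_coord_le_of_linf_le
        ((le_max_left _ _).trans (h.bound x hx y (subset_convexHull ℝ Y hy))) k)
    (subset_convexHull ℝ X hx) (subset_convexHull ℝ X hz)
  simpa using this

lemma sub_le_right (h : LipschitzGradients X Y f gradX gradY G L)
    {x y z : EuclideanSpace ℝ (Fin d)} (hx : x ∈ X) (hy : y ∈ Y) (hz : z ∈ Y) :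
    f x y - f x z ≤ G * l1 (y - z) := by
  have := sub_le_of_gradient (convex_convexHull ℝ Y) (fun _ : Unit => 1)
    (h := fun _ y => f x y) (h' := fun _ y => gradY x y)
    (fun _ y hy => h.hasGradY x (subset_convexHull ℝ X hx) y hy)
    (C := G) (fun y hy k => by
      simpa using abs_coord_le_of_linf_le
        ((le_max_right _ _).trans (h.bound x (subset_convexHull ℝ X hx) y hy)) k)
    (subset_convexHull ℝ Y hy) (subset_convexHull ℝ Y hz)
  simpa using this

/-- On the product of the action sets the payoff is a continuous function. -/
lemma exists_continuousMap (h : LipschitzGradients X Y f gradX gradY G L) :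
    ∃ K : C(X × Y, ℝ), ∀ (x : X) (y : Y), K (x, y) = f x y := by
  refine ⟨⟨fun p => f p.1 p.2, ?_⟩, fun _ _ => rfl⟩
  rw [continuous_iff_continuousAt]
  intro p
  rw [ContinuousAt, tendsto_iff_dist_tendsto_zero]
  have hle : ∀ q : X × Y, dist (f q.1 q.2) (f p.1 p.2)
      ≤ G * l1 (q.1 - p.1 : EuclideanSpace ℝ (Fin d))
        + G * l1 (q.2 - p.2 : EuclideanSpace ℝ (Fin d)) := by
    intro q
    have h1 := h.sub_le_left q.1.2 p.1.2 q.2.2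
    have h2 := h.sub_le_left p.1.2 q.1.2 q.2.2
    have h3 := h.sub_le_right p.1.2 q.2.2 p.2.2
    have h4 := h.sub_le_right p.1.2 p.2.2 q.2.2
    rw [l1_sub_comm] at h2 h4
    rw [Real.dist_eq, abs_le]
    constructor <;> linarith
  refine squeeze_zero (fun _ => dist_nonneg) hle ?_
  have hc : Continuous fun q : X × Y => G * l1 (q.1 - p.1 : EuclideanSpace ℝ (Fin d))
      + G * l1 (q.2 - p.2 : EuclideanSpace ℝ (Fin d)) :=
    (continuous_const.mul (continuous_l1.comp
      ((continuous_subtype_val.comp continuous_fst).sub continuous_const))).add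
    (continuous_const.mul (continuous_l1.comp
      ((continuous_subtype_val.comp continuous_snd).sub continuous_const)))
  simpa [l1] using hc.tendsto p

lemma exists_controls [Nonempty X] [Nonempty Y] [CompactSpace X] [CompactSpace Y] (hd : 0 < d)
    (hn : 0 < n) (hD : 0 < D) (hL : 0 ≤ L)
    (hDX : ∀ x z : X, l1 (x - z : EuclideanSpace ℝ (Fin d)) ≤ D)
    (hDY : ∀ x z : Y, l1 (x - z : EuclideanSpace ℝ (Fin d)) ≤ D)
    (h : LipschitzGradients X Y f gradX gradY G L) {K : C(X × Y, ℝ)}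
    (hK : ∀ (x : X) (y : Y), K (x, y) = f x y) :
    ∃ (HX : TestIndex d n → C(X, ℝ)) (HY : TestIndex d n → C(Y, ℝ)), (∀ i x, |HX i x| ≤ G) ∧
      (∀ i y, |HY i y| ≤ G) ∧ Controls m K L (2 * L * (D / n)) HX HY := by
  have hX := subset_convexHull ℝ X
  have hY := subset_convexHull ℝ Y
  obtain ⟨HY, b1, l1Y, c1⟩ := exists_test_functions (m := m) (n := n) hd hn hD hL hDX
    (f := f) (g := gradX) (fun x hx y hy => h.hasGradX x hx y (hY hy))
    (fun x hx y hy k => abs_coord_le_of_linf_le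
      ((le_max_left _ _).trans (h.bound x hx y (hY hy))) k)
    (fun x hx y hy x' hx' y' hy' k => by
      have h1 := h.lipschitz x hx y (hY hy) x' hx' y' (hY hy')
      have h2 := linf_nonneg (gradY x y - gradY x' y')
      exact abs_coord_le_of_linf_le (v := gradX x y - gradX x' y') (by linarith) k)
  obtain ⟨HX, b2, l2X, c2⟩ := exists_test_functions (m := m) (n := n) hd hn hD hL hDY
    (f := fun y x => -f x y) (g := fun y x => -gradY x y)
    (fun y hy x hx => hasGradientWithinAt_neg (h.hasGradY x (hX hx) y hy))
    (fun y hy x hx k => by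
      rw [PiLp.neg_apply, abs_neg]
      exact abs_coord_le_of_linf_le ((le_max_right _ _).trans (h.bound x (hX hx) y hy)) k)
    (fun y hy x hx y' hy' x' hx' k => by
      have h1 := h.lipschitz x (hX hx) y hy x' (hX hx') y' hy'
      have h2 := linf_nonneg (gradX x y - gradX x' y')
      have h3 := abs_coord_le_of_linf_le (v := gradY x y - gradY x' y')
        (G := L * l1 (y - y') + L * l1 (x - x')) (by linarith) k
      rw [PiLp.neg_apply, PiLp.neg_apply, neg_sub_neg, abs_sub_comm]
      exact h3)
  refine ⟨HX, HY, b2, b1, l2X, l1Y, fun y y' Λ hΛ x z => ?_, fun x x' Λ hΛ y z => ?_⟩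
  · have := c1 y y' Λ hΛ x z
    rw [ContinuousMap.sub_apply, ContinuousMap.sub_apply, avg_coe, avg_coe, avg_coe, avg_coe]
    simpa only [lossX_apply, hK] using this
  · have := c2 x x' Λ hΛ y z
    rw [ContinuousMap.sub_apply, ContinuousMap.sub_apply, avg_coe, avg_coe, avg_coe, avg_coe]
    simpa only [lossY_apply, hK] using this

end LipschitzGradients


/-! ### High probability bounds -/

section HighProbability

variable {Ω : Type*} [MeasurableSpace Ω] {μ : Measure Ω} [IsProbabilityMeasure μ] {d T : ℕ}
  {η D G L δ : ℝ} {σ : Player × Phase × Fin T × Fin T × Fin d → Ω → ℝ}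
  {X Y : Set (EuclideanSpace ℝ (Fin d))} [Nonempty X] [Nonempty Y]
  [CompactSpace X] [CompactSpace Y]

lemma two_le_log_eight_div (hδ : 0 < δ) (hδ1 : δ < 1) : 2 ≤ Real.log (8 / δ) := by
  have h1 : Real.log 8 ≤ Real.log (8 / δ) := by
    refine Real.log_le_log (by norm_num) ?_
    rw [le_div_iff₀ hδ]
    linarith
  have h2 : Real.log 8 = 3 * Real.log 2 := by
    rw [show (8 : ℝ) = 2 ^ 3 by norm_num, Real.log_pow]
    norm_num
  have h3 := Real.log_two_gt_d9
  linarith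

/-- With as many samples as rounds, the sum of the sampling errors is of the order of a single
loss. -/
lemma measure_sum_gap_ge_le_of_samples (hη : 0 < η) (hT : 0 < T)
    (hDX : ∀ x z : X, l1 (x - z : EuclideanSpace ℝ (Fin d)) ≤ D)
    (hDY : ∀ x z : Y, l1 (x - z : EuclideanSpace ℝ (Fin d)) ≤ D) (hG : 0 < G) (hD : 0 < D)
    (K : C(X × Y, ℝ))
    (hKX : ∀ y, ∀ x z : X, K (x, y) - K (z, y) ≤ G * l1 (x - z : EuclideanSpace ℝ (Fin d)))
    (hKY : ∀ x, ∀ y z : Y, K (x, y) - K (x, z) ≤ G * l1 (y - z : EuclideanSpace ℝ (Fin d)))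
    (hσm : ∀ i, Measurable (σ i)) (hσ : iIndepFun σ μ)
    (hlaw : ∀ i, HasLaw (σ i) (expMeasure η⁻¹) μ) (hδ : 0 < δ) (hδ1 : δ < 1) :
    μ {ω | 2 * (G * D) * Real.sqrt (Real.log (8 / δ))
        ≤ ∑ t ∈ Finset.range T, gap η K (beliefAt σ K t ω) (block σ .play t ω)}
      ≤ ENNReal.ofReal (δ / 8) := by
  have hl := two_le_log_eight_div hδ hδ1
  have hs := Real.sq_sqrt (show 0 ≤ Real.log (8 / δ) by linarith)
  have hs0 : 0 < Real.sqrt (Real.log (8 / δ)) := Real.sqrt_pos.2 (by linarith)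
  set s := Real.sqrt (Real.log (8 / δ))
  have hT' : (0 : ℝ) < T := by exact_mod_cast hT
  refine (measure_sum_gap_ge_le hη hT hDX hDY hG.le K hKX hKY hσm hσ hlaw
    (q := s / (G * D)) (by positivity) _).trans (le_of_eq ?_)
  have e : (T : ℝ) * ((s / (G * D)) ^ 2 * (G * D) ^ 2 / T) - s / (G * D) * (2 * (G * D) * s)
      = -Real.log (8 / δ) := by
    rw [← hs]
    field_simp
    ring
  rw [e, Real.exp_neg, Real.exp_log (by positivity), inv_div]

/-- The deviation allowed to the `n` test functions, over `T` rounds with `T` samples each. There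
is nothing to control if there is only one round. -/
noncomputable def radius (T n : ℕ) (G δ : ℝ) : ℝ :=
  if T = 1 then 0 else Real.sqrt (2 * G ^ 2 / T * Real.log (16 * T * n / δ))

lemma radius_nonneg : 0 ≤ radius T n G δ := by
  unfold radius
  split_ifs
  · exact le_rfl
  · exact Real.sqrt_nonneg _

lemma sq_radius {n : ℕ} (hT : 2 ≤ T) (hn : 0 < n) (hδ : 0 < δ) (hδ1 : δ < 1) :
    radius T n G δ ^ 2 = 2 * G ^ 2 / T * Real.log (16 * T * n / δ) := by
  rw [radius, if_neg (by omega), Real.sq_sqrt]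
  have hT' : (2 : ℝ) ≤ T := by exact_mod_cast hT
  have hn' : (1 : ℝ) ≤ n := by exact_mod_cast hn
  have : 0 ≤ Real.log (16 * T * n / δ) := by
    refine Real.log_nonneg ?_
    rw [le_div_iff₀ hδ]
    nlinarith
  positivity

lemma measure_not_typical_radius_le {ι : Type*} [Fintype ι] [Nonempty ι] (hη : 0 < η) (hT : 0 < T)
    (hG : 0 < G) {HX : ι → C(X, ℝ)} {HY : ι → C(Y, ℝ)} (hX : ∀ i x, |HX i x| ≤ G)
    (hY : ∀ i y, |HY i y| ≤ G) (hσm : ∀ i, Measurable (σ i)) (hσ : iIndepFun σ μ)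
    (hlaw : ∀ i, HasLaw (σ i) (expMeasure η⁻¹) μ) (K : C(X × Y, ℝ)) (hδ : 0 < δ) (hδ1 : δ < 1) :
    μ {ω | ¬ ∀ t ∈ Finset.Ico 1 T,
        Typical η (radius T (Fintype.card ι) G δ) HX HY (stateAt σ K t ω) (block σ .guess t ω) ∧
        Typical η (radius T (Fintype.card ι) G δ) HX HY (beliefAt σ K t ω) (block σ .play t ω)}
      ≤ ENNReal.ofReal (δ / 2) := by
  rcases (show T = 1 ∨ 2 ≤ T by omega) with rfl | hT2
  · simp
  refine (measure_not_typical_le hη hT hG radius_nonneg hX hY hσm hσ hlaw K).trans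
    (le_of_eq ?_)
  have hT' : (0 : ℝ) < T := by exact_mod_cast hT
  have hn : 0 < Fintype.card ι := Fintype.card_pos
  have hn' : (0 : ℝ) < Fintype.card ι := by exact_mod_cast hn
  rw [sq_radius hT2 hn hδ hδ1]
  have e : (T : ℝ) * (2 * G ^ 2 / T * Real.log (16 * T * Fintype.card ι / δ)) / (2 * G ^ 2)
      = Real.log (16 * T * Fintype.card ι / δ) := by
    field_simp
  rw [e, Real.exp_neg, Real.exp_log (by positivity)]
  congr 1
  field_simp
  norm_num

lemma log_card_testIndex_le (hd : 2 ≤ d) (hT : 2 ≤ T) (hδ : 0 < δ) (hδ1 : δ < 1) :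
    Real.log (16 * T * Fintype.card (TestIndex d T) / δ)
      ≤ 5 * (d ^ 2 * Real.log T + d * Real.log (8 / δ)) := by
  have hd' : (2 : ℝ) ≤ d := by exact_mod_cast hd
  have hT' : (2 : ℝ) ≤ T := by exact_mod_cast hT
  have hcard : (Fintype.card (TestIndex d T) : ℝ) = (2 * d * T + 1) ^ d * d := by
    simp [TestIndex]
  have e : 16 * (T : ℝ) * ((2 * d * T + 1) ^ d * d) / δ
      = 2 * T * d * (8 / δ) * (2 * d * T + 1) ^ d := by
    field_simp
    norm_num
  have h2 := Real.log_two_gt_d9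
  have h2' := Real.log_two_lt_d9
  have hlT : Real.log 2 ≤ Real.log T := Real.log_le_log (by norm_num) hT'
  have hld : Real.log d ≤ d - 1 := Real.log_le_sub_one_of_pos (by linarith)
  have hl := two_le_log_eight_div hδ hδ1
  have h3 : Real.log (2 * d * T + 1) ≤ 2 * Real.log 2 + Real.log d + Real.log T := by
    have : Real.log (2 * d * T + 1) ≤ Real.log (2 ^ 2 * d * T) :=
      Real.log_le_log (by positivity) (by nlinarith)
    rwa [Real.log_mul (by positivity) (by positivity), Real.log_mul (by positivity)
      (by positivity), Real.log_pow, Nat.cast_ofNat] at this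
  rw [hcard, e, Real.log_mul (by positivity) (by positivity), Real.log_pow,
    Real.log_mul (by positivity) (by positivity), Real.log_mul (by positivity) (by positivity),
    Real.log_mul (by positivity) (by positivity)]
  set t := Real.log T
  set l := Real.log (8 / δ)
  set D := (d : ℝ)
  have h4 : D * Real.log (2 * D * T + 1) ≤ D * (1.4 + (D - 1) + t) := by
    gcongr
    linarith
  have h5 : D ^ 2 * 0.69 ≤ D ^ 2 * t := by
    gcongr
    linarith
  have h6 : t * 4 ≤ t * D ^ 2 := mul_le_mul_of_nonneg_left (by nlinarith) (by linarith)
  have h7 : D * t * 2 ≤ D * t * D := mul_le_mul_of_nonneg_left (by linarith)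
    (mul_nonneg (by linarith) (by linarith))
  have h8 : D * 2 ≤ D * l := by gcongr
  have h9 : 2 * l ≤ D * l := mul_le_mul_of_nonneg_right hd' (by linarith)
  nlinarith

end HighProbability


/-! ### The choice of the parameters -/

section Parameters

variable {d T : ℕ} {D G L s : ℝ}

/-- The parameter `η` is chosen such that `2 d² D / η = 1 / (5 (L + 1))`; with a guessing error of
`L D + 2 L D / T ≤ 3 L D` in each round the last term is then of the order `T D² L`. -/
lemma bound_of_controls (hd : 2 ≤ d) (hT : 1 ≤ T) (hD : 0 < D) (hL : 0 ≤ L) (hG : 0 ≤ G)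
    (hs : 1 ≤ s) :
    2 * (G * D) * s + 8 * (10 * d ^ 2 * D * (L + 1)) * D * Real.log d + 2 * (G * D)
        + T * (4 * d ^ 2 * D / (10 * d ^ 2 * D * (L + 1)) * (L * D + 2 * L * (D / T)) ^ 2)
      ≤ T * (100 * (d ^ 2 * D ^ 2 * (L + 1) * Real.log d / T + G * D / T * s)
        + 100 * (D ^ 2 * L)) := by
  have hT' : (1 : ℝ) ≤ T := by exact_mod_cast hT
  have hd' : (2 : ℝ) ≤ d := by exact_mod_cast hd
  have hlog : 0 ≤ Real.log d := Real.log_nonneg (by linarith)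
  have hGD : 0 ≤ G * D := by positivity
  have e1 : 4 * (d : ℝ) ^ 2 * D / (10 * d ^ 2 * D * (L + 1)) = 2 / (5 * (L + 1)) := by
    field_simp
    norm_num
  have h1 : (L * D + 2 * L * (D / T)) ^ 2 ≤ 9 * (L * D ^ 2) * (L + 1) := by
    have h2 : D / T ≤ D := div_le_self hD.le hT'
    have h3 : L * D + 2 * L * (D / T) ≤ 3 * L * D := by
      have := mul_le_mul_of_nonneg_left h2 hL
      linarith
    calc (L * D + 2 * L * (D / T)) ^ 2 ≤ (3 * L * D) ^ 2 := by gcongr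
      _ = 9 * (L * D ^ 2) * L := by ring
      _ ≤ 9 * (L * D ^ 2) * (L + 1) := by gcongr; linarith
  have h4 : 2 / (5 * (L + 1)) * (L * D + 2 * L * (D / T)) ^ 2 ≤ 4 * (D ^ 2 * L) := by
    refine (mul_le_mul_of_nonneg_left h1 (by positivity)).trans ?_
    have : 2 / (5 * (L + 1)) * (9 * (L * D ^ 2) * (L + 1)) = 18 / 5 * (D ^ 2 * L) := by
      field_simp
      ring
    rw [this]
    gcongr
    norm_num
  have e2 : T * (100 * (d ^ 2 * D ^ 2 * (L + 1) * Real.log d / T + G * D / T * s)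
        + 100 * (D ^ 2 * L))
      = 100 * (d ^ 2 * D ^ 2 * (L + 1) * Real.log d) + 100 * (G * D * s)
        + T * (100 * (D ^ 2 * L)) := by
    field_simp
  rw [e1, e2]
  have h5 : (T : ℝ) * (2 / (5 * (L + 1)) * (L * D + 2 * L * (D / T)) ^ 2)
      ≤ T * (100 * (D ^ 2 * L)) := by
    refine mul_le_mul_of_nonneg_left (h4.trans ?_) (by linarith)
    gcongr
    norm_num
  have h6 : 0 ≤ (d : ℝ) ^ 2 * D ^ 2 * (L + 1) * Real.log d := by positivity
  have h7 : G * D ≤ G * D * s := le_mul_of_one_le_right hGD hs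
  linarith

/-- With typical samples the discretization error `2 L D / T` contributes at most `L D²` over all
rounds, and the deviations `r` contribute the second argument of the minimum. -/
lemma bound_of_typical {r Λ : ℝ} (hd : 2 ≤ d) (hT : 1 ≤ T) (hD : 0 < D) (hL : 0 < L)
    (hG : 0 ≤ G) (hs : 1 ≤ s) (hr : r ^ 2 ≤ 10 * G ^ 2 / T * Λ) :
    2 * (G * D) * s + 8 * (10 * d ^ 2 * D * (L + 1)) * D * Real.log d + 2 * (G * D)
        + T * (8 * d ^ 2 * D / (10 * d ^ 2 * D * (L + 1)) * (2 * r + 2 * L * (D / T)) ^ 2)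
      ≤ T * (100 * (d ^ 2 * D ^ 2 * (L + 1) * Real.log d / T + G * D / T * s)
        + 100 * (G ^ 2 * Λ / (L * T))) := by
  have hT' : (1 : ℝ) ≤ T := by exact_mod_cast hT
  have hd' : (2 : ℝ) ≤ d := by exact_mod_cast hd
  have hlog : Real.log 2 ≤ Real.log d := Real.log_le_log (by norm_num) hd'
  have h2 := Real.log_two_gt_d9
  have hGD : 0 ≤ G * D := by positivity
  have e1 : 8 * (d : ℝ) ^ 2 * D / (10 * d ^ 2 * D * (L + 1)) = 4 / (5 * (L + 1)) := by
    field_simp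
    norm_num
  have h1 : (2 * r + 2 * L * (D / T)) ^ 2
      ≤ 80 * G ^ 2 / T * Λ + 8 * (L ^ 2 * D ^ 2) / T := by
    have h3 : (D / T) ^ 2 ≤ D ^ 2 / T := by
      rw [div_pow]
      gcongr
      nlinarith
    have h4 := mul_le_mul_of_nonneg_left h3 (show 0 ≤ 8 * L ^ 2 by positivity)
    have h5 : (2 * r + 2 * L * (D / T)) ^ 2 ≤ 8 * r ^ 2 + 8 * L ^ 2 * (D / T) ^ 2 := by
      nlinarith [sq_nonneg (2 * r - 2 * L * (D / T))]
    have e2 : 8 * L ^ 2 * (D ^ 2 / T) = 8 * (L ^ 2 * D ^ 2) / T := by ring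
    have e3 : 8 * (10 * G ^ 2 / T * Λ) = 80 * G ^ 2 / T * Λ := by ring
    linarith
  have h6 : (T : ℝ) * (4 / (5 * (L + 1)) * (2 * r + 2 * L * (D / T)) ^ 2)
      ≤ 64 * (G ^ 2 * Λ / L) + 7 * (L * D ^ 2) := by
    have hG2 : 0 ≤ G ^ 2 * Λ := by
      have := (sq_nonneg r).trans hr
      have e4 : G ^ 2 * Λ = T / 10 * (10 * G ^ 2 / T * Λ) := by field_simp
      rw [e4]
      positivity
    have hLL : 4 / (5 * (L + 1)) ≤ 4 / (5 * L) := by gcongr; linarith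
    calc (T : ℝ) * (4 / (5 * (L + 1)) * (2 * r + 2 * L * (D / T)) ^ 2)
        ≤ T * (4 / (5 * L) * (80 * G ^ 2 / T * Λ + 8 * (L ^ 2 * D ^ 2) / T)) := by gcongr
      _ = 64 * (G ^ 2 * Λ / L) + 32 / 5 * (L * D ^ 2) := by
        field_simp
        ring
      _ ≤ _ := by gcongr; norm_num
  have e2 : T * (100 * (d ^ 2 * D ^ 2 * (L + 1) * Real.log d / T + G * D / T * s)
        + 100 * (G ^ 2 * Λ / (L * T)))
      = 100 * (d ^ 2 * D ^ 2 * (L + 1) * Real.log d) + 100 * (G * D * s)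
        + 100 * (G ^ 2 * Λ / L) := by
    field_simp
  rw [e1, e2]
  have h7 : G * D ≤ G * D * s := le_mul_of_one_le_right hGD hs
  have h8 : L * D ^ 2 ≤ d ^ 2 * D ^ 2 * (L + 1) * Real.log d := by
    have h9 : 1 ≤ (d : ℝ) ^ 2 * Real.log d := by
      nlinarith
    calc L * D ^ 2 ≤ (L + 1) * D ^ 2 * 1 := by nlinarith [sq_nonneg D]
      _ ≤ (L + 1) * D ^ 2 * (d ^ 2 * Real.log d) := by gcongr
      _ = _ := by ring
  have h10 : 0 ≤ L * D ^ 2 := by positivity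
  have hG2 : 0 ≤ G ^ 2 * Λ / L := by
    have := (sq_nonneg r).trans hr
    have e4 : G ^ 2 * Λ = T / 10 * (10 * G ^ 2 / T * Λ) := by field_simp
    rw [e4]
    positivity
  linarith

end Parameters

section Model

variable {Ω : Type*} [MeasurableSpace Ω] {μ : Measure Ω} [IsProbabilityMeasure μ] {d T : ℕ}
  {D G L δ : ℝ} {σ : Player × Phase × Fin T × Fin T × Fin d → Ω → ℝ}
  {X Y : Set (EuclideanSpace ℝ (Fin d))} [Nonempty X] [Nonempty Y]
  [CompactSpace X] [CompactSpace Y]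
  {f : EuclideanSpace ℝ (Fin d) → EuclideanSpace ℝ (Fin d) → ℝ}
  {gradX gradY : EuclideanSpace ℝ (Fin d) → EuclideanSpace ℝ (Fin d) → EuclideanSpace ℝ (Fin d)}

/-- The duality gap of the measurable best responses. The first argument of the minimum needs no
control of the guesses; for the second one the samples are typical. -/
lemma measure_duality_gap_not_le (hd : 2 ≤ d) (hT : 1 ≤ T)
    (hDX : ∀ x z : X, l1 (x - z : EuclideanSpace ℝ (Fin d)) ≤ D)
    (hDY : ∀ x z : Y, l1 (x - z : EuclideanSpace ℝ (Fin d)) ≤ D) (hD : 0 < D) (hL : 0 ≤ L)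
    (hG : 0 < G) (h : LipschitzGradients X Y f gradX gradY G L) {K : C(X × Y, ℝ)}
    (hK : ∀ (x : X) (y : Y), K (x, y) = f x y) (hσm : ∀ i, Measurable (σ i))
    (hσ : iIndepFun σ μ)
    (hlaw : ∀ i, HasLaw (σ i) (expMeasure (10 * (d : ℝ) ^ 2 * D * (L + 1))⁻¹) μ) (hδ : 0 < δ)
    (hδ1 : δ < 1) :
    μ {ω | ¬ ∀ (x₀ : X) (y₀ : Y),
      -((stateAt σ K T ω).1 x₀ + (stateAt σ K T ω).2 y₀)
        ≤ T * (100 * (d ^ 2 * D ^ 2 * (L + 1) * Real.log d / T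
              + G * D / T * Real.sqrt (Real.log (8 / δ)))
          + 100 * min (D ^ 2 * L)
              ((d ^ 2 * G ^ 2 * Real.log T + d * G ^ 2 * Real.log (8 / δ)) / (L * T)))}
      ≤ ENNReal.ofReal δ := by
  set η : ℝ := 10 * (d : ℝ) ^ 2 * D * (L + 1) with hηdef
  have hd0 : (0 : ℝ) < d := by exact_mod_cast (by omega : 0 < d)
  have hT0 : (0 : ℝ) < T := by exact_mod_cast hT
  have hη : 0 < η := by positivity
  have hl := two_le_log_eight_div hδ hδ1
  have hs : 1 ≤ Real.sqrt (Real.log (8 / δ)) := Real.one_le_sqrt.2 (by linarith)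
  have hKX : ∀ y, ∀ x z : X, K (x, y) - K (z, y) ≤ G * l1 (x - z : EuclideanSpace ℝ (Fin d)) :=
    fun y x z => by
      rw [hK, hK]
      exact h.sub_le_left x.2 z.2 y.2
  have hKY : ∀ x, ∀ y z : Y, K (x, y) - K (x, z) ≤ G * l1 (y - z : EuclideanSpace ℝ (Fin d)) :=
    fun x y z => by
      rw [hK, hK]
      exact h.sub_le_right x.2 y.2 z.2
  obtain ⟨HX, HY, hX, hY, hC⟩ := h.exists_controls (m := T) (n := T) (by omega) hT hD hL hDX hDY hK
  have he : 0 ≤ 2 * L * (D / T) := by positivity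
  have hgap := measure_sum_gap_ge_le_of_samples hη hT hDX hDY hG hD K hKX hKY hσm hσ hlaw hδ hδ1
  rcases le_or_gt (D ^ 2 * L)
    ((d ^ 2 * G ^ 2 * Real.log T + d * G ^ 2 * Real.log (8 / δ)) / (L * T)) with hmin | hmin
  · rw [min_eq_left hmin]
    refine (measure_mono ?_).trans (hgap.trans (ENNReal.ofReal_le_ofReal (by linarith)))
    intro ω hω
    simp only [Set.mem_ofPred_eq] at hω ⊢
    by_contra hc
    rw [not_le] at hc
    refine hω fun x₀ y₀ => ?_
    have h1 := duality_gap_le_of_controls hη hd hDX hDY hG.le hT hL he K hKX hKY hC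
      (fun i => block σ .guess i ω) (fun i => block σ .play i ω) T hT x₀ y₀
    have h2 := bound_of_controls hd hT hD hL hG.le hs
    refine h1.trans (le_trans ?_ h2)
    gcongr
  · have hL0 : 0 < L := by
      -- for `L = 0` both arguments of the minimum are `0`
      rcases hL.eq_or_lt with rfl | hL0
      · simp at hmin
      · exact hL0
    rw [min_eq_right hmin.le]
    have : Nonempty (TestIndex d T) := ⟨(fun _ => 0, ⟨0, by omega⟩)⟩
    have htyp := measure_not_typical_radius_le hη hT hG hX hY hσm hσ hlaw K hδ hδ1
    set r := radius T (Fintype.card (TestIndex d T)) G δ with hr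
    set Λ := d ^ 2 * Real.log T + d * Real.log (8 / δ) with hΛ
    have hrΛ : r ^ 2 ≤ 10 * G ^ 2 / T * Λ := by
      rcases (show T = 1 ∨ 2 ≤ T by omega) with h1 | hT2
      · rw [hr, radius, if_pos h1, hΛ, h1]
        have : 0 ≤ d * Real.log (8 / δ) := by
          have : 0 ≤ Real.log (8 / δ) := by linarith
          positivity
        rw [Nat.cast_one, Real.log_one, mul_zero, zero_add, zero_pow two_ne_zero]
        positivity
      · rw [hr, sq_radius hT2 Fintype.card_pos hδ hδ1]
        calc 2 * G ^ 2 / T * Real.log (16 * T * Fintype.card (TestIndex d T) / δ)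
            ≤ 2 * G ^ 2 / T * (5 * Λ) := by
              gcongr
              exact log_card_testIndex_le hd hT2 hδ hδ1
          _ = 10 * G ^ 2 / T * Λ := by ring
    have hsmall : 8 * (2 * (d : ℝ) ^ 2 * D / η) ^ 2 * L ^ 2 ≤ 1 := by
      have e1 : 2 * (d : ℝ) ^ 2 * D / η = 1 / (5 * (L + 1)) := by
        rw [hηdef]
        field_simp
        norm_num
      rw [e1, div_pow, one_pow, mul_one_div, div_mul_eq_mul_div, div_le_one (by positivity)]
      nlinarith
    have e2 : (d ^ 2 * G ^ 2 * Real.log T + d * G ^ 2 * Real.log (8 / δ)) / (L * T)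
        = G ^ 2 * Λ / (L * T) := by
      rw [hΛ]
      ring
    rw [e2]
    refine (measure_mono ?_).trans ((measure_union_le _ _).trans ((add_le_add hgap htyp).trans ?_))
    · intro ω hω
      simp only [Set.mem_union, Set.mem_ofPred_eq] at hω ⊢
      by_contra hc
      rw [not_or, not_le, not_not] at hc
      refine hω fun x₀ y₀ => ?_
      have h1 := duality_gap_le_of_typical hη hd hDX hDY hG.le hT hL he radius_nonneg hsmall K
        hKX hKY hC (fun i => block σ .guess i ω) (fun i => block σ .play i ω) T hT
        (fun t ht => (hc.2 t ht).1) (fun t ht => (hc.2 t ht).2) x₀ y₀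
      have h2 := bound_of_typical hd hT hD hL0 hG.le hs hrΛ
      refine h1.trans (le_trans ?_ h2)
      gcongr
      exact hc.1.le
    · rw [← ENNReal.ofReal_add (by positivity) (by positivity)]
      exact ENNReal.ofReal_le_ofReal (by linarith)

end Model


/-! ### Constant payoffs -/

lemma IsRun.x_mem {d T m : ℕ} {X Y : Set (EuclideanSpace ℝ (Fin d))}
    {f : EuclideanSpace ℝ (Fin d) → EuclideanSpace ℝ (Fin d) → ℝ}
    {s : Player → Phase → Fin T → Fin m → Fin d → ℝ}
    {x y xg yg : Fin T → Fin m → EuclideanSpace ℝ (Fin d)} (h : IsRun X Y f s x y xg yg)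
    (t : Fin T) (j : Fin m) : x t j ∈ X := by
  rcases Nat.eq_zero_or_pos (t : ℕ) with h0 | h0
  · exact (h.first_x t h0 j).1
  · exact (h.play_x t h0 j).1

lemma IsRun.y_mem {d T m : ℕ} {X Y : Set (EuclideanSpace ℝ (Fin d))}
    {f : EuclideanSpace ℝ (Fin d) → EuclideanSpace ℝ (Fin d) → ℝ}
    {s : Player → Phase → Fin T → Fin m → Fin d → ℝ}
    {x y xg yg : Fin T → Fin m → EuclideanSpace ℝ (Fin d)} (h : IsRun X Y f s x y xg yg)
    (t : Fin T) (j : Fin m) : y t j ∈ Y := by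
  rcases Nat.eq_zero_or_pos (t : ℕ) with h0 | h0
  · exact (h.first_y t h0 j).1
  · exact (h.play_y t h0 j).1

/-- If the gradients vanish, the payoff is constant and there is no duality gap. -/
lemma IsRun.sum_payoff_eq_zero {d T m : ℕ} {X Y : Set (EuclideanSpace ℝ (Fin d))}
    {f : EuclideanSpace ℝ (Fin d) → EuclideanSpace ℝ (Fin d) → ℝ}
    {gradX gradY : EuclideanSpace ℝ (Fin d) → EuclideanSpace ℝ (Fin d) → EuclideanSpace ℝ (Fin d)}
    {L : ℝ} (hf : LipschitzGradients X Y f gradX gradY 0 L)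
    {s : Player → Phase → Fin T → Fin m → Fin d → ℝ}
    {x y xg yg : Fin T → Fin m → EuclideanSpace ℝ (Fin d)} (h : IsRun X Y f s x y xg yg)
    {x₀ y₀ : EuclideanSpace ℝ (Fin d)} (hx₀ : x₀ ∈ X) (hy₀ : y₀ ∈ Y) :
    ∑ t, (payoffLeft f (empirical (x t)) y₀ - payoffRight f x₀ (empirical (y t))) = 0 := by
  refine Finset.sum_eq_zero fun t _ => ?_
  have h1 : ∀ j, f (x t j) y₀ = f x₀ y₀ := fun j => by
    have := hf.sub_le_left (h.x_mem t j) hx₀ hy₀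
    have := hf.sub_le_left hx₀ (h.x_mem t j) hy₀
    linarith
  have h2 : ∀ j, f x₀ (y t j) = f x₀ y₀ := fun j => by
    have := hf.sub_le_right hx₀ (h.y_mem t j) hy₀
    have := hf.sub_le_right hx₀ hy₀ (h.y_mem t j)
    linarith
  rw [payoffLeft_empirical, payoffRight_empirical]
  simp only [avg, h1, h2, sub_self]

lemma bound_nonneg {d T : ℕ} {D G L δ : ℝ} (hD : 0 < D) (hL : 0 ≤ L)
    (hG : 0 ≤ G) (hδ : 0 < δ) (hδ1 : δ < 1) :
    0 ≤ 100 * ((d : ℝ) ^ 2 * D ^ 2 * (L + 1) * Real.log d / T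
          + G * D / T * Real.sqrt (Real.log (8 / δ)))
        + 100 * min (D ^ 2 * L)
          (((d : ℝ) ^ 2 * G ^ 2 * Real.log T + d * G ^ 2 * Real.log (8 / δ)) / (L * T)) := by
  have h1 := two_le_log_eight_div hδ hδ1
  have h2 : 0 ≤ Real.log (8 / δ) := by linarith
  have h3 : 0 ≤ Real.log d := Real.log_natCast_nonneg d
  have h4 : 0 ≤ Real.log T := Real.log_natCast_nonneg T
  have h5 := le_min (show 0 ≤ D ^ 2 * L by positivity)
    (show 0 ≤ ((d : ℝ) ^ 2 * G ^ 2 * Real.log T + d * G ^ 2 * Real.log (8 / δ)) / (L * T) by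
      positivity)
  positivity


end OFTPL


theorem mainTheorem12 :
    ∃ C : ℝ, 0 < C ∧
    ∀ (d T : ℕ), 2 ≤ d → 1 ≤ T →
    ∀ (X Y : Set (EuclideanSpace ℝ (Fin d))), IsCompact X → IsCompact Y →
    ∀ (f : EuclideanSpace ℝ (Fin d) → EuclideanSpace ℝ (Fin d) → ℝ)
      (gradX gradY : EuclideanSpace ℝ (Fin d) → EuclideanSpace ℝ (Fin d) →
        EuclideanSpace ℝ (Fin d))
      (D G L η δ : ℝ),
    D = max (OFTPL.l1Diam X) (OFTPL.l1Diam Y) → 0 < D → 0 ≤ L →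
    (∀ x ∈ convexHull ℝ X, ∀ y ∈ convexHull ℝ Y,
      HasGradientWithinAt (fun z => f z y) (gradX x y) (convexHull ℝ X) x) →
    (∀ x ∈ convexHull ℝ X, ∀ y ∈ convexHull ℝ Y,
      HasGradientWithinAt (fun z => f x z) (gradY x y) (convexHull ℝ Y) y) →
    (∀ x ∈ convexHull ℝ X, ∀ y ∈ convexHull ℝ Y,
      max (OFTPL.linf (gradX x y)) (OFTPL.linf (gradY x y)) ≤ G) →
    (∀ x ∈ convexHull ℝ X, ∀ y ∈ convexHull ℝ Y,
      ∀ x' ∈ convexHull ℝ X, ∀ y' ∈ convexHull ℝ Y,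
      OFTPL.linf (gradX x y - gradX x' y') + OFTPL.linf (gradY x y - gradY x' y')
        ≤ L * OFTPL.l1 (x - x') + L * OFTPL.l1 (y - y')) →
    η = 10 * (d : ℝ) ^ 2 * D * (L + 1) →
    0 < δ → δ < 1 →
    ∀ (Ω : Type*) [MeasurableSpace Ω] (μ : Measure Ω) [IsProbabilityMeasure μ]
      -- all coordinates of all perturbation vectors are i.i.d. exponential with mean `η`
      (σ : OFTPL.Player × OFTPL.Phase × Fin T × Fin T × Fin d → Ω → ℝ),
    iIndepFun σ μ →
    (∀ i, HasLaw (σ i) (expMeasure η⁻¹) μ) →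
    ∀ (x y xg yg : Ω → Fin T → Fin T → EuclideanSpace ℝ (Fin d)),
    (∀ᵐ ω ∂μ, OFTPL.IsRun X Y f (fun p q t j k => σ (p, q, t, j, k) ω)
      (x ω) (y ω) (xg ω) (yg ω)) →
    μ {ω | ¬ ∀ x₀ ∈ X, ∀ y₀ ∈ Y,
      (1 / (T : ℝ)) * ∑ t, (OFTPL.payoffLeft f (OFTPL.empirical (x ω t)) y₀
          - OFTPL.payoffRight f x₀ (OFTPL.empirical (y ω t)))
        ≤ C * ((d : ℝ) ^ 2 * D ^ 2 * (L + 1) * Real.log d / T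
              + G * D / T * Real.sqrt (Real.log (8 / δ)))
          + C * min (D ^ 2 * L)
              (((d : ℝ) ^ 2 * G ^ 2 * Real.log T + d * G ^ 2 * Real.log (8 / δ)) / (L * T))}
      ≤ ENNReal.ofReal δ := by
  refine ⟨100, by norm_num, ?_⟩
  intro d T hd hT X Y hX hY f gradX gradY D G L η δ hDdef hD hL hgX hgY hbound hlip hη hδ hδ1 Ω _ μ
    _ σ hσ hlaw x y xg yg hrun
  rcases X.eq_empty_or_nonempty with rfl | hXne
  · simp
  rcases Y.eq_empty_or_nonempty with rfl | hYne
  · simp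
  have := hXne.to_subtype
  have := hYne.to_subtype
  have := isCompact_iff_compactSpace.1 hX
  have := isCompact_iff_compactSpace.1 hY
  have h : OFTPL.LipschitzGradients X Y f gradX gradY G L := ⟨hgX, hgY, hbound, hlip⟩
  have hDX : ∀ x z : X, OFTPL.l1 (x - z : EuclideanSpace ℝ (Fin d)) ≤ D := fun x z =>
    (OFTPL.l1_sub_le_l1Diam hX x.2 z.2).trans (hDdef ▸ le_max_left _ _)
  have hDY : ∀ x z : Y, OFTPL.l1 (x - z : EuclideanSpace ℝ (Fin d)) ≤ D := fun x z =>
    (OFTPL.l1_sub_le_l1Diam hY x.2 z.2).trans (hDdef ▸ le_max_right _ _)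
  have hT0 : (0 : ℝ) < T := by exact_mod_cast hT
  rcases h.nonneg.eq_or_lt with rfl | hG
  · -- the deviation bounds divide by `G`
    have h0 : ∀ᵐ ω ∂μ, ∀ x₀ ∈ X, ∀ y₀ ∈ Y,
        ∑ t, (OFTPL.payoffLeft f (OFTPL.empirical (x ω t)) y₀
          - OFTPL.payoffRight f x₀ (OFTPL.empirical (y ω t))) = 0 := by
      filter_upwards [hrun] with ω hr x₀ hx₀ y₀ hy₀
      exact hr.sum_payoff_eq_zero h hx₀ hy₀
    refine (le_of_eq (ae_iff.1 ?_)).trans zero_le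
    filter_upwards [h0] with ω hω x₀ hx₀ y₀ hy₀
    rw [hω x₀ hx₀ y₀ hy₀, mul_zero]
    exact OFTPL.bound_nonneg hD hL le_rfl hδ hδ1
  obtain ⟨K, hK⟩ := h.exists_continuousMap
  -- `HasLaw` gives measurability up to null sets only
  let σ' : OFTPL.Player × OFTPL.Phase × Fin T × Fin T × Fin d → Ω → ℝ :=
    fun i => (hlaw i).aemeasurable.mk (σ i)
  have hae : ∀ i, σ i =ᵐ[μ] σ' i := fun i => (hlaw i).aemeasurable.ae_eq_mk
  have hσm : ∀ i, Measurable (σ' i) := fun i => (hlaw i).aemeasurable.measurable_mk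
  have hσ' : iIndepFun σ' μ := hσ.congr hae
  have hlaw' : ∀ i, HasLaw (σ' i) (expMeasure η⁻¹) μ := fun i => (hlaw i).congr (hae i).symm
  have hη0 : 0 < η := by
    have : (0 : ℝ) < d := by exact_mod_cast (by omega : 0 < d)
    rw [hη]
    positivity
  have hU := OFTPL.ae_unique hη0 hσm hσ' hlaw' K
  subst hη
  refine (measure_mono_ae ?_).trans (OFTPL.measure_duality_gap_not_le hd hT hDX hDY hD hL hG h hK
    hσm hσ' hlaw' hδ hδ1)
  filter_upwards [hrun, hU, ae_all_iff.2 hae] with ω hr hu he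
  refine fun hω hb => hω fun x₀ hx₀ y₀ hy₀ => ?_
  have e := hr.sum_payoff_eq hK (ξg := fun i => OFTPL.block σ' .guess i ω)
    (ξp := fun i => OFTPL.block σ' .play i ω)
    (fun t p j => by funext k; simp [OFTPL.block, he])
    (fun t p j => by funext k; simp [OFTPL.block, he]) hu ⟨x₀, hx₀⟩ ⟨y₀, hy₀⟩
  rw [one_div, inv_mul_le_iff₀ hT0]
  simp only at e
  rw [e]
  exact hb ⟨x₀, hx₀⟩ ⟨y₀, hy₀⟩
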